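/- **Setting.** Let $Q_A,Q_B$ be disjoint finite sets and $Q=Q_A\cup Q_B$. A process template $U\in\{A,B\}$ has an initial state $\mathrm{init}_U\in Q_U$ and a finite guarded transition relation $\delta_U\subseteq Q_U\times\mathcal P(Q)\times Q_U$; write $|U|=|Q_U|$. (Neither totality of $\delta_U$ nor any restriction on the guards is required.) The disjunctive system $A\|B^n$ has one $A$-process and $n$ $B$-processes. Its configurations are pairs $(q_A,\vec c)$ with $q_A\in Q_A$ and $\vec c:Q_B\to\mathbb N_0$, where $\vec c(q)$ is the number of $B$-processes in state $q$. The initial configuration has $q_A=\mathrm{init}_A$, $\vec c(\mathrm{init}_B)=n$ and $\vec c(q)=0$ for $q\ne\mathrm{init}_B$. There are two kinds of transitions. * The $A$-process takes $(q_A,g,q_A')\in\delta_A$, leaving $\vec c$ unchanged, provided $\vec c(q)\ge 1$ for some $q\in g\cap Q_B$. * A $B$-process takes $(q_i,g,q_j)\in\delta_B$, where $\vec c(q_i)\ge 1$, so that $\vec c$ becomes $\vec c-\vec u_{q_i}+\vec u_{q_j}$ (with $\vec u_q$ the unit vector of $q$) and $q_A$ is unchanged, provided some other process is in a state of $g$,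 that is: $q_A\in g$, or $\vec c(q)\ge1$ for some $q\in g\cap Q_B$ with $q\neq q_i$, or $q_i\in g$ and $\vec c(q_i)\ge 2$. A configuration is deadlocked if it has no outgoing transition. *Deadlock detection in disjunctive systems* is the problem: given $A$ and $B$, is there an $n\ge 1$ such that a deadlocked configuration of $A\|B^n$ is reachable from its initial configuration? An instance is written as a binary word that lists, in self-delimiting unary, $|A|$, $|B|$ and the (numbers of the) initial states, followed by the lists of transitions of $A$ and $B$; each transition is given by the unary numbers of its source and target and the characteristic bit vector (of length $|A|+|B|$) of its guard. **Theorem.** Deadlock detection in disjunctive systems is decidable in NEXPTIME: there are a nondeterministic (multi-stack) Turing machine and a polynomial $p$ such that on the encoding of every pair $(A,B)$, of length $\ell$, every computation halts after at most $2^{p(\ell)}$ steps, and some computation accepts if and only if there is an $n\ge 1$ for which $A\|B^n$ has a reachable deadlocked configuration. -/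

import Mathlib

/-! ### Disjunctive systems and their counter systems -/

/-- A process template with local states `S`, whose guards are sets of states of the whole system
(`Q` is the type of all local states of all templates). The guard set of the template is the set of
guards that occur in `δ`. The transition relation is not required to be total. -/
structure ProcessTemplate (S Q : Type) where
  /-- the initial local state -/
  init : S
  /-- the guarded transition relation: triples (source, guard, target) -/
  δ : Finset (S × Finset Q × S)

/-- A configuration `(q_A, c)`: the state of the single `A`-process, and for every local state of
`B` the number of `B`-processes that are currently in it. -/
structure Config (QA QB : Type) where
  /-- the local state of the `A`-process -/
  qA : QA
  /-- the number of `B`-processes in each local state -/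
  c : QB → ℕ

namespace Config

variable {QA QB : Type}

/-- The guard `g` of a transition of the `A`-process is satisfied: some `B`-process is in `g`. -/
def SatA (s : Config QA QB) (g : Finset (QA ⊕ QB)) : Prop :=
  ∃ k, Sum.inr k ∈ g ∧ 1 ≤ s.c k

/-- The guard `g` of a transition of a `B`-process that is in state `i` is satisfied: the
`A`-process is in `g`, or another `B`-process is in a different state of `g`, or another
`B`-process is in the same state `i` and `i` belongs to `g`. -/
def SatB (s : Config QA QB) (i : QB) (g : Finset (QA ⊕ QB)) : Prop :=
  (1 ≤ s.c i ∧ Sum.inl s.qA ∈ g) ∨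
  (1 ≤ s.c i ∧ ∃ k, Sum.inr k ∈ g ∧ k ≠ i ∧ 1 ≤ s.c k) ∨
  (Sum.inr i ∈ g ∧ 2 ≤ s.c i)

end Config

section CounterSystem

variable {QA QB : Type} [DecidableEq QB]

/-- The transition relation of the counter system of `A` and `B`: either the `A`-process or one
`B`-process takes a local transition whose guard is satisfied. -/
def CounterStep (A : ProcessTemplate QA (QA ⊕ QB)) (B : ProcessTemplate QB (QA ⊕ QB))
    (s s' : Config QA QB) : Prop :=
  (s'.c = s.c ∧ ∃ g, (s.qA, g, s'.qA) ∈ A.δ ∧ s.SatA g) ∨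
  (s'.qA = s.qA ∧ ∃ i g j, (i, g, j) ∈ B.δ ∧ 1 ≤ s.c i ∧ s.SatB i g ∧
    s'.c = s.c - Pi.single i 1 + Pi.single j 1)

/-- The initial configuration of `A ‖ Bⁿ`. -/
def initialConfig (A : ProcessTemplate QA (QA ⊕ QB)) (B : ProcessTemplate QB (QA ⊕ QB)) (n : ℕ) :
    Config QA QB :=
  ⟨A.init, Pi.single B.init n⟩

/-- A configuration is deadlocked if no transition leaves it. -/
def Deadlocked (A : ProcessTemplate QA (QA ⊕ QB)) (B : ProcessTemplate QB (QA ⊕ QB))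
    (s : Config QA QB) : Prop :=
  ¬ ∃ s', CounterStep A B s s'

/-- For some number `n ≥ 1` of `B`-processes, the system `A ‖ Bⁿ` can reach a deadlocked
configuration. (For `n = 0` no guard can ever be satisfied.) -/
def HasReachableDeadlock (A : ProcessTemplate QA (QA ⊕ QB)) (B : ProcessTemplate QB (QA ⊕ QB)) :
    Prop :=
  ∃ n : ℕ, 1 ≤ n ∧ ∃ s, Relation.ReflTransGen (CounterStep A B) (initialConfig A B n) s ∧
    Deadlocked A B s

end CounterSystem

/-! ### Finite descriptions of disjunctive systems as words -/

/-- A finite description of a pair of process templates `A`, `B`: the local states are numbered,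
and the transitions are listed. -/
structure DisjSystem where
  /-- the number `|A|` of local states of `A` -/
  sizeA : ℕ
  /-- the number `|B|` of local states of `B` -/
  sizeB : ℕ
  /-- the initial state of `A` -/
  initA : Fin sizeA
  /-- the initial state of `B` -/
  initB : Fin sizeB
  /-- the transitions of `A` -/
  transA : List (Fin sizeA × Finset (Fin sizeA ⊕ Fin sizeB) × Fin sizeA)
  /-- the transitions of `B` -/
  transB : List (Fin sizeB × Finset (Fin sizeA ⊕ Fin sizeB) × Fin sizeB)

namespace DisjSystem

/-- The template `A` that is described. -/
def A (D : DisjSystem) : ProcessTemplate (Fin D.sizeA) (Fin D.sizeA ⊕ Fin D.sizeB) :=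
  ⟨D.initA, D.transA.toFinset⟩

/-- The template `B` that is described. -/
def B (D : DisjSystem) : ProcessTemplate (Fin D.sizeB) (Fin D.sizeA ⊕ Fin D.sizeB) :=
  ⟨D.initB, D.transB.toFinset⟩

/-- The deadlock detection problem: does some `A ‖ Bⁿ` reach a deadlocked configuration? -/
def HasDeadlock (D : DisjSystem) : Prop :=
  HasReachableDeadlock D.A D.B

/-- The self-delimiting unary code `1ᵏ0` of a number. As the states of a template are given
explicitly, unary and binary state numbers are polynomially equivalent here. -/
def encNat (k : ℕ) : List Bool :=
  List.replicate k true ++ [false]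

/-- A guard is encoded by its characteristic vector of length `|A| + |B|`. -/
def encGuard {a b : ℕ} (g : Finset (Fin a ⊕ Fin b)) : List Bool :=
  (List.ofFn fun i : Fin a => decide (Sum.inl i ∈ g)) ++
    List.ofFn fun j : Fin b => decide (Sum.inr j ∈ g)

/-- The code of a transition: source, target, guard. -/
def encTrans {a b m : ℕ} (t : Fin m × Finset (Fin a ⊕ Fin b) × Fin m) : List Bool :=
  encNat t.1 ++ encNat t.2.2 ++ encGuard t.2.1

/-- The code of a list of transitions: every transition is announced by a `1`, and the list ends
with a `0`. -/
def encTransList {a b m : ℕ} (l : List (Fin m × Finset (Fin a ⊕ Fin b) × Fin m)) : List Bool :=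
  (l.flatMap fun t => true :: encTrans t) ++ [false]

/-- The binary word that describes the system. -/
def encode (D : DisjSystem) : List Bool :=
  encNat D.sizeA ++ encNat D.sizeB ++ encNat D.initA ++ encNat D.initB ++
    encTransList D.transA ++ encTransList D.transB

end DisjSystem

/-! ### Nondeterministic Turing machines and NEXPTIME -/

/-- A nondeterministic Turing machine on binary inputs: Mathlib's multi-stack Turing machine model
`Turing.TM2` (with finitely many stacks, finite alphabets, labels and internal states), but with two
programs; in every step one of the two is chosen nondeterministically. -/
structure NTM where
  /-- the stacks -/
  K : Type
  [decEqK : DecidableEq K]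
  [finK : Fintype K]
  /-- the stack alphabets -/
  Γ : K → Type
  [finΓ : ∀ k, Fintype (Γ k)]
  /-- the labels -/
  Λ : Type
  [finΛ : Fintype Λ]
  /-- the internal states -/
  σ : Type
  [finσ : Fintype σ]
  /-- the input stack -/
  k₀ : K
  /-- the symbols that represent the input bits -/
  inputSymbol : Bool → Γ k₀
  /-- the initial label -/
  main : Λ
  /-- the initial internal state -/
  initialState : σ
  /-- the accepting internal states -/
  accepting : Set σ
  /-- the two programs -/
  program : Bool → Λ → Turing.TM2.Stmt Γ Λ σ

namespace NTM

/-- The configurations of the machine: the current label (`none` if it has halted), the internal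
state, and the contents of the stacks. -/
abbrev Cfg (M : NTM) : Type :=
  Turing.TM2.Cfg M.Γ M.Λ M.σ

/-- One step of the machine, by either of its two programs. -/
def Step (M : NTM) (c d : M.Cfg) : Prop :=
  letI := M.decEqK
  ∃ choice : Bool, d ∈ Turing.TM2.step (M.program choice) c

/-- Some computation leads from `c` to `d` in exactly `k` steps. -/
def StepsTo (M : NTM) : ℕ → M.Cfg → M.Cfg → Prop
  | 0, c, d => c = d
  | k + 1, c, d => ∃ e, M.Step c e ∧ M.StepsTo k e d

/-- The initial configuration on input `w`: the word is on the input stack (its first letter on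
top), and all other stacks are empty. -/
def init (M : NTM) (w : List Bool) : M.Cfg :=
  letI := M.decEqK
  { l := some M.main
    var := M.initialState
    stk := Function.update (fun _ => []) M.k₀ (w.map M.inputSymbol) }

/-- Every computation on input `w` has at most `T` steps (so all of them halt). -/
def HaltsWithin (M : NTM) (w : List Bool) (T : ℕ) : Prop :=
  ∀ k c, M.StepsTo k (M.init w) c → k ≤ T

/-- Some computation on input `w` halts in an accepting state. -/
def Accepts (M : NTM) (w : List Bool) : Prop :=
  ∃ k c, M.StepsTo k (M.init w) c ∧ c.l = none ∧ c.var ∈ M.accepting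

end NTM

/-- The decision problem `P`, with instances encoded as binary words by `enc`, is in NEXPTIME: there
are a nondeterministic Turing machine and a polynomial `p` such that on the code of every instance
`x`, of length `ℓ`, all computations halt within `2 ^ p(ℓ)` steps, and some computation accepts iff
`P x` holds. -/
def InNEXPTIME {α : Type} (enc : α → List Bool) (P : α → Prop) : Prop :=
  ∃ (M : NTM) (p : Polynomial ℕ), ∀ x : α,
    M.HaltsWithin (enc x) (2 ^ p.eval (enc x).length) ∧ (M.Accepts (enc x) ↔ P x)

/-! ### Relations: sequences and shortest paths -/

/-! Whether a configuration is deadlocked depends only on the state of the `A`-process and on which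
counters are at least 1 and which are at least 2. So it suffices to prune a run to few processes
while keeping these data at its end. Give the `B`-processes identities and group them by the state
in which they end. A group with a single member is kept. In a larger group, for every state `r` that
it visits, take a process that follows the first member to reach `r`, waits in `r` up to the last
moment at which a member is there, and then follows that member. All its moves are moves of original
processes, and it is in `r` whenever some member is, so it can witness every guard that a member in
`r` witnessed. Two copies of it keep final counters at least 2. This yields the cutoff `n ≤ 2 |B|²`
(`exists_pruned`, `HasReachableDeadlock.exists_le`). With `n` processes there are at most `|A| (n +
1) ^ |B|` configurations, so cutting cycles out of a run leaves fewer steps than that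
(`exists_short_run`), which is `2 ^ O(ℓ²)`.

The machine guesses `n`, guesses a run while storing only the current counters in unary, and checks
that no transition is enabled at the end. Soundness needs no bound on `n` or on the run; the bounds
only show that some accepting computation is short. Since the guessing could go on forever, a
deterministic preamble puts `16 ^ ℓ²` letters on a clock stack, and every later step consumes one of
them (`clockedNTM_spec`, `DisjSystem.time_le`).

To keep the machine tractable, it is compiled from structured programs with a big-step semantics
`Exec`. Their flowcharts have the same executions with the same numbers of steps (`Exec.steps`,
`Prog.Steps.exec`). The simulation is analysed for lists of numbers (`Sim.main_sound`,
`Sim.main_complete`), and `DisjSystem.rawStep_iff` relates these lists to the counter system. -/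

theorem Relation.ReflTransGen.exists_seq {α : Type*} {r : α → α → Prop} {a b : α}
    (h : Relation.ReflTransGen r a b) :
    ∃ (T : ℕ) (x : ℕ → α), x 0 = a ∧ x T = b ∧ ∀ t < T, r (x t) (x (t + 1)) := by
  induction h with
  | refl => exact ⟨0, fun _ => a, rfl, rfl, by simp⟩
  | @tail b c _ hbc ih =>
    obtain ⟨T, x, h0, hT, hs⟩ := ih
    refine ⟨T + 1, fun t => if t ≤ T then x t else c, by simpa using h0, by simp, fun t ht => ?_⟩
    rcases Nat.lt_succ_iff_lt_or_eq.1 ht with h | rfl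
    · simpa [h.le, Nat.succ_le_of_lt h] using hs t h
    · simpa [hT] using hbc

theorem reflTransGen_of_seq {α : Type*} {r : α → α → Prop} {T : ℕ} {x : ℕ → α}
    (h : ∀ t < T, Relation.ReflTransGen r (x t) (x (t + 1))) :
    Relation.ReflTransGen r (x 0) (x T) := by
  induction T with
  | zero => exact .refl
  | succ T ih => exact (ih fun t ht => h t (by omega)).trans (h T (by omega))

/-- A path inside a finite set can be shortened to one that has fewer steps than the set has
elements. -/
theorem exists_seq_lt_card {α : Type*} {r : α → α → Prop} {T : ℕ} {x : ℕ → α}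
    (h : ∀ t < T, r (x t) (x (t + 1))) (S : Finset α) (hS : ∀ t ≤ T, x t ∈ S) :
    ∃ (T' : ℕ) (y : ℕ → α), T' < S.card ∧ y 0 = x 0 ∧ y T' = x T ∧
      ∀ t < T', r (y t) (y (t + 1)) := by
  induction T using Nat.strong_induction_on generalizing x with
  | _ T ih =>
    by_cases hT : T < S.card
    · exact ⟨T, x, hT, rfl, rfl, h⟩
    -- By the pigeonhole principle a point repeats. The cycle between its two occurrences is cut out
    -- by shifting all later times by `j - i`.
    obtain ⟨i, j, hlt, hj, he⟩ : ∃ i j, i < j ∧ j < T + 1 ∧ x i = x j := by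
      obtain ⟨i, hi, j, hj, hij, he⟩ := Finset.exists_ne_map_eq_of_card_lt_of_maps_to
        (s := Finset.range (T + 1)) (t := S) (f := x) (by rw [Finset.card_range]; omega)
        (fun t ht => hS t (by simpa [Nat.lt_succ_iff] using ht))
      simp only [Finset.mem_range] at hi hj
      rcases Nat.lt_or_gt_of_ne hij with h | h
      · exact ⟨i, j, h, hj, he⟩
      · exact ⟨j, i, h, hi, he.symm⟩
    obtain ⟨T', y, h1, h2, h3, h4⟩ := ih (T - (j - i)) (by omega)
      (x := fun t => if t ≤ i then x t else x (t + (j - i))) (fun t ht => by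
        rcases lt_trichotomy t i with hti | rfl | hti
        · simpa [hti.le, Nat.succ_le_of_lt hti] using h t (by omega)
        · have := h j (by omega)
          rw [← he] at this
          simpa [show t + 1 + (j - t) = j + 1 by omega] using this
        · have := h (t + (j - i)) (by omega)
          simpa [hti.not_ge, show ¬ t + 1 ≤ i by omega,
            show t + 1 + (j - i) = t + (j - i) + 1 by omega] using this)
      (fun t ht => by
        split_ifs
        · exact hS t (by omega)
        · exact hS _ (by omega))
    refine ⟨T', y, h1, by simpa using h2, ?_, h4⟩
    rw [h3]
    split_ifs with hle
    · have h5 : T = j := by omega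
      rw [show T - (j - i) = i by omega, h5, he]
    · rw [show T - (j - i) + (j - i) = T by omega]

/-! ### The cutoff: pruning runs -/

section Cutoff

variable {QA QB : Type} [DecidableEq QB]

/-- The number of processes in each state, when process `i` is in state `f i`. -/
def occupancy {ι : Type*} [Fintype ι] (f : ι → QB) (q : QB) : ℕ :=
  (Finset.univ.filter fun i => f i = q).card

theorem one_le_occupancy {ι : Type*} [Fintype ι] {f : ι → QB} {q : QB} :
    1 ≤ occupancy f q ↔ ∃ i, f i = q := by
  simp [occupancy, Nat.one_le_iff_ne_zero, Finset.filter_eq_empty_iff]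

theorem two_le_occupancy {ι : Type*} [Fintype ι] {f : ι → QB} {q : QB} :
    2 ≤ occupancy f q ↔ ∃ i j, i ≠ j ∧ f i = q ∧ f j = q := by
  rw [occupancy, ← Nat.lt_iff_add_one_le, Finset.one_lt_card]
  simp only [Finset.mem_filter, Finset.mem_univ, true_and]
  constructor
  · rintro ⟨i, hi, j, hj, hij⟩; exact ⟨i, j, hij, hi, hj⟩
  · rintro ⟨i, j, hij, hi, hj⟩; exact ⟨i, hi, j, hj, hij⟩

theorem occupancy_const {ι : Type*} [Fintype ι] (q : QB) :
    occupancy (fun _ : ι => q) = Pi.single q (Fintype.card ι) := by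
  funext k
  by_cases h : k = q
  · subst h; simp [occupancy]
  · simp [occupancy, h, Ne.symm h]

theorem occupancy_update {ι : Type*} [Fintype ι] [DecidableEq ι] (f : ι → QB) (i : ι) (q : QB) :
    occupancy (Function.update f i q) = occupancy f - Pi.single (f i) 1 + Pi.single q 1 := by
  funext k
  have h1 : ∀ h : ι → QB, occupancy h k =
      (if h i = k then 1 else 0) + ((Finset.univ.erase i).filter fun j => h j = k).card := by
    intro h
    rw [occupancy, ← Finset.insert_erase (Finset.mem_univ i), Finset.filter_insert]
    split_ifs
    · rw [Finset.card_insert_of_notMem (by simp)]; simp [add_comm]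
    · simp
  have h2 : ((Finset.univ.erase i).filter fun j => Function.update f i q j = k) =
      (Finset.univ.erase i).filter fun j => f j = k :=
    Finset.filter_congr fun j hj => by rw [Function.update_of_ne (Finset.ne_of_mem_erase hj)]
  simp only [Pi.add_apply, Pi.sub_apply, h1, h2, Function.update_self, Pi.single_apply]
  by_cases h3 : f i = k <;> by_cases h4 : q = k <;> simp [h3, h4, eq_comm (a := k)] <;> omega

/-- A step of the system in which the processes have identities. Several `B`-processes may take the
same local transition at once, if a process that does not move satisfies its guard; it is also
allowed that nothing moves. -/
def MultiStep (A : ProcessTemplate QA (QA ⊕ QB)) (B : ProcessTemplate QB (QA ⊕ QB)) {ι : Type}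
    (s s' : QA × (ι → QB)) : Prop :=
  (s'.2 = s.2 ∧ ∃ g, (s.1, g, s'.1) ∈ A.δ ∧ ∃ i, Sum.inr (s.2 i) ∈ g) ∨
  (s'.1 = s.1 ∧ ∃ p g p', (p, g, p') ∈ B.δ ∧
    (∀ j, s'.2 j = s.2 j ∨ s.2 j = p ∧ s'.2 j = p') ∧
    (Sum.inl s.1 ∈ g ∨ ∃ j, Sum.inr (s.2 j) ∈ g ∧ s'.2 j = s.2 j))

variable {A : ProcessTemplate QA (QA ⊕ QB)} {B : ProcessTemplate QB (QA ⊕ QB)}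

/-- The moving processes are moved one at a time. The observer, which is the `A`-process or a
process at rest, stays in place, so the guard remains satisfied throughout. -/
theorem MultiStep.reflTransGen {ι : Type} [Fintype ι] {s s' : QA × (ι → QB)}
    (h : MultiStep A B s s') :
    Relation.ReflTransGen (CounterStep A B) ⟨s.1, occupancy s.2⟩ ⟨s'.1, occupancy s'.2⟩ := by
  classical
  obtain ⟨q, f⟩ := s
  obtain ⟨q', f'⟩ := s'
  rcases h with ⟨h1, g, hg, i, hi⟩ | ⟨h1, p, g, p', hg, hmv, hobs⟩
  · dsimp only at h1 hg hi
    subst h1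
    exact .single (.inl ⟨rfl, g, hg, f' i, hi, one_le_occupancy.2 ⟨i, rfl⟩⟩)
  dsimp only at h1 hmv hobs
  subst h1
  -- `M` is the set of processes that have already moved.
  have key : ∀ M : Finset ι, (∀ i ∈ M, f' i ≠ f i) →
      Relation.ReflTransGen (CounterStep A B) ⟨q', occupancy f⟩
        ⟨q', occupancy fun i => if i ∈ M then f' i else f i⟩ := by
    intro M
    induction M using Finset.induction_on with
    | empty => intro _; simp only [Finset.notMem_empty, if_false]; exact .refl
    | insert x M hx ih =>
      intro hM
      refine (ih fun i hi => hM i (Finset.mem_insert_of_mem hi)).tail ?_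
      set h : ι → QB := fun i => if i ∈ M then f' i else f i with hh
      have hfx := hM x (Finset.mem_insert_self x M)
      obtain ⟨hxp, hxp'⟩ := (hmv x).resolve_left hfx
      have hhx : h x = p := by simp [hh, hx, hxp]
      have hup : (fun i => if i ∈ insert x M then f' i else f i) = Function.update h x p' := by
        funext i
        by_cases hi : i = x
        · subst hi; simp [hxp']
        · simp [hi, hh]
      rw [hup]
      have h1 : 1 ≤ occupancy h p := one_le_occupancy.2 ⟨x, hhx⟩
      refine .inr ⟨rfl, p, g, p', hg, h1, ?_, ?_⟩
      · rcases hobs with ho | ⟨j, hj, hjs⟩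
        · exact .inl ⟨h1, ho⟩
        · have hjx : j ≠ x := by rintro rfl; exact hfx hjs
          have hhj : h j = f j := by
            simp only [hh]; split_ifs
            · exact hjs
            · rfl
          -- An observer that is itself in the source state makes, together with the mover `x`, a
          -- counter of at least 2: the third clause of `SatB`.
          by_cases hjp : f j = p
          · exact .inr (.inr ⟨hjp ▸ hj, two_le_occupancy.2 ⟨j, x, hjx, hhj.trans hjp, hhx⟩⟩)
          · exact .inr (.inl ⟨h1, f j, hj, hjp, one_le_occupancy.2 ⟨j, hhj⟩⟩)
      · simpa [hhx] using occupancy_update h x p'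
  have := key (Finset.univ.filter fun i => f' i ≠ f i) (by simp)
  convert this using 4 with i
  by_cases hi : f' i = f i <;> simp [hi]

/-- The mover may be any process in the source state other than the witness of the guard, so it is
chosen according to the clause of `SatB` that holds. In the third clause two processes share the
state, and one observes the other. -/
theorem CounterStep.exists_multiStep {ι : Type} [Fintype ι] {q : QA} {f : ι → QB}
    {s' : Config QA QB} (h : CounterStep A B ⟨q, occupancy f⟩ s') :
    ∃ f', occupancy f' = s'.c ∧ MultiStep A B (q, f) (s'.qA, f') := by
  classical
  rcases h with ⟨h1, g, hg, k, hk, hc⟩ | ⟨h1, i, g, j, hg, hi, hs, hc⟩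
  · obtain ⟨x, rfl⟩ := one_le_occupancy.1 hc
    exact ⟨f, h1.symm, .inl ⟨rfl, g, hg, x, hk⟩⟩
  · have hx : ∃ x, f x = i ∧ (Sum.inl q ∈ g ∨ ∃ y, Sum.inr (f y) ∈ g ∧ y ≠ x) := by
      obtain ⟨x, hx⟩ := one_le_occupancy.1 hi
      rcases hs with ⟨-, h⟩ | ⟨-, k, hk, hki, hck⟩ | ⟨hk, hck⟩
      · exact ⟨x, hx, .inl h⟩
      · obtain ⟨y, hy⟩ := one_le_occupancy.1 hck
        exact ⟨x, hx, .inr ⟨y, hy ▸ hk, by rintro rfl; exact hki (hy.symm.trans hx)⟩⟩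
      · obtain ⟨y, z, hyz, hy, hz⟩ := two_le_occupancy.1 hck
        exact ⟨z, hz, .inr ⟨y, hy ▸ hk, hyz⟩⟩
    obtain ⟨x, hx, ho⟩ := hx
    refine ⟨Function.update f x j, by rw [occupancy_update, hx, hc],
      .inr ⟨h1, i, g, j, hg, fun y => ?_, ho.imp_right fun ⟨y, hy, hyx⟩ => ⟨y, hy, ?_⟩⟩⟩
    · by_cases hy : y = x
      · subst hy; exact .inr ⟨hx, by simp⟩
      · simp [hy]
    · simp [hyx]

theorem exists_multiStep_reflTransGen {ι : Type} [Fintype ι] {q : QA} {f : ι → QB}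
    {s : Config QA QB}
    (h : Relation.ReflTransGen (CounterStep A B) ⟨q, occupancy f⟩ s) :
    ∃ f', occupancy f' = s.c ∧ Relation.ReflTransGen (MultiStep A B) (q, f) (s.qA, f') := by
  induction h with
  | refl => exact ⟨f, rfl, .refl⟩
  | @tail b c _ hbc ih =>
    obtain ⟨f', hf, hr⟩ := ih
    obtain ⟨qb, cb⟩ := b
    dsimp only at hf hr
    subst hf
    obtain ⟨f'', hf, hs⟩ := hbc.exists_multiStep
    exact ⟨f'', hf, hr.tail hs⟩

/-- From the trajectories of a bunch `P` of processes, which all go from `a` to `e`, and a state `r`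
that the bunch visits, one can make up a trajectory that is in `r` whenever some process of the
bunch is. -/
theorem exists_hybrid {ι : Type} {f : ℕ → ι → QB} {T : ℕ} {a e r : QB} (P : ι → Prop)
    (h0 : ∀ i, f 0 i = a) (hT : ∀ i, P i → f T i = e) (hr : ∃ i t, P i ∧ t ≤ T ∧ f t i = r) :
    ∃ τ : ℕ → QB, τ 0 = a ∧ τ T = e ∧ (∀ t ≤ T, ∀ i, P i → f t i = r → τ t = r) ∧
      ∀ t, τ (t + 1) = τ t ∨ ∃ i, f t i = τ t ∧ f (t + 1) i = τ (t + 1) := by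
  classical
  -- `t₁` is the first and `t₂` the last time at which the bunch is in `r`. The trajectory follows
  -- `i` up to `t₁`, waits in `r` until `t₂`, and follows `j` from then on.
  have hV : ∃ t, t ≤ T ∧ ∃ i, P i ∧ f t i = r := by
    obtain ⟨i, t, h1, h2, h3⟩ := hr; exact ⟨t, h2, i, h1, h3⟩
  obtain ⟨hi1, i, hi2, hi3⟩ := Nat.find_spec hV
  have hfirst : ∀ t ≤ T, ∀ i, P i → f t i = r → Nat.find hV ≤ t :=
    fun t ht i hi hit => Nat.find_min' hV ⟨ht, i, hi, hit⟩
  set t₁ := Nat.find hV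
  obtain ⟨t₂, ht₂, hlast⟩ := Finset.exists_max_image
    ((Finset.range (T + 1)).filter fun t => ∃ i, P i ∧ f t i = r) id
    ⟨t₁, by simp only [Finset.mem_filter, Finset.mem_range]; exact ⟨by omega, i, hi2, hi3⟩⟩
  simp only [Finset.mem_filter, Finset.mem_range, id, Nat.lt_succ_iff] at ht₂ hlast
  obtain ⟨hj1, j, hj2, hj3⟩ := ht₂
  have h12 : t₁ ≤ t₂ := hlast t₁ ⟨by omega, i, hi2, hi3⟩
  refine ⟨fun t => if t ≤ t₁ then f t i else if t ≤ t₂ then r else f t j, by simp [h0], ?_,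
    fun t ht k hk hkt => ?_, fun t => ?_⟩
  · dsimp only
    split_ifs with h1 h2
    · exact hT i hi2
    · rw [← hj3, show t₂ = T by omega]; exact hT j hj2
    · exact hT j hj2
  · have h1 := hfirst t ht k hk hkt
    have h2 := hlast t ⟨ht, k, hk, hkt⟩
    dsimp only
    split_ifs with h3
    · rw [show t = t₁ by omega, hi3]
    · rfl
  · dsimp only
    rcases lt_trichotomy t t₁ with h | h | h
    · simp only [h.le, Nat.succ_le_of_lt h, if_true]
      exact .inr ⟨i, rfl, rfl⟩
    · rw [if_neg (show ¬ t + 1 ≤ t₁ by omega), if_pos h.le]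
      split_ifs with h3
      · left; rw [h, hi3]
      · exact .inr ⟨j, by rw [h, hi3, ← hj3]; congr 1; omega, rfl⟩
    · rw [if_neg (show ¬ t + 1 ≤ t₁ by omega), if_neg (show ¬ t ≤ t₁ by omega)]
      split_ifs with h3 h4 h4
      · exact .inl rfl
      · omega
      · exact .inr ⟨j, by rw [← hj3]; congr 1; omega, rfl⟩
      · exact .inr ⟨j, rfl, rfl⟩

/-- Every run can be pruned to one with at most `2 |B|²` processes that ends in the same states,
up to the numbers of processes in states that hold at least two. -/
theorem exists_pruned [Fintype QB] {n : ℕ} (hn : 1 ≤ n) {s : Config QA QB}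
    (h : Relation.ReflTransGen (CounterStep A B) (initialConfig A B n) s) :
    ∃ m, 1 ≤ m ∧ m ≤ 2 * Fintype.card QB ^ 2 ∧ ∃ c,
      Relation.ReflTransGen (CounterStep A B) (initialConfig A B m) ⟨s.qA, c⟩ ∧
      (∀ q, 1 ≤ c q ↔ 1 ≤ s.c q) ∧ ∀ q, 2 ≤ c q ↔ 2 ≤ s.c q := by
  classical
  have hinit : ∀ m, initialConfig A B m = ⟨A.init, occupancy fun _ : Fin m => B.init⟩ := by
    intro m; simp [initialConfig, occupancy_const]
  rw [hinit] at h
  obtain ⟨f', hf', hr⟩ := exists_multiStep_reflTransGen h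
  obtain ⟨T, x, hx0, hxT, hx⟩ := hr.exists_seq
  set f : ℕ → Fin n → QB := fun t => (x t).2 with hf
  have hf0 : ∀ i, f 0 i = B.init := by simp [hf, hx0]
  have hfT : f T = f' := by simp [hf, hxT]
  rw [← hfT] at hf'
  let single : QB → Prop := fun e => occupancy (f T) e = 1
  -- An index consists of the final state, the state to be covered, and a copy number. A state in
  -- which exactly one process ends gets a single index, so that its final counter stays 1.
  let I : Type := {y : QB × QB × Bool // if single y.1 then y.2 = (y.1, false) else
    ∃ i t, f T i = y.1 ∧ t ≤ T ∧ f t i = y.2.1}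
  have hτ : ∀ y : I, ∃ τ : ℕ → QB, τ 0 = B.init ∧ τ T = y.1.1 ∧
      (∀ t, τ (t + 1) = τ t ∨ ∃ i, f t i = τ t ∧ f (t + 1) i = τ (t + 1)) ∧
      if single y.1.1 then ∀ i, f T i = y.1.1 → ∀ t, τ t = f t i else
        ∀ t ≤ T, ∀ i, f T i = y.1.1 → f t i = y.1.2.1 → τ t = y.1.2.1 := by
    rintro ⟨⟨e, r, b⟩, hy⟩
    by_cases hs : single e
    · obtain ⟨i, hi⟩ := one_le_occupancy.1 hs.ge
      refine ⟨fun t => f t i, hf0 i, hi, fun t => .inr ⟨i, rfl, rfl⟩, ?_⟩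
      simp only [hs, if_true]
      intro j hj t
      by_contra hne
      have : 2 ≤ occupancy (f T) e :=
        two_le_occupancy.2 ⟨i, j, by rintro rfl; exact hne rfl, hi, hj⟩
      simp only [single] at hs
      omega
    · simp only [hs, if_false] at hy ⊢
      obtain ⟨τ, h1, h2, h3, h4⟩ := exists_hybrid (fun i => f T i = e) hf0 (fun _ h => h) hy
      exact ⟨τ, h1, h2, h4, h3⟩
  choose τ hτ0 hτT hτs hτc using hτ
  -- A process that rests during a step is in the same state `r` before and after it. The trajectory
  -- that covers `r` for its group is then in `r` at both times, so it rests as well and can take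
  -- over as observer.
  have hcov : ∀ t < T, ∀ i, f (t + 1) i = f t i →
      ∃ y : I, τ y t = f t i ∧ τ y (t + 1) = f t i := by
    intro t ht i hi
    by_cases hs : single (f T i)
    · refine ⟨⟨(f T i, f T i, false), by simp [hs]⟩, ?_⟩
      have h2 := hτc ⟨(f T i, f T i, false), by simp [hs]⟩
      simp only [hs, if_true] at h2
      exact ⟨h2 i rfl t, (h2 i rfl (t + 1)).trans hi⟩
    · have hy : if single (f T i) then (f t i, false) = (f T i, false) else
          ∃ j u, f T j = f T i ∧ u ≤ T ∧ f u j = f t i := by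
        simp only [hs, if_false]; exact ⟨i, t, rfl, ht.le, rfl⟩
      refine ⟨⟨(f T i, f t i, false), hy⟩, ?_⟩
      have h2 := hτc ⟨(f T i, f t i, false), hy⟩
      simp only [hs, if_false] at h2
      exact ⟨h2 t ht.le i rfl rfl, h2 (t + 1) ht i rfl hi⟩
  have hcov0 : ∀ t < T, ∀ i, (∀ j, f (t + 1) j = f t j) → ∃ y : I, τ y t = f t i :=
    fun t ht i hi => (hcov t ht i (hi i)).imp fun _ h => h.1
  have hrun : ∀ t < T, MultiStep A B ((x t).1, fun y => τ y t)
      ((x (t + 1)).1, fun y => τ y (t + 1)) := by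
    intro t ht
    rcases hx t ht with ⟨h1, g, hg, i, hi⟩ | ⟨h1, p, g, p', hg, hmv, ho⟩
    · have h1' : ∀ j, f (t + 1) j = f t j := fun j => congrFun h1 j
      refine .inl ⟨?_, g, hg, ?_⟩
      · funext y
        rcases hτs y t with h | ⟨j, hj, hj'⟩
        · exact h
        · exact hj'.symm.trans ((h1' j).trans hj)
      · obtain ⟨y, hy⟩ := hcov0 t ht i h1'
        exact ⟨y, by dsimp only; rw [hy]; exact hi⟩
    -- Several trajectories may copy the same original move at this moment; this is why `MultiStep`
    -- lets many processes move at once.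
    · refine .inr ⟨h1, p, g, p', hg, fun y => ?_, ho.imp_right ?_⟩
      · rcases hτs y t with h | ⟨j, hj, hj'⟩
        · exact .inl h
        · dsimp only; rw [← hj, ← hj']; exact hmv j
      · rintro ⟨j, hj, hjs⟩
        obtain ⟨y, hy, hy'⟩ := hcov t ht j hjs
        exact ⟨y, by dsimp only; rw [hy]; exact hj, by dsimp only; rw [hy, hy']⟩
  have hreach := reflTransGen_of_seq
    (x := fun t => (⟨(x t).1, occupancy fun y => τ y t⟩ : Config QA QB))
    fun t ht => (hrun t ht).reflTransGen
  have hone : ∀ q, 1 ≤ occupancy (fun y => τ y T) q ↔ 1 ≤ s.c q := by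
    intro q
    rw [← hf', one_le_occupancy, one_le_occupancy]
    constructor
    · rintro ⟨⟨⟨e, r, b⟩, hy⟩, rfl⟩
      rw [hτT]
      by_cases hs : single e
      · exact one_le_occupancy.1 hs.ge
      · simp only [hs, if_false] at hy
        obtain ⟨i, -, hi, -⟩ := hy
        exact ⟨i, hi⟩
    · rintro ⟨i, rfl⟩
      refine ⟨⟨(f T i, f T i, false), ?_⟩, hτT _⟩
      split_ifs
      · rfl
      · exact ⟨i, T, rfl, le_rfl, rfl⟩
  refine ⟨Fintype.card I, ?_, ?_, occupancy fun y => τ y T, ?_, hone, fun q => ?_⟩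
  · have : 1 ≤ s.c (f T ⟨0, hn⟩) := by rw [← hf']; exact one_le_occupancy.2 ⟨_, rfl⟩
    obtain ⟨y, -⟩ := one_le_occupancy.1 ((hone _).2 this)
    exact Fintype.card_pos_iff.2 ⟨y⟩
  · refine (Fintype.card_subtype_le _).trans ?_
    simp only [Fintype.card_prod, Fintype.card_bool]
    nlinarith
  · have h0 : initialConfig A B (Fintype.card I) = ⟨(x 0).1, occupancy fun y => τ y 0⟩ := by
      simp only [hτ0, occupancy_const, hx0]; rfl
    rw [h0, show s.qA = (x T).1 by rw [hxT]]
    exact hreach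
  · rw [← hf', two_le_occupancy]
    constructor
    · rintro ⟨⟨⟨e, r, b⟩, hy⟩, ⟨⟨e', r', b'⟩, hy'⟩, hne, h1, h2⟩
      rw [hτT] at h1 h2
      dsimp only at h1 h2
      subst h1 h2
      by_cases hs : single e'
      · simp only [hs, if_true] at hy hy'
        exact (hne (Subtype.ext (Prod.ext rfl (hy.trans hy'.symm)))).elim
      · simp only [hs, if_false] at hy
        obtain ⟨i, -, hi, -⟩ := hy
        have := one_le_occupancy.2 ⟨i, hi⟩
        simp only [single] at hs
        omega
    · intro h2
      have hs : ¬ single q := by simp only [single]; omega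
      obtain ⟨i, hi⟩ := one_le_occupancy.1 (le_trans one_le_two h2)
      have hy : ∀ b : Bool, if single q then (q, b) = (q, false) else
          ∃ i t, f T i = q ∧ t ≤ T ∧ f t i = q := by
        intro b; simp only [hs, if_false]; exact ⟨i, T, hi, le_rfl, hi⟩
      -- The witnesses are the two copies of the trajectory that covers the final state `q` itself.
      refine ⟨⟨(q, q, false), hy false⟩, ⟨(q, q, true), hy true⟩, fun h => ?_, hτT _, hτT _⟩
      simpa using congrArg (fun z : I => z.1.2.2) h

/-- Some transition is enabled: a description of the configurations that are not deadlocked. -/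
theorem exists_counterStep_iff {s : Config QA QB} : (∃ s', CounterStep A B s s') ↔
    (∃ g q', (s.qA, g, q') ∈ A.δ ∧ s.SatA g) ∨
      ∃ i g j, (i, g, j) ∈ B.δ ∧ 1 ≤ s.c i ∧ s.SatB i g := by
  constructor
  · rintro ⟨s', ⟨-, g, hg, hs⟩ | ⟨-, i, g, j, hg, hi, hs, -⟩⟩
    · exact .inl ⟨g, _, hg, hs⟩
    · exact .inr ⟨i, g, j, hg, hi, hs⟩
  · rintro (⟨g, q', hg, hs⟩ | ⟨i, g, j, hg, hi, hs⟩)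
    · exact ⟨⟨q', s.c⟩, .inl ⟨rfl, g, hg, hs⟩⟩
    · exact ⟨⟨s.qA, s.c - Pi.single i 1 + Pi.single j 1⟩, .inr ⟨rfl, i, g, j, hg, hi, hs, rfl⟩⟩

/-- The enabling conditions compare counters only with 1 and 2, and pruning preserves exactly these
comparisons. -/
theorem HasReachableDeadlock.exists_le [Fintype QB] (h : HasReachableDeadlock A B) :
    ∃ n, 1 ≤ n ∧ n ≤ 2 * Fintype.card QB ^ 2 ∧ ∃ s,
      Relation.ReflTransGen (CounterStep A B) (initialConfig A B n) s ∧ Deadlocked A B s := by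
  obtain ⟨n, hn, s, hs, hd⟩ := h
  obtain ⟨m, hm, hm', c, hc, h1, h2⟩ := exists_pruned hn hs
  refine ⟨m, hm, hm', _, hc, ?_⟩
  rw [Deadlocked, exists_counterStep_iff] at hd ⊢
  simpa only [Config.SatA, Config.SatB, h1, h2] using hd

/-! ### Conservation of processes and the length of shortest runs. -/

theorem CounterStep.sum_eq [Fintype QB] {s s' : Config QA QB} (h : CounterStep A B s s') :
    ∑ q, s'.c q = ∑ q, s.c q := by
  rcases h with ⟨h, -⟩ | ⟨-, i, g, j, -, hi, -, hc⟩
  · rw [h]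
  · have h1 : s.c = (s.c - Pi.single i 1) + Pi.single i 1 := by
      funext k
      by_cases hk : k = i
      · subst hk; simp [Nat.sub_add_cancel hi]
      · simp [hk]
    have h2 : ∀ k : QB, ∑ q, (Pi.single k 1 : QB → ℕ) q = 1 := fun k => by
      simp [Finset.sum_pi_single']
    rw [hc, h1]
    simp only [Pi.add_apply, Finset.sum_add_distrib, h2]
    congr 2
    rw [← h1]

/-- A shortest run to a configuration is at most exponentially long. -/
theorem exists_short_run [Fintype QA] [Fintype QB] {n : ℕ} {s : Config QA QB}
    (h : Relation.ReflTransGen (CounterStep A B) (initialConfig A B n) s) :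
    ∃ (T : ℕ) (x : ℕ → Config QA QB), T < Fintype.card QA * (n + 1) ^ Fintype.card QB ∧
      x 0 = initialConfig A B n ∧ x T = s ∧
      (∀ t < T, CounterStep A B (x t) (x (t + 1))) ∧ ∀ t ≤ T, ∑ q, (x t).c q = n := by
  classical
  have hsum : ∀ {T : ℕ} {x : ℕ → Config QA QB}, x 0 = initialConfig A B n →
      (∀ t < T, CounterStep A B (x t) (x (t + 1))) → ∀ t ≤ T, ∑ q, (x t).c q = n := by
    intro T x h0 hx t ht
    induction t with
    | zero => simp [h0, initialConfig, Finset.sum_pi_single']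
    | succ t ih => rw [(hx t ht).sum_eq, ih (by omega)]
  obtain ⟨T, x, h0, hT, hx⟩ := h.exists_seq
  -- The counters add up to `n`, so each is at most `n`, and the run stays in the image of a type
  -- with `|A| (n + 1) ^ |B|` elements.
  let emb : QA × (QB → Fin (n + 1)) → Config QA QB := fun p => ⟨p.1, fun q => (p.2 q : ℕ)⟩
  obtain ⟨T', y, h1, h2, h3, h4⟩ := exists_seq_lt_card hx (Finset.univ.image emb) (fun t ht => by
    have := hsum h0 hx t ht
    refine Finset.mem_image.2 ⟨((x t).qA, fun q => ⟨(x t).c q, ?_⟩), Finset.mem_univ _, rfl⟩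
    rw [Nat.lt_succ_iff, ← this]
    exact Finset.single_le_sum (f := (x t).c) (fun _ _ => Nat.zero_le _) (Finset.mem_univ q))
  refine ⟨T', y, h1.trans_le (Finset.card_image_le.trans (by simp)), h2.trans h0, h3.trans hT, h4,
    hsum (h2.trans h0) h4⟩

end Cutoff

/-! ### A structured language of nondeterministic programs on stacks -/

/-- The primitive operations on the memory `σ` and on stacks that are indexed by `K`. -/
inductive Prim (K Γ σ : Type)
  /-- pop a stack and record the result in the memory -/
  | pop (k : K) (f : σ → Option Γ → σ)
  /-- push a symbol, or nothing, on a stack -/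
  | push (k : K) (f : σ → Option Γ)
  /-- change the memory -/
  | load (f : σ → σ)
  /-- change the memory according to a nondeterministic bit -/
  | flip (f : Bool → σ → σ)

/-- Structured programs. The program `loop P p Q` executes `P`, leaves the loop if `p` is false, and
otherwise executes `Q` and starts again. -/
inductive Prog (K Γ σ : Type)
  | op (l : List (Prim K Γ σ))
  | seq (P Q : Prog K Γ σ)
  | ite (p : σ → Bool) (P Q : Prog K Γ σ)
  | loop (P : Prog K Γ σ) (p : σ → Bool) (Q : Prog K Γ σ)

section Semantics

variable {K Γ σ : Type} [DecidableEq K]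

/-- The effect of a primitive operation, where `b` is the nondeterministic bit. -/
def Prim.eval (b : Bool) : Prim K Γ σ → σ × (K → List Γ) → σ × (K → List Γ)
  | pop k f, s => (f s.1 (s.2 k).head?, Function.update s.2 k (s.2 k).tail)
  | push k f, s => (s.1, Function.update s.2 k ((f s.1).toList ++ s.2 k))
  | load f, s => (f s.1, s.2)
  | flip f, s => (f b s.1, s.2)

/-- The effect of a list of primitive operations. -/
def evalOps (b : Bool) : List (Prim K Γ σ) → σ × (K → List Γ) → σ × (K → List Γ)
  | [], s => s
  | o :: l, s => evalOps b l (o.eval b s)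

/-- `Exec P s n s'`: some execution of `P` leads from `s` to `s'` in `n` steps. -/
inductive Exec : Prog K Γ σ → σ × (K → List Γ) → ℕ → σ × (K → List Γ) → Prop
  | op {l s} (b : Bool) : Exec (.op l) s 1 (evalOps b l s)
  | seq {P Q s s' s'' m n} : Exec P s m s' → Exec Q s' n s'' → Exec (.seq P Q) s (m + n) s''
  | ite_true {p P Q s s' n} : p s.1 = true → Exec P s n s' → Exec (.ite p P Q) s n s'
  | ite_false {p P Q s s' n} : p s.1 = false → Exec Q s n s' → Exec (.ite p P Q) s n s'
  | loop_exit {P p Q s s' n} : Exec P s n s' → p s'.1 = false → Exec (.loop P p Q) s n s'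
  | loop_next {P p Q s s₁ s₂ s₃ m n k} : Exec P s m s₁ → p s₁.1 = true → Exec Q s₁ n s₂ →
      Exec (.loop P p Q) s₂ k s₃ → Exec (.loop P p Q) s (m + n + k) s₃

/-- Deterministic operations. -/
def Prim.Det : Prim K Γ σ → Prop
  | flip _ => False
  | _ => True

/-- Deterministic programs. -/
def Prog.Det : Prog K Γ σ → Prop
  | op l => ∀ o ∈ l, o.Det
  | seq P Q => P.Det ∧ Q.Det
  | ite _ P Q => P.Det ∧ Q.Det
  | loop P _ Q => P.Det ∧ Q.Det

/-- The operation does not use the stack `c`. -/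
def Prim.Avoids (c : K) : Prim K Γ σ → Prop
  | pop k _ => k ≠ c
  | push k _ => k ≠ c
  | _ => True

/-- The program does not use the stack `c`. -/
def Prog.Avoids (c : K) : Prog K Γ σ → Prop
  | op l => ∀ o ∈ l, o.Avoids c
  | seq P Q => P.Avoids c ∧ Q.Avoids c
  | ite _ P Q => P.Avoids c ∧ Q.Avoids c
  | loop P _ Q => P.Avoids c ∧ Q.Avoids c

/-! ### Determinism, and independence of stacks that are not used. -/

theorem evalOps_det {l : List (Prim K Γ σ)} (h : ∀ o ∈ l, o.Det) (b b' : Bool)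
    (s : σ × (K → List Γ)) : evalOps b l s = evalOps b' l s := by
  induction l generalizing s with
  | nil => rfl
  | cons o l ih =>
    have ho : o.eval b s = o.eval b' s := by
      have := h o (by simp)
      cases o <;> first | rfl | exact this.elim
    rw [evalOps, evalOps, ho, ih fun o' ho' => h o' (by simp [ho'])]

theorem evalOps_update {c : K} {l : List (Prim K Γ σ)} (h : ∀ o ∈ l, o.Avoids c) (b : Bool) (v : σ)
    (S : K → List Γ) (x : List Γ) :
    evalOps b l (v, Function.update S c x) =
      ((evalOps b l (v, S)).1, Function.update (evalOps b l (v, S)).2 c x) := by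
  induction l generalizing v S with
  | nil => rfl
  | cons o l ih =>
    have ho : o.eval b (v, Function.update S c x) =
        ((o.eval b (v, S)).1, Function.update (o.eval b (v, S)).2 c x) := by
      have := h o (by simp)
      cases o with
      | pop k f => simp [Prim.eval, Function.update_of_ne this, Function.update_comm this]
      | push k f => simp [Prim.eval, Function.update_of_ne this, Function.update_comm this]
      | load f => rfl
      | flip f => rfl
    rw [evalOps, evalOps, ho, ih fun o' ho' => h o' (by simp [ho'])]

/-- For a deterministic program, exhibiting one execution describes them all. Thus each `ExecLE`
specification of such a program serves for completeness and, through `ExecLE.eq_of_exec`, for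
soundness. -/
theorem Exec.det {P : Prog K Γ σ} (hP : P.Det) {s s₁ : σ × (K → List Γ)} {m : ℕ}
    (h₁ : Exec P s m s₁) : ∀ {n s₂}, Exec P s n s₂ → m = n ∧ s₁ = s₂ := by
  induction h₁ with
  | op b =>
    intro n s₂ h₂
    cases h₂ with
    | op b' => exact ⟨rfl, evalOps_det hP _ _ _⟩
  | seq _ _ ih1 ih2 =>
    intro n s₂ h₂
    cases h₂ with
    | seq h1 h2 =>
      obtain ⟨rfl, rfl⟩ := ih1 hP.1 h1
      obtain ⟨rfl, rfl⟩ := ih2 hP.2 h2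
      exact ⟨rfl, rfl⟩
  | ite_true hp _ ih =>
    intro n s₂ h₂
    cases h₂ with
    | ite_true _ h => exact ih hP.1 h
    | ite_false hp' _ => simp [hp] at hp'
  | ite_false hp _ ih =>
    intro n s₂ h₂
    cases h₂ with
    | ite_true hp' _ => simp [hp] at hp'
    | ite_false _ h => exact ih hP.2 h
  | loop_exit _ hp ih =>
    intro n s₂ h₂
    cases h₂ with
    | loop_exit h _ => exact ih hP.1 h
    | loop_next h hp' _ _ =>
      obtain ⟨rfl, rfl⟩ := ih hP.1 h
      simp [hp] at hp'
  | loop_next _ hp _ _ ih1 ih2 ih3 =>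
    intro n s₂ h₂
    cases h₂ with
    | loop_exit h hp' =>
      obtain ⟨rfl, rfl⟩ := ih1 hP.1 h
      simp [hp] at hp'
    | loop_next h1 _ h2 h3 =>
      obtain ⟨rfl, rfl⟩ := ih1 hP.1 h1
      obtain ⟨rfl, rfl⟩ := ih2 hP.2 h2
      obtain ⟨rfl, rfl⟩ := ih3 hP h3
      exact ⟨rfl, rfl⟩

/-- Some execution of `P` leads from `s` to `s'` in at most `n` steps. -/
def ExecLE (P : Prog K Γ σ) (s : σ × (K → List Γ)) (n : ℕ) (s' : σ × (K → List Γ)) : Prop :=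
  ∃ m ≤ n, Exec P s m s'

namespace ExecLE

variable {P Q : Prog K Γ σ} {p : σ → Bool} {s s' s₁ s₂ s₃ : σ × (K → List Γ)} {l m n k : ℕ}

theorem mono (h : ExecLE P s m s') (hmn : m ≤ n) : ExecLE P s n s' :=
  let ⟨k, hk, h⟩ := h; ⟨k, hk.trans hmn, h⟩

theorem congr (h : ExecLE P s m s') (hmn : m ≤ n) (hs : s' = s₁) : ExecLE P s n s₁ :=
  hs ▸ h.mono hmn

theorem op (b : Bool) {l : List (Prim K Γ σ)} (h : evalOps b l s = s') : ExecLE (.op l) s 1 s' :=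
  ⟨1, le_rfl, h ▸ .op b⟩

theorem seq (h₁ : ExecLE P s m s₁) (h₂ : ExecLE Q s₁ n s') : ExecLE (.seq P Q) s (m + n) s' :=
  let ⟨_, hi, h₁⟩ := h₁; let ⟨_, hj, h₂⟩ := h₂; ⟨_, add_le_add hi hj, .seq h₁ h₂⟩

theorem ite_true (hp : p s.1 = true) (h : ExecLE P s n s') : ExecLE (.ite p P Q) s n s' :=
  let ⟨k, hk, h⟩ := h; ⟨k, hk, .ite_true hp h⟩

theorem ite_false (hp : p s.1 = false) (h : ExecLE Q s n s') : ExecLE (.ite p P Q) s n s' :=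
  let ⟨k, hk, h⟩ := h; ⟨k, hk, .ite_false hp h⟩

theorem loop_exit (h : ExecLE P s n s') (hp : p s'.1 = false) : ExecLE (.loop P p Q) s n s' :=
  let ⟨k, hk, h⟩ := h; ⟨k, hk, .loop_exit h hp⟩

theorem loop_next (h₁ : ExecLE P s l s₁) (hp : p s₁.1 = true) (h₂ : ExecLE Q s₁ m s₂)
    (h₃ : ExecLE (.loop P p Q) s₂ n s₃) : ExecLE (.loop P p Q) s (l + m + n) s₃ :=
  let ⟨_, hi, h₁⟩ := h₁; let ⟨_, hj, h₂⟩ := h₂; let ⟨_, hk, h₃⟩ := h₃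
  ⟨_, add_le_add (add_le_add hi hj) hk, .loop_next h₁ hp h₂ h₃⟩

theorem eq_of_exec (h₁ : ExecLE P s n s₁) (hP : P.Det) (h₂ : Exec P s m s₂) : s₂ = s₁ :=
  let ⟨_, _, h₁⟩ := h₁; (h₁.det hP h₂).2.symm

end ExecLE

end Semantics

/-! ### Flowcharts of programs -/

namespace Prog

variable {K Γ σ : Type}

/-- The labels of a program: one for every operation in it. -/
abbrev Lab : Prog K Γ σ → Type
  | op _ => Unit
  | seq P Q => P.Lab ⊕ Q.Lab
  | ite _ P Q => P.Lab ⊕ Q.Lab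
  | loop P _ Q => P.Lab ⊕ Q.Lab

/-- The labels form a finite type. -/
abbrev fintypeLab : (P : Prog K Γ σ) → Fintype P.Lab
  | op _ => inferInstanceAs (Fintype Unit)
  | seq P Q => @instFintypeSum _ _ P.fintypeLab Q.fintypeLab
  | ite _ P Q => @instFintypeSum _ _ P.fintypeLab Q.fintypeLab
  | loop P _ Q => @instFintypeSum _ _ P.fintypeLab Q.fintypeLab

/-- The label at which the execution starts, which depends on the memory. -/
def entry : (P : Prog K Γ σ) → σ → P.Lab
  | op _, _ => ()
  | seq P _, v => .inl (P.entry v)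
  | ite p P Q, v => if p v then .inl (P.entry v) else .inr (Q.entry v)
  | loop P _ _, v => .inl (P.entry v)

/-- The operation at a label. -/
def act : (P : Prog K Γ σ) → P.Lab → List (Prim K Γ σ)
  | op l, _ => l
  | seq P Q, l => Sum.elim P.act Q.act l
  | ite _ P Q, l => Sum.elim P.act Q.act l
  | loop P _ Q, l => Sum.elim P.act Q.act l

/-- The label to which the execution proceeds after the operation at a label (`none` if the program
is left). -/
def next : (P : Prog K Γ σ) → P.Lab → σ → Option P.Lab
  | op _, _, _ => none
  | seq P Q, .inl l, v => some ((P.next l v).elim (.inr (Q.entry v)) .inl)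
  | seq _ Q, .inr l, v => (Q.next l v).map .inr
  | ite _ P _, .inl l, v => (P.next l v).map .inl
  | ite _ _ Q, .inr l, v => (Q.next l v).map .inr
  | loop P p Q, .inl l, v =>
    (P.next l v).elim (if p v then some (.inr (Q.entry v)) else none) fun l' => some (.inl l')
  | loop P _ Q, .inr l, v => some ((Q.next l v).elim (.inl (P.entry v)) .inr)

theorem Det.act {P : Prog K Γ σ} (h : P.Det) (l : P.Lab) : ∀ o ∈ P.act l, o.Det := by
  induction P with
  | op _ => exact h
  | seq P Q ihP ihQ => exact l.casesOn (ihP h.1) (ihQ h.2)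
  | ite p P Q ihP ihQ => exact l.casesOn (ihP h.1) (ihQ h.2)
  | loop P p Q ihP ihQ => exact l.casesOn (ihP h.1) (ihQ h.2)

theorem Avoids.act {c : K} {P : Prog K Γ σ} (h : P.Avoids c) (l : P.Lab) :
    ∀ o ∈ P.act l, o.Avoids c := by
  induction P with
  | op _ => exact h
  | seq P Q ihP ihQ => exact l.casesOn (ihP h.1) (ihQ h.2)
  | ite p P Q ihP ihQ => exact l.casesOn (ihP h.1) (ihQ h.2)
  | loop P p Q ihP ihQ => exact l.casesOn (ihP h.1) (ihQ h.2)

variable [DecidableEq K]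

/-- `P.Steps n l s s'`: some execution of the flowchart of `P` that starts at the label `l` leads
from `s` to `s'` and out of the program in `n` steps. -/
inductive Steps (P : Prog K Γ σ) : ℕ → P.Lab → σ × (K → List Γ) → σ × (K → List Γ) → Prop
  | exit {l s s'} (b : Bool) : evalOps b (P.act l) s = s' → P.next l s'.1 = none →
      Steps P 1 l s s'
  | step {n l l' s s' s''} (b : Bool) : evalOps b (P.act l) s = s' → P.next l s'.1 = some l' →
      Steps P n l' s' s'' → Steps P (n + 1) l s s''

variable {P Q : Prog K Γ σ} {p : σ → Bool} {s s' s'' : σ × (K → List Γ)} {m n : ℕ}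

/-! ### Composition and decomposition of flowchart executions. -/

theorem Steps.seq_right {l : Q.Lab} (h : Q.Steps n l s s') :
    (seq P Q).Steps n (.inr l) s s' := by
  induction h with
  | exit b h1 h2 => exact .exit b h1 (by simp [next, h2])
  | step b h1 h2 _ ih => exact .step b h1 (by simp only [next, h2, Option.map_some]) ih

theorem Steps.seq_left {l : P.Lab} (h : P.Steps m l s s')
    (hQ : Q.Steps n (Q.entry s'.1) s' s'') : (seq P Q).Steps (m + n) (.inl l) s s'' := by
  induction h with
  | exit b h1 h2 =>
    rw [add_comm]
    exact .step b h1 (by simp only [next, h2, Option.elim]) hQ.seq_right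
  | step b h1 h2 _ ih =>
    rw [Nat.add_right_comm]
    exact .step b h1 (by simp only [next, h2, Option.elim]) (ih hQ)

theorem Steps.ite_left {l : P.Lab} (h : P.Steps n l s s') : (ite p P Q).Steps n (.inl l) s s' := by
  induction h with
  | exit b h1 h2 => exact .exit b h1 (by simp [next, h2])
  | step b h1 h2 _ ih => exact .step b h1 (by simp only [next, h2, Option.map_some]) ih

theorem Steps.ite_right {l : Q.Lab} (h : Q.Steps n l s s') :
    (ite p P Q).Steps n (.inr l) s s' := by
  induction h with
  | exit b h1 h2 => exact .exit b h1 (by simp [next, h2])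
  | step b h1 h2 _ ih => exact .step b h1 (by simp only [next, h2, Option.map_some]) ih

theorem Steps.loop_exit {l : P.Lab} (h : P.Steps n l s s') (hp : p s'.1 = false) :
    (loop P p Q).Steps n (.inl l) s s' := by
  induction h with
  | exit b h1 h2 => exact .exit b h1 (by simp [next, h2, hp])
  | step b h1 h2 _ ih => exact .step b h1 (by simp only [next, h2, Option.elim]) (ih hp)

theorem Steps.loop_right {l : Q.Lab} (h : Q.Steps m l s s')
    (hQ : (loop P p Q).Steps n (.inl (P.entry s'.1)) s' s'') :
    (loop P p Q).Steps (m + n) (.inr l) s s'' := by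
  induction h with
  | exit b h1 h2 =>
    rw [add_comm]
    exact .step b h1 (by simp only [next, h2, Option.elim]) hQ
  | step b h1 h2 _ ih =>
    rw [Nat.add_right_comm]
    exact .step b h1 (by simp only [next, h2, Option.elim]) (ih hQ)

theorem Steps.loop_left {l : P.Lab} (h : P.Steps m l s s') (hp : p s'.1 = true)
    (hQ : (loop P p Q).Steps n (.inr (Q.entry s'.1)) s' s'') :
    (loop P p Q).Steps (m + n) (.inl l) s s'' := by
  induction h with
  | exit b h1 h2 =>
    rw [add_comm]
    exact .step b h1 (by simp only [next, h2, Option.elim, hp, if_true]) hQ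
  | step b h1 h2 _ ih =>
    rw [Nat.add_right_comm]
    exact .step b h1 (by simp only [next, h2, Option.elim]) (ih hp hQ)

/-- The step counts agree exactly because tests take no time of their own: they are folded into
`entry` and `next`. -/
theorem _root_.Exec.steps (h : Exec P s n s') : P.Steps n (P.entry s.1) s s' := by
  induction h with
  | op b => exact .exit b rfl rfl
  | seq _ _ ih1 ih2 => exact ih1.seq_left ih2
  | ite_true hp _ ih => rw [entry, if_pos hp]; exact ih.ite_left
  | ite_false hp _ ih => rw [entry, if_neg (by simp [hp])]; exact ih.ite_right
  | loop_exit _ hp ih => exact ih.loop_exit hp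
  | loop_next _ hp _ _ ih1 ih2 ih3 => rw [add_assoc]; exact ih1.loop_left hp (ih2.loop_right ih3)

/-- The induction passes from labels of `P` to labels of `Q`, so the claim has to be stated for both
kinds at once; `Sum.elim` does this. -/
theorem Steps.of_seq {L : (seq P Q).Lab} (h : (seq P Q).Steps n L s s'') :
    Sum.elim (fun l => ∃ m k s', P.Steps m l s s' ∧ Q.Steps k (Q.entry s'.1) s' s'' ∧ n = m + k)
      (fun l => Q.Steps n l s s'') L := by
  induction h with
  | @exit L s s' b h1 h2 =>
    rcases L with l | l
    · simp [next] at h2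
    · exact .exit b h1 (by simpa [next] using h2)
  | @step n L L' s s' s'' b h1 h2 _ ih =>
    rcases L with l | l
    · simp only [next, Option.some.injEq] at h2
      cases h3 : P.next l s'.1 with
      | none =>
        rw [h3] at h2; subst h2
        exact ⟨1, n, s', .exit b h1 h3, ih, by omega⟩
      | some l' =>
        rw [h3] at h2; subst h2
        obtain ⟨m, k, s₁, hm, hk, rfl⟩ := ih
        exact ⟨m + 1, k, s₁, .step b h1 h3 hm, hk, by omega⟩
    · simp only [next, Option.map_eq_some_iff] at h2
      obtain ⟨l', h3, rfl⟩ := h2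
      exact .step b h1 h3 ih

theorem Steps.of_ite {L : (ite p P Q).Lab} (h : (ite p P Q).Steps n L s s') :
    Sum.elim (fun l => P.Steps n l s s') (fun l => Q.Steps n l s s') L := by
  induction h with
  | @exit L s s' b h1 h2 =>
    rcases L with l | l <;> exact .exit b h1 (by simpa [next] using h2)
  | @step n L L' s s' s'' b h1 h2 _ ih =>
    rcases L with l | l <;>
    · simp only [next, Option.map_eq_some_iff] at h2
      obtain ⟨l', h3, rfl⟩ := h2
      exact .step b h1 h3 ih

/-- An execution can pass through the loop any number of times. Only the part of the current
iteration that starts at the given label is kept as `Steps`; whenever control reaches an entry, `hP`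
or `hQ` turns what follows into an `Exec`. -/
theorem Steps.of_loop {L : (loop P p Q).Lab}
    (hP : ∀ {n s s'}, P.Steps n (P.entry s.1) s s' → Exec P s n s')
    (hQ : ∀ {n s s'}, Q.Steps n (Q.entry s.1) s s' → Exec Q s n s')
    (h : (loop P p Q).Steps n L s s'') :
    Sum.elim
      (fun l => ∃ m k s', P.Steps m l s s' ∧ n = m + k ∧
        (p s'.1 = false ∧ k = 0 ∧ s' = s'' ∨ p s'.1 = true ∧ ∃ i j s₁, Exec Q s' i s₁ ∧
          Exec (loop P p Q) s₁ j s'' ∧ k = i + j))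
      (fun l => ∃ m k s', Q.Steps m l s s' ∧ Exec (loop P p Q) s' k s'' ∧ n = m + k) L := by
  induction h with
  | @exit L s s' b h1 h2 =>
    rcases L with l | l
    · cases h3 : P.next l s'.1 with
      | none =>
        cases hp : p s'.1 with
        | false => exact ⟨1, 0, s', .exit b h1 h3, rfl, .inl ⟨hp, rfl, rfl⟩⟩
        | true => simp [next, h3, hp] at h2
      | some l' => simp [next, h3] at h2
    · simp [next] at h2
  | @step n L L' s s' s'' b h1 h2 _ ih =>
    rcases L with l | l
    · simp only [next] at h2
      cases h3 : P.next l s'.1 with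
      | none =>
        cases hp : p s'.1 with
        | false => simp [h3, hp] at h2
        | true =>
          simp only [h3, hp, Option.elim, if_true, Option.some.injEq] at h2
          subst h2
          obtain ⟨m, k, s₁, hm, hk, rfl⟩ := ih
          exact ⟨1, m + k, s', .exit b h1 h3, by omega,
            .inr ⟨hp, m, k, s₁, hQ hm, hk, rfl⟩⟩
      | some l' =>
        simp only [h3, Option.elim, Option.some.injEq] at h2
        subst h2
        obtain ⟨m, k, s₁, hm, rfl, hk⟩ := ih
        exact ⟨m + 1, k, s₁, .step b h1 h3 hm, by omega, hk⟩
    · simp only [next, Option.some.injEq] at h2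
      cases h3 : Q.next l s'.1 with
      | none =>
        rw [h3] at h2; subst h2
        obtain ⟨m, k, s₁, hm, rfl, ⟨hp, rfl, rfl⟩ | ⟨hp, i, j, s₂, hi, hj, rfl⟩⟩ := ih
        · exact ⟨1, m, s', .exit b h1 h3, .loop_exit (hP hm) hp, by omega⟩
        · exact ⟨1, m + i + j, s', .exit b h1 h3, .loop_next (hP hm) hp hi hj, by omega⟩
      | some l' =>
        rw [h3] at h2; subst h2
        obtain ⟨m, k, s₁, hm, hk, rfl⟩ := ih
        exact ⟨m + 1, k, s₁, .step b h1 h3 hm, hk, by omega⟩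

theorem Steps.exec (h : P.Steps n (P.entry s.1) s s') : Exec P s n s' := by
  induction P generalizing n s s' with
  | op l =>
    cases h with
    | exit b h1 _ => exact h1 ▸ .op b
    | step b _ h2 _ => simp [next] at h2
  | seq P Q ihP ihQ =>
    obtain ⟨m, k, s₁, h1, h2, rfl⟩ := h.of_seq
    exact .seq (ihP h1) (ihQ h2)
  | ite p P Q ihP ihQ =>
    have := h.of_ite
    cases hp : p s.1 with
    | true => exact .ite_true hp (ihP (by simpa [entry, hp] using this))
    | false => exact .ite_false hp (ihQ (by simpa [entry, hp] using this))
  | loop P p Q ihP ihQ =>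
    obtain ⟨m, k, s₁, hm, rfl, ⟨hp, rfl, rfl⟩ | ⟨hp, i, j, s₂, hi, hj, rfl⟩⟩ := h.of_loop ihP ihQ
    · exact .loop_exit (ihP hm) hp
    · rw [← add_assoc]; exact .loop_next (ihP hm) hp hi hj

end Prog

/-! ### Clocked machines -/

theorem NTM.StepsTo.trans {M : NTM} {m n : ℕ} {c d e : M.Cfg} (h₁ : M.StepsTo m c d)
    (h₂ : M.StepsTo n d e) : M.StepsTo (m + n) c e := by
  induction m generalizing c with
  | zero => rw [Nat.zero_add]; exact h₁ ▸ h₂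
  | succ m ih =>
    obtain ⟨x, hx, h₁⟩ := h₁
    rw [Nat.add_right_comm]
    exact ⟨x, hx, ih h₁⟩

section Machine

variable {K Γ σ : Type} [DecidableEq K]

/-- The statement that executes a list of operations and continues with `q`. -/
def stmtOps [Inhabited Γ] {L : Type} (b : Bool) :
    List (Prim K Γ σ) → Turing.TM2.Stmt (fun _ : K => Γ) L (σ × Bool) →
      Turing.TM2.Stmt (fun _ : K => Γ) L (σ × Bool)
  | [], q => q
  | .pop k f :: l, q => .pop k (fun v o => (f v.1 o, v.2)) (stmtOps b l q)
  | .push k f :: l, q => .branch (fun v => (f v.1).isSome)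
      (.push k (fun v => (f v.1).getD default) (stmtOps b l q)) (stmtOps b l q)
  | .load f :: l, q => .load (fun v => (f v.1, v.2)) (stmtOps b l q)
  | .flip f :: l, q => .load (fun v => (f b v.1, v.2)) (stmtOps b l q)

theorem stepAux_stmtOps [Inhabited Γ] {L : Type} (b : Bool) (l : List (Prim K Γ σ))
    (q : Turing.TM2.Stmt (fun _ : K => Γ) L (σ × Bool)) (v : σ) (a : Bool) (S : K → List Γ) :
    Turing.TM2.stepAux (stmtOps b l q) (v, a) S =
      Turing.TM2.stepAux q ((evalOps b l (v, S)).1, a) (evalOps b l (v, S)).2 := by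
  induction l generalizing v S with
  | nil => rfl
  | cons o l ih =>
    cases o with
    | pop k f => simp [stmtOps, evalOps, Prim.eval, ih]
    | push k f => cases h : f v <;> simp [stmtOps, evalOps, Prim.eval, ih, h]
    | load f => simp [stmtOps, evalOps, Prim.eval, ih]
    | flip f => simp [stmtOps, evalOps, Prim.eval, ih]

variable [Fintype K] [Fintype Γ] [Inhabited Γ] [Fintype σ]

/-- The machine that executes the program `setup`, and then the program `main` with a clock: before
every step of `main` it pops the stack `clk`, and it halts, rejecting, if that stack is empty. The
second component of its internal state tells whether the clock has not run out. -/
abbrev clockedNTM (k₀ clk : K) (inp : Bool → Γ) (v₀ : σ) (acc : Set σ) (setup main : Prog K Γ σ) :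
    NTM where
  K := K
  decEqK := inferInstance
  finK := inferInstance
  Γ := fun _ => Γ
  finΓ := fun _ => inferInstance
  Λ := setup.Lab ⊕ main.Lab
  finΛ := @instFintypeSum _ _ setup.fintypeLab main.fintypeLab
  σ := σ × Bool
  finσ := inferInstance
  k₀ := k₀
  inputSymbol := inp
  main := .inl (setup.entry v₀)
  initialState := (v₀, true)
  accepting := {v | v.1 ∈ acc ∧ v.2 = true}
  program := fun b l => match l with
    | .inl l => stmtOps b (setup.act l)
        (.goto fun v => (setup.next l v.1).elim (.inr (main.entry v.1)) .inl)
    | .inr l => .pop clk (fun v o => (v.1, o.isSome)) (.branch (fun v => v.2)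
        (stmtOps b (main.act l) (.branch (fun v => (main.next l v.1).isSome)
          (.goto fun v => .inr ((main.next l v.1).getD l)) .halt)) .halt)

variable {k₀ clk : K} {inp : Bool → Γ} {v₀ : σ} {acc : Set σ} {setup main : Prog K Γ σ}

/-- The configurations of the machine. -/
def clockedCfg (k₀ clk : K) (inp : Bool → Γ) (v₀ : σ) (acc : Set σ) (setup main : Prog K Γ σ)
    (l : Option (setup.Lab ⊕ main.Lab)) (v : σ) (a : Bool) (S : K → List Γ) :
    (clockedNTM k₀ clk inp v₀ acc setup main).Cfg :=
  ⟨l, (v, a), S⟩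

local notation "cfg" => clockedCfg k₀ clk inp v₀ acc setup main

theorem clockedNTM_step_none {v : σ} {a : Bool} {S : K → List Γ} {d} :
    ¬ (clockedNTM k₀ clk inp v₀ acc setup main).Step (cfg none v a S) d := by
  rintro ⟨b, hd⟩
  simp [clockedCfg] at hd

theorem clockedNTM_step_inl {l : setup.Lab} {v : σ} {S : K → List Γ} {d} :
    (clockedNTM k₀ clk inp v₀ acc setup main).Step (cfg (some (.inl l)) v true S) d ↔
      ∃ b, d = cfg (some ((setup.next l (evalOps b (setup.act l) (v, S)).1).elim
        (.inr (main.entry (evalOps b (setup.act l) (v, S)).1)) .inl))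
        (evalOps b (setup.act l) (v, S)).1 true (evalOps b (setup.act l) (v, S)).2 := by
  refine exists_congr fun b => ?_
  have h := stepAux_stmtOps b (setup.act l) (Turing.TM2.Stmt.goto fun v : σ × Bool =>
    (setup.next l v.1).elim (Sum.inr (main.entry v.1)) Sum.inl) v true S
  refine ⟨fun hd => ?_, fun hd => ?_⟩
  · exact ((Option.some.inj hd).symm.trans h)
  · exact congrArg some (h.trans hd.symm)

/-- As `main` does not use `clk`, popping the clock commutes with its operations. -/
theorem clockedNTM_step_inr {l : main.Lab} {v : σ} {S : K → List Γ} {x : Γ} {C : List Γ}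
    (hmain : main.Avoids clk) {d} :
    (clockedNTM k₀ clk inp v₀ acc setup main).Step
      (cfg (some (.inr l)) v true (Function.update S clk (x :: C))) d ↔
      ∃ b, d = cfg ((main.next l (evalOps b (main.act l) (v, S)).1).map .inr)
        (evalOps b (main.act l) (v, S)).1 true
        (Function.update (evalOps b (main.act l) (v, S)).2 clk C) := by
  refine exists_congr fun b => ?_
  have h := stepAux_stmtOps b (main.act l) (Turing.TM2.Stmt.branch
    (fun v : σ × Bool => (main.next l v.1).isSome)
    (.goto fun v => (.inr ((main.next l v.1).getD l) : setup.Lab ⊕ main.Lab)) .halt) v true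
      (Function.update S clk C)
  rw [evalOps_update (hmain.act l)] at h
  have h2 : Turing.TM2.stepAux ((clockedNTM k₀ clk inp v₀ acc setup main).program b (.inr l))
      (v, true) (Function.update S clk (x :: C)) =
      cfg ((main.next l (evalOps b (main.act l) (v, S)).1).map .inr)
        (evalOps b (main.act l) (v, S)).1 true
        (Function.update (evalOps b (main.act l) (v, S)).2 clk C) := by
    simp only [clockedNTM, Turing.TM2.stepAux, Function.update_self, List.head?_cons,
      Option.isSome_some, List.tail_cons, Function.update_idem, cond_true]
    refine h.trans ?_
    cases h3 : main.next l (evalOps b (main.act l) (v, S)).1 <;> simp [h3, clockedCfg]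
  refine ⟨fun hd => ?_, fun hd => ?_⟩
  · exact (Option.some.inj hd).symm.trans h2
  · exact congrArg some (h2.trans hd.symm)

theorem clockedNTM_step_inr_nil {l : main.Lab} {v : σ} {a : Bool} {S : K → List Γ} {d}
    (h : (clockedNTM k₀ clk inp v₀ acc setup main).Step
      (cfg (some (.inr l)) v a (Function.update S clk [])) d) :
    d = cfg none v false (Function.update S clk []) := by
  obtain ⟨b, hd⟩ := h
  refine (Option.some.inj hd).symm.trans ?_
  simp [clockedNTM, clockedCfg]

/-- During `setup` both programs of the machine act alike, so there is only one computation. Any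
other is a proper initial piece of it, which has not halted, or continues from its end. -/
theorem clockedNTM_setup {n : ℕ} {l : setup.Lab} {s s' : σ × (K → List Γ)} (hdet : setup.Det)
    (h : setup.Steps n l s s') :
    (clockedNTM k₀ clk inp v₀ acc setup main).StepsTo n (cfg (some (.inl l)) s.1 true s.2)
      (cfg (some (.inr (main.entry s'.1))) s'.1 true s'.2) ∧
    ∀ k d, (clockedNTM k₀ clk inp v₀ acc setup main).StepsTo k
      (cfg (some (.inl l)) s.1 true s.2) d → (k < n ∧ d.l ≠ none) ∨ (n ≤ k ∧
        (clockedNTM k₀ clk inp v₀ acc setup main).StepsTo (k - n)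
          (cfg (some (.inr (main.entry s'.1))) s'.1 true s'.2) d) := by
  induction h with
  | @exit l s s' b h1 h2 =>
    refine ⟨⟨_, clockedNTM_step_inl.2 ⟨b, rfl⟩, ?_⟩, fun k d hk => ?_⟩
    · simp only [NTM.StepsTo, Prod.mk.eta, h1, h2, Option.elim]
    · cases k with
      | zero => exact .inl ⟨by omega, by rw [← show _ = d from hk]; simp [clockedCfg]⟩
      | succ k =>
        obtain ⟨e, he, hk⟩ := hk
        obtain ⟨b', rfl⟩ := clockedNTM_step_inl.1 he
        rw [evalOps_det (hdet.act l) b' b] at hk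
        simp only [Prod.mk.eta, h1, h2, Option.elim] at hk
        exact .inr ⟨by omega, by simpa using hk⟩
  | @step n l l' s s' s'' b h1 h2 _ ih =>
    refine ⟨⟨_, clockedNTM_step_inl.2 ⟨b, rfl⟩, ?_⟩, fun k d hk => ?_⟩
    · simp only [Prod.mk.eta, h1, h2, Option.elim]
      exact ih.1
    · cases k with
      | zero => exact .inl ⟨by omega, by rw [← show _ = d from hk]; simp [clockedCfg]⟩
      | succ k =>
        obtain ⟨e, he, hk⟩ := hk
        obtain ⟨b', rfl⟩ := clockedNTM_step_inl.1 he
        rw [evalOps_det (hdet.act l) b' b] at hk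
        simp only [Prod.mk.eta, h1, h2, Option.elim] at hk
        rcases ih.2 k d hk with ⟨h3, h4⟩ | ⟨h3, h4⟩
        · exact .inl ⟨by omega, h4⟩
        · exact .inr ⟨by omega, by rwa [Nat.add_sub_add_right]⟩

/-- Every step consumes a letter of the clock; the additional 1 is the step that finds the clock
empty. -/
theorem clockedNTM_halts (hmain : main.Avoids clk) {C : List Γ} {l : main.Lab} {v : σ}
    {S : K → List Γ} {k : ℕ} {d} (h : (clockedNTM k₀ clk inp v₀ acc setup main).StepsTo k
      (cfg (some (.inr l)) v true (Function.update S clk C)) d) : k ≤ C.length + 1 := by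
  have hnone : ∀ {k v a S d}, (clockedNTM k₀ clk inp v₀ acc setup main).StepsTo k
      (cfg none v a S) d → k = 0 := by
    intro k v a S d h
    cases k with
    | zero => rfl
    | succ k => obtain ⟨e, he, -⟩ := h; exact (clockedNTM_step_none he).elim
  induction C generalizing l v S k with
  | nil =>
    cases k with
    | zero => omega
    | succ k =>
      obtain ⟨e, he, h⟩ := h
      obtain rfl := clockedNTM_step_inr_nil he
      simp [hnone h]
  | cons x C ih =>
    cases k with
    | zero => omega
    | succ k =>
      obtain ⟨e, he, h⟩ := h
      obtain ⟨b, rfl⟩ := (clockedNTM_step_inr hmain).1 he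
      cases h2 : main.next l (evalOps b (main.act l) (v, S)).1 with
      | none => rw [h2] at h; simp [hnone h]
      | some l' => rw [h2] at h; simpa using ih h

theorem clockedNTM_main_complete (hmain : main.Avoids clk) {n : ℕ} {l : main.Lab}
    {s s' : σ × (K → List Γ)} (h : main.Steps n l s s') {C : List Γ} (hC : n ≤ C.length) :
    ∃ S, (clockedNTM k₀ clk inp v₀ acc setup main).StepsTo n
      (cfg (some (.inr l)) s.1 true (Function.update s.2 clk C)) (cfg none s'.1 true S) := by
  induction h generalizing C with
  | @exit l s s' b h1 h2 =>
    obtain ⟨x, C, rfl⟩ := List.exists_cons_of_length_pos hC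
    refine ⟨Function.update s'.2 clk C, _, (clockedNTM_step_inr hmain).2 ⟨b, rfl⟩, ?_⟩
    simp only [NTM.StepsTo, Prod.mk.eta, h1, h2, Option.map_none]
  | @step n l l' s s' s'' b h1 h2 _ ih =>
    obtain ⟨x, C, rfl⟩ := List.exists_cons_of_length_pos (Nat.zero_lt_of_lt hC)
    obtain ⟨S, hS⟩ := ih (C := C) (by simpa using hC)
    refine ⟨S, _, (clockedNTM_step_inr hmain).2 ⟨b, rfl⟩, ?_⟩
    simpa only [Prod.mk.eta, h1, h2, Option.map_some] using hS

/-- The flag `d.var.2` separates leaving `main` from running out of time. Without it, a computation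
stopped by the clock would be accepting whenever its memory happens to be in `acc`. -/
theorem clockedNTM_main_sound (hmain : main.Avoids clk) {n : ℕ} {l : main.Lab} {v : σ}
    {S : K → List Γ} {C : List Γ} {d} (h : (clockedNTM k₀ clk inp v₀ acc setup main).StepsTo n
      (cfg (some (.inr l)) v true (Function.update S clk C)) d) (hd : d.l = none)
    (ha : d.var.2 = true) :
    ∃ s', main.Steps n l (v, S) s' ∧ d.var.1 = s'.1 := by
  induction n generalizing l v S C with
  | zero => rw [← show _ = d from h] at hd; simp [clockedCfg] at hd
  | succ n ih =>
    obtain ⟨e, he, h⟩ := h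
    have hnone : ∀ {v a S}, (clockedNTM k₀ clk inp v₀ acc setup main).StepsTo n
        (cfg none v a S) d → n = 0 ∧ cfg none v a S = d := by
      intro v a S h
      cases n with
      | zero => exact ⟨rfl, h⟩
      | succ k => obtain ⟨e, he, -⟩ := h; exact (clockedNTM_step_none he).elim
    cases C with
    | nil =>
      obtain rfl := clockedNTM_step_inr_nil he
      rw [← (hnone h).2] at ha
      simp [clockedCfg] at ha
    | cons x C =>
      obtain ⟨b, rfl⟩ := (clockedNTM_step_inr hmain).1 he
      cases h2 : main.next l (evalOps b (main.act l) (v, S)).1 with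
      | none =>
        rw [h2] at h
        obtain ⟨rfl, rfl⟩ := hnone h
        exact ⟨_, .exit b rfl h2, rfl⟩
      | some l' =>
        rw [h2] at h
        obtain ⟨s', h3, h4⟩ := ih h
        exact ⟨s', .step b rfl h2 h3, h4⟩

/-- If `setup` leads in `t` steps from the initial configuration on the word `w` to the state `s`,
then the machine halts within `t + N + 1` steps, where `N` is the number of symbols on the clock
stack; if it accepts then some execution of `main` from `s` does, and if some execution of `main`
from `s` accepts within `N` steps then so does the machine. -/
theorem clockedNTM_spec (hdet : setup.Det) (hmain : main.Avoids clk) {w : List Bool} {t : ℕ}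
    {s : σ × (K → List Γ)}
    (h : Exec setup (v₀, Function.update (fun _ => []) k₀ (w.map inp)) t s) :
    (clockedNTM k₀ clk inp v₀ acc setup main).HaltsWithin w (t + (s.2 clk).length + 1) ∧
    ((clockedNTM k₀ clk inp v₀ acc setup main).Accepts w → ∃ n s', Exec main s n s' ∧ s'.1 ∈ acc) ∧
    ∀ n ≤ (s.2 clk).length, ∀ s', Exec main s n s' → s'.1 ∈ acc →
      (clockedNTM k₀ clk inp v₀ acc setup main).Accepts w := by
  obtain ⟨h1, h2⟩ := clockedNTM_setup (k₀ := k₀) (clk := clk) (inp := inp) (v₀ := v₀) (acc := acc)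
    (main := main) hdet h.steps
  have hup : s.2 = Function.update s.2 clk (s.2 clk) := (Function.update_eq_self _ _).symm
  refine ⟨fun k c hk => ?_, ?_, ?_⟩
  · rcases h2 k c hk with ⟨h3, -⟩ | ⟨h3, h4⟩
    · omega
    · rw [hup] at h4
      have := clockedNTM_halts hmain h4
      omega
  · rintro ⟨k, c, hk, hc, hacc⟩
    rcases h2 k c hk with ⟨-, h4⟩ | ⟨h3, h4⟩
    · exact (h4 hc).elim
    · rw [hup] at h4
      obtain ⟨s', h5, h6⟩ := clockedNTM_main_sound hmain h4 hc hacc.2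
      exact ⟨_, s', h5.exec, h6 ▸ hacc.1⟩
  · intro n hn s' hs hacc
    obtain ⟨S, hS⟩ := clockedNTM_main_complete (k₀ := k₀) (inp := inp) (v₀ := v₀) (acc := acc)
      (setup := setup) hmain hs.steps hn
    rw [← hup] at hS
    exact ⟨_, _, h1.trans hS, rfl, hacc, rfl⟩

end Machine

/-! ### The programs that simulate a disjunctive system -/

/-- The stack alphabet. The letters `src` and `tgt` mark the process that is about to move, and the
place where it is going to. -/
inductive Letter
  | zero | one | src | tgt
  deriving DecidableEq

instance : Fintype Letter := ⟨{.zero, .one, .src, .tgt}, fun x => by cases x <;> decide⟩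

instance : Inhabited Letter := ⟨.zero⟩

/-- The stacks: the input, its part that has been read, and for `A` (`true`) and `B` (`false`) the
numbers of processes in the local states, and the part of them that has been read; and the clock. -/
inductive StackName
  | I | J | V (b : Bool) | W (b : Bool) | clk
  deriving DecidableEq, Fintype

/-- The internal memory of the machine. -/
structure Memory where
  /-- the letter that has been read -/
  buf : Option Letter := none
  /-- there is a process in the source of the current transition -/
  ok : Bool := false
  /-- there is a process in the current state -/
  occ : Bool := false
  /-- the guard of the current transition is satisfied -/
  sat : Bool := false
  /-- a nondeterministic choice -/
  fire : Bool := false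
  /-- the current transition is taken -/
  commit : Bool := false
  /-- the transitions are not taken, but only checked -/
  check : Bool := false
  /-- an enabled transition was found in the checking mode -/
  bad : Bool := false

noncomputable instance : Fintype Memory :=
  Fintype.ofInjective (fun m : Memory =>
    (m.buf, m.ok, m.occ, m.sat, m.fire, m.commit, m.check, m.bad)) (by
      rintro ⟨⟩ ⟨⟩ h
      simpa using h)

open StackName Letter

local infixr:60 " ⨟ " => Prog.seq

/-- The programs for the simulation. -/
abbrev SimProg := Prog StackName Letter Memory

/-- The states of these programs. -/
abbrev SimState := Memory × (StackName → List Letter)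

namespace Sim

/-- The contents of the stacks. -/
def stk (i j : List Letter) (v w : Bool → List Letter) (c : List Letter) : StackName → List Letter
  | I => i
  | J => j
  | V b => v b
  | W b => w b
  | clk => c

section stk

variable {i j : List Letter} {v w : Bool → List Letter} {c x : List Letter} {b : Bool}

@[simp] theorem stk_I : stk i j v w c I = i := rfl
@[simp] theorem stk_J : stk i j v w c J = j := rfl
@[simp] theorem stk_V : stk i j v w c (V b) = v b := rfl
@[simp] theorem stk_W : stk i j v w c (W b) = w b := rfl
@[simp] theorem stk_clk : stk i j v w c clk = c := rfl

@[simp] theorem update_stk_I : Function.update (stk i j v w c) I x = stk x j v w c := by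
  funext k; cases k <;> simp

@[simp] theorem update_stk_J : Function.update (stk i j v w c) J x = stk i x v w c := by
  funext k; cases k <;> simp

@[simp] theorem update_stk_V :
    Function.update (stk i j v w c) (V b) x = stk i j (Function.update v b x) w c := by
  funext k; cases k <;> simp [Function.update_apply]

@[simp] theorem update_stk_W :
    Function.update (stk i j v w c) (W b) x = stk i j v (Function.update w b x) c := by
  funext k; cases k <;> simp [Function.update_apply]

@[simp] theorem update_stk_clk : Function.update (stk i j v w c) clk x = stk i j v w x := by
  funext k; cases k <;> simp

end stk

/-- Record the letter that is read. -/
def record (m : Memory) (o : Option Letter) : Memory := { m with buf := o }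

/-- Keep only the mode and the verdict. -/
def reset (m : Memory) : Memory := { check := m.check, bad := m.bad }

/-- Move one letter from one stack to another. -/
def move (k k' : StackName) : SimProg := .op [.pop k record, .push k' (·.buf)]

/-- Empty the stack `k`, and push `f` of the letters on `k'`. -/
def transfer (k k' : StackName) (f : Memory → Option Letter) : SimProg :=
  .loop (.op [.pop k record, .push k' f]) (·.buf.isSome) (.op [])

/-- Move letters from `V k` to `W k`, up to and including the first `zero`. -/
def moveBlock (k : Bool) : SimProg :=
  .loop (move (V k) (W k)) (fun m => m.buf != some zero) (.op [])

/-- Read a number, and move that many blocks from `V k` to `W k`. -/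
def seek (k : Bool) : SimProg :=
  .loop (move I J) (fun m => m.buf == some one) (moveBlock k)

/-- Move everything back from `W k` to `V k`. -/
def restore (k : Bool) : SimProg := transfer (W k) (V k) (·.buf)

/-- The letter that replaces a letter when a transition is taken, or not taken. -/
def settleLetter (commit : Bool) : Letter → Option Letter
  | src => if commit then none else some one
  | tgt => if commit then some one else none
  | x => some x

/-- Move everything back from `W k` to `V k`, and remove the marks. -/
def settle (k : Bool) : SimProg :=
  transfer (W k) (V k) fun m => m.buf.bind (settleLetter m.commit)

/-- Move everything from `V k` to `W k`, read the bit of the guard for every block, and find out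
whether some process is in the guard. -/
def guardPass (k : Bool) : SimProg :=
  .loop (move (V k) (W k)) (·.buf.isSome) (.ite (fun m => m.buf == some zero)
    (.op [.pop I record, .push J (·.buf), .load fun m =>
      { m with buf := none, sat := m.sat || (m.occ && m.buf == some one), occ := false }])
    (.op [.load fun m => { m with buf := none, occ := m.occ || m.buf == some one }]))

/-- Mark a process in the source state. -/
def markSrc (k : Bool) : List (Prim StackName Letter Memory) :=
  [.pop (V k) record, .load fun m => { m with ok := m.buf == some one },
    .push (V k) fun m => if m.ok then some src else m.buf]

/-- Mark the target state. -/
def markTgt (k : Bool) : List (Prim StackName Letter Memory) :=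
  [.push (V k) fun _ => some tgt]

/-- Read the source and the target of a transition and mark them. -/
def mark (k : Bool) : SimProg :=
  (seek k ⨟ .op (markSrc k) ⨟ restore k) ⨟ (seek k ⨟ .op (markTgt k) ⨟ restore k)

/-- Treat one transition, with the nondeterministic choice already made. -/
def transBody (k : Bool) : SimProg :=
  mark k ⨟ guardPass true ⨟ guardPass false ⨟
  .op [.load fun m => { m with
    commit := m.ok && m.sat && m.fire, bad := m.bad || (m.check && (m.ok && m.sat)) }] ⨟
  settle true ⨟ settle false ⨟ .op [.load reset]

/-- Treat one transition. -/
def trans (k : Bool) : SimProg :=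
  .op [.flip fun b m => { m with fire := b && !m.check }] ⨟ transBody k

/-! #### Loops -/

/-- The hypothesis `hf` makes `f` push nothing for an empty buffer, so the last iteration, which
pops from the empty stack, only clears the buffer. The letters arrive in reverse order. -/
theorem transfer_spec {k k' : StackName} (hk : k ≠ k') {f : Memory → Option Letter}
    {g : Letter → Option Letter} {m : Memory} (hf : ∀ o, f { m with buf := o } = o.bind g)
    (S : StackName → List Letter) {l : List Letter} (hl : S k = l) :
    ExecLE (transfer k k' f) (m, S) (2 * l.length + 1) ({ m with buf := none },
      Function.update (Function.update S k []) k' ((l.filterMap g).reverse ++ S k')) := by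
  induction l generalizing m S with
  | nil =>
    refine (ExecLE.loop_exit (.op false rfl) ?_).congr le_rfl ?_
    · simp [evalOps, Prim.eval, hl, record]
    · simp [evalOps, Prim.eval, hl, record, hf, hk.symm]
  | cons a l ih =>
    refine (ExecLE.loop_next (.op false ?_) (by rfl) (.op false rfl)
      (ih (m := { m with buf := some a }) hf (Function.update (Function.update S k l) k'
        ((g a).toList ++ S k')) (by simp [hk]))).congr ?_ ?_
    · simp [evalOps, Prim.eval, hl, record, hf, hk.symm]
    · simp only [List.length_cons]; omega
    · simp only [Prod.mk.injEq, true_and]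
      funext z
      by_cases h1 : z = k'
      · subst h1
        cases h : g a <;> simp [h]
      · by_cases h2 : z = k
        · subst h2; simp [h1]
        · simp [h1, h2]

/-- The word of letters for a word of bits. -/
def letters (l : List Bool) : List Letter := l.map fun b => if b then one else zero

/-- The code of a list of blocks. -/
def enc (bs : List (List Letter)) : List Letter := bs.flatMap fun b => b ++ [zero]

@[simp] theorem letters_nil : letters [] = [] := rfl
@[simp] theorem letters_append (l l' : List Bool) : letters (l ++ l') = letters l ++ letters l' :=
  List.map_append
@[simp] theorem letters_true (l : List Bool) : letters (true :: l) = one :: letters l := rfl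
@[simp] theorem letters_false (l : List Bool) : letters (false :: l) = zero :: letters l := rfl
@[simp] theorem letters_length (l : List Bool) : (letters l).length = l.length := List.length_map _

@[simp] theorem enc_nil : enc [] = [] := rfl
@[simp] theorem enc_cons (b : List Letter) (bs : List (List Letter)) :
    enc (b :: bs) = b ++ zero :: enc bs := by simp [enc]
@[simp] theorem enc_append (l l' : List (List Letter)) : enc (l ++ l') = enc l ++ enc l' := by
  simp [enc]

variable {i j c r : List Letter} {v w : Bool → List Letter} {k : Bool} {m : Memory}

theorem moveBlock_spec {l : List Letter} (hl : zero ∉ l) (hv : v k = l ++ zero :: r) :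
    ExecLE (moveBlock k) (m, stk i j v w c) (2 * l.length + 1) ({ m with buf := some zero },
      stk i j (Function.update v k r)
        (Function.update w k ((l ++ [zero]).reverse ++ w k)) c) := by
  induction l generalizing m v w with
  | nil =>
    refine (ExecLE.loop_exit (.op false rfl) ?_).congr le_rfl ?_
    · simp [evalOps, Prim.eval, hv, record]
    · simp [evalOps, Prim.eval, hv, record]
  | cons a l ih =>
    simp only [List.mem_cons, not_or] at hl
    refine (ExecLE.loop_next (.op false ?_) ?_ (.op false rfl)
      (ih (m := { m with buf := some a }) (v := Function.update v k (l ++ zero :: r))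
        (w := Function.update w k (a :: w k)) hl.2 (by simp))).congr ?_ ?_
    · simp [evalOps, Prim.eval, hv, record]
    · simp [Ne.symm hl.1]
    · simp only [List.length_cons]; omega
    · simp

theorem seek_spec {pre : List (List Letter)} (hz : ∀ b ∈ pre, zero ∉ b)
    (hv : v k = enc pre ++ r) :
    ExecLE (seek k) (m, stk (letters (DisjSystem.encNat pre.length) ++ i) j v w c)
      (3 * (enc pre).length + 1) ({ m with buf := some zero },
      stk i ((letters (DisjSystem.encNat pre.length)).reverse ++ j) (Function.update v k r)
        (Function.update w k ((enc pre).reverse ++ w k)) c) := by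
  induction pre generalizing m v w j with
  | nil =>
    refine (ExecLE.loop_exit (.op false rfl) ?_).congr le_rfl ?_
    · simp [evalOps, Prim.eval, record, DisjSystem.encNat]
    · simp only [enc_nil, List.nil_append] at hv
      simp [evalOps, Prim.eval, record, DisjSystem.encNat, ← hv]
  | cons b pre ih =>
    have h1 : letters (DisjSystem.encNat (b :: pre).length) =
        one :: letters (DisjSystem.encNat pre.length) := by
      simp [DisjSystem.encNat, List.replicate_succ]
    rw [h1]
    refine (ExecLE.loop_next (s₁ := ({ m with buf := some one },
        stk (letters (DisjSystem.encNat pre.length) ++ i) (one :: j) v w c)) (.op false ?_) rfl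
      (moveBlock_spec (r := enc pre ++ r) (hz b (by simp)) (by simpa using hv))
      (ih (fun b' hb' => hz b' (by simp [hb'])) (Function.update_self ..))).congr ?_ ?_
    · simp [evalOps, Prim.eval, record]
    · simp only [enc_cons, List.length_append, List.length_cons]; omega
    · simp

theorem restore_spec :
    ExecLE (restore k) (m, stk i j v w c) (2 * (w k).length + 1) ({ m with buf := none },
      stk i j (Function.update v k ((w k).reverse ++ v k)) (Function.update w k []) c) := by
  refine (transfer_spec (by simp) (g := some) (fun o => by simp) _ rfl).congr (by simp) ?_
  simp

theorem settle_spec :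
    ExecLE (settle k) (m, stk i j v w c) (2 * (w k).length + 1) ({ m with buf := none },
      stk i j (Function.update v k (((w k).filterMap (settleLetter m.commit)).reverse ++ v k))
        (Function.update w k []) c) := by
  refine (transfer_spec (by simp) (g := settleLetter m.commit) (fun o => rfl) _ rfl).congr
    (by simp) ?_
  simp

/-- The loop treats letters, not blocks, so the statement is in continuation form: the letters of a
block are put in front of an execution of the same loop. -/
theorem guardPass_block {l : List Letter} (hl : zero ∉ l) (hm : m.buf = none)
    (hv : v k = l ++ r) {T : ℕ} {s : SimState}
    (h : ExecLE (guardPass k) ({ m with occ := m.occ || l.contains one },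
      stk i j (Function.update v k r) (Function.update w k (l.reverse ++ w k)) c) T s) :
    ExecLE (guardPass k) (m, stk i j v w c) (T + 2 * l.length) s := by
  induction l generalizing m v w T with
  | nil =>
    simp only [List.nil_append] at hv
    simpa [← hv] using h
  | cons a l ih =>
    simp only [List.mem_cons, not_or] at hl
    have := ih (m := { m with occ := m.occ || a == one })
      (v := Function.update v k (l ++ r)) (w := Function.update w k (a :: w k)) hl.2 hm (by simp)
      (T := T) (by
        convert h using 2
        · simp [Bool.or_assoc, beq_eq_decide, eq_comm (a := a)]
        · simp)
    refine (ExecLE.loop_next (s₁ := ({ m with buf := some a }, stk i j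
      (Function.update v k (l ++ r)) (Function.update w k (a :: w k)) c)) (.op false ?_) rfl
      (.ite_false ?_ (.op false ?_)) this).congr ?_ rfl
    · simp [evalOps, Prim.eval, hv, record]
    · simp [Ne.symm hl.1]
    · simp [evalOps, Prim.eval, hm]
    · simp only [List.length_cons]; omega

/-- Some block that the guard selects contains a process. -/
def guardSat (gs : List Bool) (bs : List (List Letter)) : Bool :=
  (gs.zip bs).any fun p => p.1 && p.2.contains one

theorem guardPass_spec {bs : List (List Letter)} {gs : List Bool} (hz : ∀ b ∈ bs, zero ∉ b)
    (hlen : gs.length = bs.length) (hm : m.buf = none) (ho : m.occ = false) (hv : v k = enc bs) :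
    ExecLE (guardPass k) (m, stk (letters gs ++ i) j v w c) (2 * (enc bs).length + 1)
      ({ m with sat := m.sat || guardSat gs bs },
      stk i ((letters gs).reverse ++ j) (Function.update v k [])
        (Function.update w k ((enc bs).reverse ++ w k)) c) := by
  induction bs generalizing m v w j gs with
  | nil =>
    obtain rfl := List.length_eq_zero_iff.1 hlen
    refine (ExecLE.loop_exit (.op false rfl) ?_).congr le_rfl ?_
    · simp [evalOps, Prim.eval, record, hv]
    · simp [evalOps, Prim.eval, record, hv, guardSat, hm]
  | cons b bs ih =>
    obtain ⟨g, gs, rfl⟩ := List.exists_cons_of_length_pos (l := gs) (by simp [hlen])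
    simp only [enc_cons] at hv
    have h1 := ih (m := { m with sat := m.sat || (b.contains one && g) })
      (v := Function.update v k (enc bs)) (w := Function.update w k (zero :: (b.reverse ++ w k)))
      (j := letters [g] ++ j) (gs := gs) (fun b' hb' => hz b' (by simp [hb'])) (by simpa using hlen)
      hm ho (by simp)
    have h2 : ExecLE (guardPass k) ({ m with occ := m.occ || b.contains one },
        stk (letters (g :: gs) ++ i) j (Function.update v k (zero :: enc bs))
          (Function.update w k (b.reverse ++ w k)) c) _ _ :=
      ExecLE.loop_next (s₁ := ({ m with occ := m.occ || b.contains one, buf := some zero },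
          stk (letters (g :: gs) ++ i) j (Function.update v k (enc bs))
          (Function.update w k (zero :: (b.reverse ++ w k))) c))
        (.op false (by simp [evalOps, Prim.eval, record])) rfl
        (.ite_true rfl (.op false (by
          cases g <;> simp [evalOps, Prim.eval, record, letters, hm, ho]))) h1
    refine (guardPass_block (hz b (by simp)) hm hv h2).congr ?_ ?_
    · simp only [enc_cons, List.length_append, List.length_cons]; omega
    · cases g <;> simp [guardSat, Bool.or_assoc]

/-- Reading a number `t`, an operation on block number `t` is executed. -/
theorem visit_spec {bs : List (List Letter)} (hz : ∀ b ∈ bs, zero ∉ b) {t : ℕ}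
    (ht : t < bs.length) {b' : List Letter} {ops : List (Prim StackName Letter Memory)}
    {m' : Memory} (hv : v k = enc bs) (hw : w k = [])
    (hop : ∀ j v w r, v k = bs[t] ++ zero :: r →
      evalOps false ops ({ m with buf := some zero }, stk i j v w c) =
        (m', stk i j (Function.update v k (b' ++ zero :: r)) w c)) :
    ExecLE (seek k ⨟ .op ops ⨟ restore k)
      (m, stk (letters (DisjSystem.encNat t) ++ i) j v w c) (5 * (enc bs).length + 3)
      ({ m' with buf := none }, stk i ((letters (DisjSystem.encNat t)).reverse ++ j)
        (Function.update v k (enc (bs.set t b'))) w c) := by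
  have h1 : bs = bs.take t ++ bs[t] :: bs.drop (t + 1) := by simp
  have h2 : (bs.take t).length = t := by simp [ht.le]
  have h3 := seek_spec (m := m) (i := i) (j := j) (v := v) (w := w) (k := k) (c := c) (pre := bs.take t)
    (r := bs[t] ++ zero :: enc (bs.drop (t + 1)))
    (fun b hb => hz b (List.mem_of_mem_take hb)) (by rw [hv, ← enc_cons, ← enc_append, ← h1])
  rw [h2] at h3
  refine (h3.seq (.seq (.op false (hop _ _ _ _ (Function.update_self ..))) restore_spec)).congr
    ?_ ?_
  · have := congrArg (fun l => (enc l).length) h1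
    simp only [enc_append, List.length_append] at this
    simp only [Function.update_self, List.length_append, List.length_reverse, hw, List.length_nil]
    omega
  · have h4 : Function.update w k [] = w := by rw [← hw, Function.update_eq_self]
    simp [hw, h4, List.set_eq_take_append_cons_drop, ht]

end Sim

namespace Sim

variable {i j c r : List Letter} {v w : Bool → List Letter} {k : Bool} {m : Memory}

/-! #### Vectors of numbers of processes, and transitions -/

/-- The block for a number of processes. -/
def blk (n : ℕ) : List Letter := List.replicate n one

@[simp] theorem blk_length (n : ℕ) : (blk n).length = n := List.length_replicate

/-- The code of a vector. -/
def encV (l : List ℕ) : List Letter := enc (l.map blk)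

/-- A transition: the numbers of the source and the target, and the characteristic vectors of the
guard for the states of `A` (`true`) and `B` (`false`). -/
structure RawTrans where
  src : ℕ
  tgt : ℕ
  guard : Bool → List Bool

/-- The code of a transition. -/
def RawTrans.code (t : RawTrans) : List Bool :=
  DisjSystem.encNat t.src ++ DisjSystem.encNat t.tgt ++ (t.guard true ++ t.guard false)

/-- The guard is satisfied by the vector. -/
def satV (gs : List Bool) (l : List ℕ) : Bool := (gs.zip l).any fun p => p.1 && decide (1 ≤ p.2)

/-- One process is removed from the state `s`. -/
def decAt (l : List ℕ) (s : ℕ) : List ℕ := l.set s (l.getD s 0 - 1)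

/-- One process is added to the state `t`. -/
def incAt (l : List ℕ) (t : ℕ) : List ℕ := l.set t (l.getD t 0 + 1)

/-- The vectors without the process that takes a transition from `s`. -/
def others (vec : Bool → List ℕ) (k : Bool) (s : ℕ) : Bool → List ℕ :=
  Function.update vec k (decAt (vec k) s)

/-- The transition is enabled. -/
def enabled (vec : Bool → List ℕ) (k : Bool) (t : RawTrans) : Bool :=
  decide (1 ≤ (vec k).getD t.src 0) &&
    (satV (t.guard true) (others vec k t.src true) ||
      satV (t.guard false) (others vec k t.src false))

/-- The vectors after the transition. -/
def fired (vec : Bool → List ℕ) (k : Bool) (t : RawTrans) : Bool → List ℕ :=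
  Function.update vec k (incAt (decAt (vec k) t.src) t.tgt)

/-- The numbers and characteristic vectors of a transition fit the sizes of the templates. -/
structure RawTrans.Valid (sz : Bool → ℕ) (k : Bool) (t : RawTrans) : Prop where
  src_lt : t.src < sz k
  tgt_lt : t.tgt < sz k
  guard_length : ∀ b, (t.guard b).length = sz b

/-- The blocks of a vector, in which the source and the target of a transition are marked. -/
def marked (l : List ℕ) (s t : ℕ) : List (List Letter) :=
  let bs := (l.map blk).set s (if 1 ≤ l.getD s 0 then src :: blk (l.getD s 0 - 1) else [])
  bs.set t (tgt :: bs.getD t [])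

/-- The mark `src` takes the place of one letter `one`, and `tgt` is not a `one`. So a guard pass
sees the counters without the moving process, as the semantics of guards requires. -/
theorem marked_contains (l : List ℕ) (s t : ℕ) :
    (marked l s t).map (·.contains one) = (decAt l s).map fun n => decide (1 ≤ n) := by
  have hb : ∀ n, (blk n).contains one = decide (1 ≤ n) := by
    intro n; cases n <;> simp [blk, List.replicate_succ]
  refine List.ext_getElem (by simp [marked, decAt]) fun n h1 h2 => ?_
  simp only [marked, decAt, List.length_map, List.length_set] at h1 h2
  simp only [marked, decAt, List.getElem_map, List.getElem_set, List.getD_eq_getElem?_getD,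
    List.getElem?_set, List.getElem?_map, List.length_map]
  by_cases hs : s = n <;> by_cases ht : t = n
  · subst hs ht
    by_cases h : 1 ≤ l[t]
    · simp [h1, h, -List.contains_eq_mem, List.contains_cons, hb,
        show (one == tgt) = false from rfl, show (one == src) = false from rfl]
    · simp [h1, show l[t] = 0 by omega]
  · subst hs
    by_cases h : 1 ≤ l[s]
    · simp [h1, h, ht, -List.contains_eq_mem, List.contains_cons, hb]
    · simp [h1, ht, show l[s] = 0 by omega]
  · subst ht
    simp [hs, h1, -List.contains_eq_mem, List.contains_cons, hb]
  · simp [hs, ht, -List.contains_eq_mem, hb]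

theorem guardSat_marked (gs : List Bool) (l : List ℕ) (s t : ℕ) :
    guardSat gs (marked l s t) = satV gs (decAt l s) := by
  have h1 : ∀ bs, guardSat gs bs = (gs.zip (bs.map (·.contains one))).any fun p => p.1 && p.2 := by
    intro bs; rw [List.zip_map_right, List.any_map]; rfl
  have h2 : ∀ l, satV gs l = (gs.zip (l.map fun n => decide (1 ≤ n))).any fun p => p.1 && p.2 := by
    intro l; rw [List.zip_map_right, List.any_map]; rfl
  rw [h1, h2, marked_contains]

theorem guardSat_map_blk (gs : List Bool) (l : List ℕ) :
    guardSat gs (l.map blk) = satV gs l := by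
  rw [guardSat, satV, List.zip_map_right, List.any_map]
  congr 1
  funext p
  cases h : p.2 <;> simp [h, blk, List.replicate_succ]

theorem filterMap_blk (b : Bool) (n : ℕ) : (blk n).filterMap (settleLetter b) = blk n := by
  simp [blk, List.filterMap_replicate, settleLetter]

theorem filterMap_enc (b : Bool) (bs : List (List Letter)) :
    (enc bs).filterMap (settleLetter b) = enc (bs.map (List.filterMap (settleLetter b))) := by
  induction bs with
  | nil => rfl
  | cons a bs ih => simp [ih, settleLetter]

/-- The source has to be occupied: otherwise there is no `src` to delete, and turning `tgt` into
`one` would create a process. -/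
theorem marked_commit {l : List ℕ} {s t : ℕ} (h : 1 ≤ l.getD s 0) :
    (marked l s t).map (List.filterMap (settleLetter true)) =
      (incAt (decAt l s) t).map blk := by
  refine List.ext_getElem (by simp [marked, decAt, incAt]) fun n h1 h2 => ?_
  simp only [marked, List.length_map, List.length_set] at h1
  simp only [marked, decAt, incAt, List.getElem_map, List.getElem_set,
    List.getD_eq_getElem?_getD, List.getElem?_set, List.getElem?_map, List.length_map] at h ⊢
  by_cases hs : s = n <;> by_cases ht : t = n
  · subst hs ht
    simp only [h1, List.getElem?_eq_getElem, Option.getD_some] at h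
    simp [h1, h, settleLetter, filterMap_blk]
    simp [blk, ← List.replicate_succ, Nat.sub_add_cancel h]
  · subst hs
    simp only [h1, List.getElem?_eq_getElem, Option.getD_some] at h
    simp [h1, ht, h, settleLetter, filterMap_blk]
  · subst ht
    simp [hs, h1, settleLetter, filterMap_blk]
    simp [blk, List.replicate_succ]
  · simp [hs, ht, filterMap_blk]

/-- No condition on the source is needed, because an empty source received no mark. -/
theorem marked_rollback (l : List ℕ) (s t : ℕ) :
    (marked l s t).map (List.filterMap (settleLetter false)) = l.map blk := by
  refine List.ext_getElem (by simp [marked]) fun n h1 h2 => ?_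
  simp only [marked, List.length_map, List.length_set] at h1
  simp only [marked, List.getElem_map, List.getElem_set,
    List.getD_eq_getElem?_getD, List.getElem?_set, List.getElem?_map, List.length_map]
  have hb : ∀ n, 1 ≤ n → one :: blk (n - 1) = blk n := by
    intro n hn
    obtain ⟨n, rfl⟩ := Nat.exists_eq_add_of_le' hn
    simp [blk, List.replicate_succ]
  by_cases hs : s = n <;> by_cases ht : t = n
  · subst hs ht
    by_cases h : 1 ≤ l[t]
    · simp [h1, h, settleLetter, filterMap_blk, hb]
    · simp [h1, show l[t] = 0 by omega, settleLetter, blk]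
  · subst hs
    by_cases h : 1 ≤ l[s]
    · simp [h1, h, ht, settleLetter, filterMap_blk, hb]
    · simp [h1, ht, show l[s] = 0 by omega, blk]
  · subst ht
    simp [hs, h1, settleLetter, filterMap_blk]
  · simp [hs, ht, filterMap_blk]

theorem length_enc_set_le {bs : List (List Letter)} {t d : ℕ} (ht : t < bs.length)
    {b : List Letter} (hb : b.length ≤ bs[t].length + d) :
    (enc (bs.set t b)).length ≤ (enc bs).length + d := by
  have h1 : enc bs = enc (bs.take t ++ bs[t] :: bs.drop (t + 1)) := by simp
  rw [h1, List.set_eq_take_append_cons_drop, if_pos ht]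
  simp only [enc_append, enc_cons, List.length_append, List.length_cons]
  omega

theorem zero_notMem_map_blk (l : List ℕ) : ∀ b ∈ l.map blk, zero ∉ b := by
  simp [blk, List.mem_replicate]

theorem zero_notMem_mark (n : ℕ) : zero ∉ (if 1 ≤ n then src :: blk (n - 1) else []) := by
  split_ifs <;> simp [blk, List.mem_replicate]

theorem zero_notMem_set {bs : List (List Letter)} (hz : ∀ b ∈ bs, zero ∉ b) {t : ℕ}
    {b : List Letter} (hb : zero ∉ b) : ∀ b' ∈ bs.set t b, zero ∉ b' := by
  intro b' h
  rcases List.mem_or_eq_of_mem_set h with h | rfl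
  · exact hz b' h
  · exact hb

/-- The state of the simulation. -/
def sim (c : List Letter) (o : Option Letter) (ch bd : Bool) (i j : List Letter)
    (vec : Bool → List ℕ) : SimState :=
  ({ buf := o, check := ch, bad := bd }, stk i j (fun b => encV (vec b)) (fun _ => []) c)

/-- The number of letters that describe the vectors. -/
def size (vec : Bool → List ℕ) : ℕ := (encV (vec true)).length + (encV (vec false)).length

theorem mark_spec {l : List ℕ} {s t : ℕ} (hs : s < l.length) (ht : t < l.length)
    (hv : v k = encV l) (hw : w k = []) :
    ExecLE (mark k)
      (m, stk (letters (DisjSystem.encNat s ++ DisjSystem.encNat t) ++ i) j v w c)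
      (10 * (encV l).length + 6) ({ m with buf := none, ok := decide (1 ≤ l.getD s 0) },
        stk i ((letters (DisjSystem.encNat s ++ DisjSystem.encNat t)).reverse ++ j)
          (Function.update v k (enc (marked l s t))) w c) := by
  have hs' : l.getD s 0 = l[s] := List.getD_eq_getElem _ _ hs
  set bs := (l.map blk).set s (if 1 ≤ l.getD s 0 then src :: blk (l.getD s 0 - 1) else [])
    with hbs
  have h1 := visit_spec (i := letters (DisjSystem.encNat t) ++ i) (j := j) (m := m) (c := c)
    (zero_notMem_map_blk l) (t := s) (by simpa using hs) (ops := markSrc k)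
    (b' := if 1 ≤ l.getD s 0 then src :: blk (l.getD s 0 - 1) else [])
    (m' := { m with ok := decide (1 ≤ l.getD s 0),
                    buf := if 1 ≤ l.getD s 0 then some one else some zero }) hv hw (by
      intro j v w r hv
      rw [List.getElem_map, ← hs'] at hv
      revert hv
      generalize l.getD s 0 = n
      intro hv
      cases n <;> simp [markSrc, evalOps, Prim.eval, hv, blk, record, List.replicate_succ])
  have ht' : t < bs.length := by simpa [hbs] using ht
  have h2 := visit_spec (i := i) (j := (letters (DisjSystem.encNat s)).reverse ++ j)
    (v := Function.update v k (enc bs)) (k := k)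
    (m := { m with buf := none, ok := decide (1 ≤ l.getD s 0) }) (c := c)
    (bs := bs) (zero_notMem_set (zero_notMem_map_blk l) (zero_notMem_mark _)) (t := t) ht'
    (ops := markTgt k) (b' := tgt :: bs.getD t [])
    (m' := { m with buf := some zero, ok := decide (1 ≤ l.getD s 0) })
    (Function.update_self ..) hw (by
      intro j v w r hv
      simp [markTgt, evalOps, Prim.eval, hv, ht'])
  have h3 : (enc bs).length ≤ (encV l).length + 0 := length_enc_set_le (by simpa using hs) (by
    rw [List.getElem_map, ← hs', blk_length]
    split_ifs with h
    · simp only [List.length_cons, blk_length]; omega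
    · simp)
  rw [letters_append, List.append_assoc]
  refine (h1.seq h2).congr ?_ ?_
  · change 5 * (encV l).length + 3 + _ ≤ _
    omega
  · rw [show marked l s t = bs.set t (tgt :: bs.getD t []) from rfl]
    simp [-List.getD_eq_getElem?_getD]

/-- The code of a transition is read only once, and source and target come before the guard. The
marks remember both places on the stacks until the guard has been evaluated and the transition can
be committed or undone. -/
theorem transBody_spec {sz : Bool → ℕ} {t : RawTrans} (ht : t.Valid sz k) {vec : Bool → List ℕ}
    (hvec : ∀ b, (vec b).length = sz b) (hocc : m.occ = false) (hsat : m.sat = false) :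
    ExecLE (transBody k) (m, stk (letters t.code ++ i) j (fun b => encV (vec b)) (fun _ => []) c)
      (20 * size vec + 30)
      (sim c none m.check (m.bad || (m.check && enabled vec k t)) i ((letters t.code).reverse ++ j)
        (if enabled vec k t && m.fire then fired vec k t else vec)) := by
  set B : Bool → List (List Letter) :=
    Function.update (fun b => (vec b).map blk) k (marked (vec k) t.src t.tgt) with hB
  have hBz : ∀ b, ∀ x ∈ B b, zero ∉ x := by
    intro b
    by_cases h : b = k
    · subst h
      rw [hB, Function.update_self, marked]
      have h0 := zero_notMem_set (t := t.src) (zero_notMem_map_blk (vec b))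
        (zero_notMem_mark ((vec b).getD t.src 0))
      refine zero_notMem_set h0 ?_
      rw [List.mem_cons, not_or]
      refine ⟨by decide, ?_⟩
      rw [List.getD_eq_getElem _ _ (by simpa [hvec] using ht.tgt_lt)]
      exact h0 _ (List.getElem_mem _)
    · rw [hB, Function.update_of_ne h]; exact zero_notMem_map_blk _
  have hBlen : ∀ b, (B b).length = sz b := by
    intro b
    by_cases h : b = k
    · subst h; simp [hB, marked, hvec]
    · simp [hB, h, hvec]
  have hBsat : ∀ b, guardSat (t.guard b) (B b) = satV (t.guard b) (others vec k t.src b) := by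
    intro b
    by_cases h : b = k
    · subst h; simp [hB, others, guardSat_marked]
    · simp [hB, others, h, guardSat_map_blk]
  -- Only `tgt` adds a letter; `src` replaces one.
  have hBsize : (enc (B true)).length + (enc (B false)).length ≤ size vec + 1 := by
    have h1 : (enc (marked (vec k) t.src t.tgt)).length ≤ (encV (vec k)).length + 1 := by
      have hs : t.src < (vec k).length := by rw [hvec]; exact ht.src_lt
      have h2 : t.tgt < ((vec k).map blk).length := by simpa [hvec] using ht.tgt_lt
      refine (length_enc_set_le (d := 1) (by simpa using h2) ?_).trans
        (Nat.add_le_add_right (length_enc_set_le (d := 0) (by simpa using hs) ?_) 1)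
      · rw [List.getD_eq_getElem _ _ (by simpa using h2), List.length_cons]
      · rw [List.getElem_map, List.getD_eq_getElem _ _ hs, blk_length]
        split_ifs with h
        · simp only [List.length_cons, blk_length]; omega
        · simp
    cases k <;> simp only [hB, size, Function.update_self, ne_eq, Bool.true_eq_false,
      Bool.false_eq_true, not_false_eq_true, Function.update_of_ne] <;> rw [encV] <;>
      rw [encV] at h1 <;> simp only [encV] at h1 ⊢ <;> omega
  set ok : Bool := decide (1 ≤ (vec k).getD t.src 0) with hok
  set sat : Bool := satV (t.guard true) (others vec k t.src true) ||
      satV (t.guard false) (others vec k t.src false) with hsat'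
  have hen : enabled vec k t = (ok && sat) := rfl
  have h1 := mark_spec (m := m) (i := letters (t.guard true) ++ (letters (t.guard false) ++ i))
    (j := j) (c := c) (v := fun b => encV (vec b)) (w := fun _ => []) (k := k)
    (s := t.src) (t := t.tgt) (l := vec k) (by rw [hvec]; exact ht.src_lt)
    (by rw [hvec]; exact ht.tgt_lt) rfl rfl
  have hv1 : Function.update (fun b => encV (vec b)) k (enc (marked (vec k) t.src t.tgt)) =
      fun b => enc (B b) := by
    funext b
    by_cases h : b = k
    · subst h; simp [hB]
    · simp [hB, h, encV]
  rw [hv1] at h1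
  have h2 := guardPass_spec (k := true) (m := { m with buf := none, ok := ok })
    (i := letters (t.guard false) ++ i)
    (j := (letters (DisjSystem.encNat t.src ++ DisjSystem.encNat t.tgt)).reverse ++ j)
    (v := fun b => enc (B b)) (w := fun _ => []) (c := c) (gs := t.guard true) (hBz true)
    (by rw [ht.guard_length, hBlen]) rfl hocc rfl
  have h3 := guardPass_spec (k := false)
    (m := { m with buf := none, ok := ok, sat := m.sat || guardSat (t.guard true) (B true) })
    (i := i) (j := (letters (t.guard true)).reverse ++
      ((letters (DisjSystem.encNat t.src ++ DisjSystem.encNat t.tgt)).reverse ++ j))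
    (v := Function.update (fun b => enc (B b)) true [])
    (w := Function.update (fun _ => []) true ((enc (B true)).reverse ++ [])) (c := c)
    (gs := t.guard false) (hBz false) (by rw [ht.guard_length, hBlen]) rfl hocc
    (Function.update_of_ne (by simp) ..)
  have hsize : (encV (vec k)).length ≤ size vec := by cases k <;> simp [size]
  -- A committed transition has `ok` true, which provides the occupied source that `marked_commit`
  -- needs.
  have hfin : ∀ b, ((enc (B b)).reverse.filterMap (settleLetter (ok && sat && m.fire))).reverse =
      encV ((if enabled vec k t && m.fire then fired vec k t else vec) b) := by
    intro b
    rw [List.filterMap_reverse, List.reverse_reverse, filterMap_enc, encV, hen]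
    by_cases h : b = k
    · subst h
      rw [hB, Function.update_self]
      cases hc : ok && sat && m.fire
      · simp [marked_rollback]
      · simp only [Bool.and_eq_true] at hc
        rw [marked_commit (of_decide_eq_true hc.1.1)]
        simp [fired]
    · rw [hB, Function.update_of_ne h, List.map_map]
      have : (if (ok && sat && m.fire) = true then fired vec k t else vec) b = vec b := by
        split_ifs
        · simp [fired, h]
        · rfl
      rw [this]
      refine congrArg enc (List.map_congr_left fun n _ => filterMap_blk _ n)
  have hcode : letters t.code ++ i = letters (DisjSystem.encNat t.src ++ DisjSystem.encNat t.tgt) ++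
      (letters (t.guard true) ++ (letters (t.guard false) ++ i)) := by simp [RawTrans.code]
  rw [hcode]
  refine (ExecLE.seq h1 (.seq h2 (.seq h3
    (.seq (.op (s' := ({ m with
      buf := none, ok := ok, sat := sat, commit := ok && sat && m.fire,
      bad := m.bad || (m.check && (ok && sat)) }, stk i ((letters t.code).reverse ++ j)
        (fun _ => []) (fun b => (enc (B b)).reverse) c)) false ?_) (.seq settle_spec
      (.seq settle_spec (.op (s' := sim c none m.check (m.bad || (m.check && enabled vec k t)) i
        ((letters t.code).reverse ++ j)
        (if enabled vec k t && m.fire then fired vec k t else vec)) false ?_))))))).congr ?_ ?_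
  · have hv2 : Function.update (Function.update (fun b => enc (B b)) true []) false [] =
        fun _ => [] := by funext b; cases b <;> simp
    have hw2 : Function.update (Function.update (fun _ => []) true (enc (B true)).reverse) false
        (enc (B false)).reverse = fun b => (enc (B b)).reverse := by funext b; cases b <;> simp
    simp [evalOps, Prim.eval, hsat, hBsat, ← hsat', RawTrans.code, hv2, hw2]
  · simp only [evalOps, Prim.eval, reset, sim, hen, Prod.mk.injEq, true_and]
    congr 1
    · funext b
      cases b
      · simpa [hen] using hfin false
      · simpa [hen] using hfin true
    · funext b; cases b <;> simp
  · simp only [ne_eq, Bool.false_eq_true, not_false_eq_true, Function.update_of_ne,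
      List.length_reverse]
    omega
  · rfl

end Sim

theorem ExecLE.exec_seq_eq {K Γ σ : Type} [DecidableEq K] {P Q : Prog K Γ σ}
    {s s₁ s' : σ × (K → List Γ)} {n m : ℕ} (h₁ : ExecLE P s n s₁) (hP : P.Det)
    (h : Exec (.seq P Q) s m s') : ∃ m', Exec Q s₁ m' s' := by
  cases h with
  | seq h2 h3 => exact ⟨_, h₁.eq_of_exec hP h2 ▸ h3⟩

/-- If `I` holds before each iteration of a loop and `R` at each test, then `R` holds at the end. -/
theorem Exec.loop_inv {K Γ σ : Type} [DecidableEq K] {P Q : Prog K Γ σ} {p : σ → Bool}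
    {I R : σ × (K → List Γ) → Prop} (hP : ∀ s n s', I s → Exec P s n s' → R s')
    (hQ : ∀ s n s', R s → p s.1 = true → Exec Q s n s' → I s') {s s' : σ × (K → List Γ)} {n : ℕ}
    (hs : I s) (h : Exec (.loop P p Q) s n s') : R s' ∧ p s'.1 = false := by
  generalize hL : Prog.loop P p Q = L at h
  induction h with
  | loop_exit h1 hp _ =>
    cases hL
    exact ⟨hP _ _ _ hs h1, hp⟩
  | loop_next h1 hp h2 _ _ _ ih =>
    cases hL
    exact ih (hQ _ _ _ (hP _ _ _ hs h1) hp h2) rfl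
  | _ => cases hL

namespace Sim

variable {i j c r : List Letter} {v w : Bool → List Letter} {k : Bool} {m : Memory}

/-- Treat a list of transitions. -/
def transLoop (k : Bool) : SimProg := .loop (move I J) (fun m => m.buf == some one) (trans k)

/-- Treat all transitions. -/
def round : SimProg := transLoop true ⨟ transLoop false ⨟ transfer J I (·.buf)

/-- Treat all transitions arbitrarily often. -/
def run : SimProg :=
  .loop (.op [.flip fun b m => { m with fire := b }]) (·.fire) (.op [.load reset] ⨟ round)

/-- Check all transitions. -/
def verify : SimProg := .op [.load fun m => { m with check := true }] ⨟ round

/-- Read a number and produce that many empty blocks. -/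
def initBlocks (k : Bool) : SimProg :=
  .loop (move I J) (fun m => m.buf == some one) (.op [.push (V k) fun _ => some zero])

/-- Produce the vector for `A`, and find the place where the processes `B` are to be put. -/
def initA : SimProg :=
  initBlocks true ⨟ initBlocks false ⨟
  (seek true ⨟ .op [.push (V true) fun _ => some one] ⨟ restore true) ⨟ seek false

/-- Choose a positive number of processes `B`. -/
def guess : SimProg :=
  .loop (.op [.push (V false) fun _ => some one, .flip fun b m => { m with fire := b }]) (·.fire)
    (.op [])

/-- Restore the vectors, and forget the part of the input that has been read. -/
def initB : SimProg := restore false ⨟ transfer J I (fun _ => none) ⨟ .op [.load reset]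

/-- The simulation of a disjunctive system. -/
def main : SimProg := initA ⨟ guess ⨟ initB ⨟ run ⨟ verify

/-! ### Determinism of the subroutines, and separation from the clock. -/

theorem det_transfer (k k' : StackName) (f : Memory → Option Letter) : (transfer k k' f).Det := by
  simp [transfer, Prog.Det, Prim.Det]

theorem det_move (k k' : StackName) : (move k k').Det := by
  simp [move, Prog.Det, Prim.Det]

theorem det_seek : (seek k).Det := by
  simp [seek, moveBlock, Prog.Det, Prim.Det, det_move]

theorem det_transBody : (transBody k).Det := by
  simp [transBody, mark, markSrc, markTgt, guardPass, settle, restore, Prog.Det, Prim.Det,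
    det_transfer, det_seek, det_move]

theorem det_initA : initA.Det := by
  simp [initA, initBlocks, restore, Prog.Det, Prim.Det, det_transfer, det_seek, det_move]

theorem det_initB : initB.Det := by
  simp [initB, restore, Prog.Det, Prim.Det, det_transfer]

theorem avoids_main : main.Avoids clk := by
  simp [main, initA, initB, guess, run, verify, round, transLoop, trans, transBody, mark, markSrc,
    markTgt, guardPass, settle, restore, seek, moveBlock, move, transfer, initBlocks, Prog.Avoids,
    Prim.Avoids]

/-! #### The rounds -/

theorem move_spec {a : Letter} : ExecLE (move I J) (m, stk (a :: i) j v w c) 1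
    ({ m with buf := some a }, stk i (a :: j) v w c) :=
  .op false (by simp [evalOps, Prim.eval, record])

/-- The transitions of a system are given by two lists. -/
abbrev RawSystem := Bool → List RawTrans

/-- A transition of the system from one vector to another. -/
def RawStep (L : RawSystem) (vec vec' : Bool → List ℕ) : Prop :=
  ∃ k, ∃ t ∈ L k, enabled vec k t = true ∧ vec' = fired vec k t

/-- The system is well-formed. -/
def RawSystem.Valid (sz : Bool → ℕ) (L : RawSystem) : Prop := ∀ k, ∀ t ∈ L k, t.Valid sz k

theorem length_fired {vec : Bool → List ℕ} {sz : Bool → ℕ} (h : ∀ b, (vec b).length = sz b)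
    (k : Bool) (t : RawTrans) (b : Bool) : (fired vec k t b).length = sz b := by
  by_cases hb : b = k
  · subst hb; simp [fired, incAt, decAt, h]
  · simp [fired, hb, h]

variable {o : Option Letter} {ch bd : Bool} {sz : Bool → ℕ} {vec : Bool → List ℕ} {t : RawTrans}
  {s' : SimState} {n Z : ℕ}

theorem trans_complete (ht : t.Valid sz k) (hvec : ∀ b, (vec b).length = sz b) (f : Bool) :
    ExecLE (trans k) (sim c o ch bd (letters t.code ++ i) j vec) (20 * size vec + 31)
      (sim c none ch (bd || (ch && enabled vec k t)) i ((letters t.code).reverse ++ j)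
        (if enabled vec k t && (f && !ch) then fired vec k t else vec)) :=
  ((ExecLE.op f rfl).seq (transBody_spec (m := { buf := o, check := ch, bad := bd, fire := f && !ch })
    ht hvec rfl rfl)).congr (by omega) rfl

theorem trans_sound (ht : t.Valid sz k) (hvec : ∀ b, (vec b).length = sz b)
    (h : Exec (trans k) (sim c o ch bd (letters t.code ++ i) j vec) n s') : ∃ f,
      s' = sim c none ch (bd || (ch && enabled vec k t)) i ((letters t.code).reverse ++ j)
        (if enabled vec k t && (f && !ch) then fired vec k t else vec) := by
  cases h with
  | seq h1 h2 =>
    cases h1 with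
    | op f =>
      exact ⟨f, (transBody_spec (m := { buf := o, check := ch, bad := bd, fire := f && !ch })
        ht hvec rfl rfl).eq_of_exec det_transBody h2⟩

/-- The code of a list of transitions. -/
def codeList (l : List RawTrans) : List Bool := (l.flatMap fun t => true :: t.code) ++ [false]

theorem letters_codeList_cons (l : List RawTrans) :
    letters (codeList (t :: l)) = one :: (letters t.code ++ letters (codeList l)) := by
  simp [codeList]

/-- This is the execution in which every guess is negative. In the checking mode it also collects in
`bad` whether some transition is enabled. -/
theorem transLoop_skip {l : List RawTrans} (hl : ∀ t ∈ l, t.Valid sz k)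
    (hvec : ∀ b, (vec b).length = sz b) :
    ExecLE (transLoop k) (sim c o ch bd (letters (codeList l) ++ i) j vec)
      (l.length * (20 * size vec + 32) + 1)
      (sim c (some zero) ch (bd || (ch && l.any (enabled vec k))) i
        ((letters (codeList l)).reverse ++ j) vec) := by
  induction l generalizing o bd j with
  | nil =>
    refine (ExecLE.loop_exit move_spec ?_).congr (by simp) ?_
    · rfl
    · simp [codeList, sim]
  | cons t l ih =>
    have hm : ExecLE (move I J) (sim c o ch bd (one :: (letters t.code ++
        (letters (codeList l) ++ i))) j vec) 1 (sim c (some one) ch bd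
      (letters t.code ++ (letters (codeList l) ++ i)) (one :: j) vec) := move_spec
    have h1 := trans_complete (c := c) (o := some one) (ch := ch) (bd := bd)
      (i := letters (codeList l) ++ i) (j := one :: j) (hl t (by simp)) hvec false
    simp only [Bool.false_and, Bool.and_false, Bool.false_eq_true, if_false] at h1
    rw [letters_codeList_cons, List.cons_append, List.append_assoc]
    refine (ExecLE.loop_next hm rfl h1 (ih fun t' ht' => hl t' (by simp [ht']))).congr ?_ ?_
    · rw [List.length_cons, Nat.succ_mul l.length]; omega
    · simp [Bool.and_or_distrib_left, Bool.or_assoc]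

/-- The transition is taken at its first occurrence in the list and everything else is skipped, so a
single pass can realize any enabled transition. The bound `Z` covers the vectors before and after
it, on which the time depends. -/
theorem transLoop_fire {l : List RawTrans} (hl : ∀ t ∈ l, t.Valid sz k)
    (hvec : ∀ b, (vec b).length = sz b) (ht : t ∈ l) (hen : enabled vec k t = true)
    (hZ : size vec ≤ Z) (hZ' : size (fired vec k t) ≤ Z) :
    ExecLE (transLoop k) (sim c o false bd (letters (codeList l) ++ i) j vec)
      (l.length * (20 * Z + 32) + 1)
      (sim c (some zero) false bd i ((letters (codeList l)).reverse ++ j) (fired vec k t)) := by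
  induction l generalizing o j with
  | nil => simp at ht
  | cons t' l ih =>
    have hl' : ∀ t ∈ l, t.Valid sz k := fun t' ht' => hl t' (by simp [ht'])
    have hm : ExecLE (move I J) (sim c o false bd (one :: (letters t'.code ++
        (letters (codeList l) ++ i))) j vec) 1 (sim c (some one) false bd
      (letters t'.code ++ (letters (codeList l) ++ i)) (one :: j) vec) := move_spec
    rw [letters_codeList_cons, List.cons_append, List.append_assoc]
    have hlen : (t' :: l).length * (20 * Z + 32) = l.length * (20 * Z + 32) + (20 * Z + 32) := by
      rw [List.length_cons, Nat.succ_mul]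
    by_cases heq : t' = t
    · subst heq
      have h1 := trans_complete (c := c) (o := some one) (ch := false) (bd := bd)
        (i := letters (codeList l) ++ i) (j := one :: j) (hl t' (by simp)) hvec true
      simp only [hen, Bool.not_false, Bool.and_self, if_true, Bool.false_and, Bool.or_false] at h1
      refine (ExecLE.loop_next hm rfl h1
        ((transLoop_skip hl' (length_fired hvec k t')).congr le_rfl rfl)).congr ?_ ?_
      · have : l.length * (20 * size (fired vec k t') + 32) ≤ l.length * (20 * Z + 32) :=
          Nat.mul_le_mul le_rfl (by omega)
        omega
      · simp
    · have h1 := trans_complete (c := c) (o := some one) (ch := false) (bd := bd)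
        (i := letters (codeList l) ++ i) (j := one :: j) (hl t' (by simp)) hvec false
      simp only [Bool.false_and, Bool.and_false, Bool.or_false, Bool.false_eq_true, if_false] at h1
      refine (ExecLE.loop_next hm rfl h1
        (ih hl' ((List.mem_cons.1 ht).resolve_left (Ne.symm heq)))).congr ?_ ?_
      · omega
      · simp

/-- The program is not deterministic, but the checking mode masks the nondeterministic bit, so all
executions have the same outcome. -/
theorem transLoop_check {l : List RawTrans} (hl : ∀ t ∈ l, t.Valid sz k)
    (hvec : ∀ b, (vec b).length = sz b)
    (h : Exec (transLoop k) (sim c o true bd (letters (codeList l) ++ i) j vec) n s') :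
    s' = sim c (some zero) true (bd || l.any (enabled vec k)) i
        ((letters (codeList l)).reverse ++ j) vec := by
  induction l generalizing o bd j n with
  | nil =>
    have hm : ExecLE (move I J) (sim c o true bd (letters (codeList []) ++ i) j vec) 1
      (sim c (some zero) true bd i (zero :: j) vec) := move_spec
    cases h with
    | loop_exit h1 _ => rw [hm.eq_of_exec (det_move _ _) h1]; simp [codeList]
    | loop_next h1 hp _ _ =>
      obtain rfl := hm.eq_of_exec (det_move _ _) h1
      simp [sim] at hp
  | cons t l ih =>
    have hm : ExecLE (move I J) (sim c o true bd (one :: (letters t.code ++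
        (letters (codeList l) ++ i))) j vec) 1 (sim c (some one) true bd
      (letters t.code ++ (letters (codeList l) ++ i)) (one :: j) vec) := move_spec
    rw [letters_codeList_cons, List.cons_append, List.append_assoc] at h
    cases h with
    | loop_exit h1 hp =>
      obtain rfl := hm.eq_of_exec (det_move _ _) h1
      simp [sim] at hp
    | loop_next h1 _ h2 h3 =>
      obtain rfl := hm.eq_of_exec (det_move _ _) h1
      obtain ⟨f, rfl⟩ := trans_sound (hl t (by simp)) hvec h2
      simp only [Bool.not_true, Bool.and_false, Bool.false_eq_true, if_false, Bool.true_and] at h3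
      rw [ih (fun t' ht' => hl t' (by simp [ht'])) h3, letters_codeList_cons]
      simp [Bool.or_assoc]

/-- A pass may take several transitions one after another. Each is tested against the vector of that
moment, so together they form a run. The list `l` is a part of `L k` to allow induction while
`RawStep L` stays fixed. -/
theorem transLoop_sound {L : RawSystem} {l : List RawTrans} (hL : L.Valid sz) (hl : l ⊆ L k)
    (hvec : ∀ b, (vec b).length = sz b)
    (h : Exec (transLoop k) (sim c o false bd (letters (codeList l) ++ i) j vec) n s') :
    ∃ vec', Relation.ReflTransGen (RawStep L) vec vec' ∧ (∀ b, (vec' b).length = sz b) ∧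
      s' = sim c (some zero) false bd i ((letters (codeList l)).reverse ++ j) vec' := by
  induction l generalizing o j n vec with
  | nil =>
    have hm : ExecLE (move I J) (sim c o false bd (letters (codeList []) ++ i) j vec) 1
      (sim c (some zero) false bd i (zero :: j) vec) := move_spec
    cases h with
    | loop_exit h1 _ =>
      exact ⟨vec, .refl, hvec, by rw [hm.eq_of_exec (det_move _ _) h1]; simp [codeList]⟩
    | loop_next h1 hp _ _ =>
      obtain rfl := hm.eq_of_exec (det_move _ _) h1
      simp [sim] at hp
  | cons t l ih =>
    have hm : ExecLE (move I J) (sim c o false bd (one :: (letters t.code ++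
        (letters (codeList l) ++ i))) j vec) 1 (sim c (some one) false bd
      (letters t.code ++ (letters (codeList l) ++ i)) (one :: j) vec) := move_spec
    rw [letters_codeList_cons, List.cons_append, List.append_assoc] at h
    have htl : t ∈ L k := hl (by simp)
    cases h with
    | loop_exit h1 hp =>
      obtain rfl := hm.eq_of_exec (det_move _ _) h1
      simp [sim] at hp
    | loop_next h1 _ h2 h3 =>
      obtain rfl := hm.eq_of_exec (det_move _ _) h1
      obtain ⟨f, rfl⟩ := trans_sound (hL k t htl) hvec h2
      rw [Bool.false_and, Bool.or_false] at h3
      set vec₁ := if (enabled vec k t && (f && !false)) = true then fired vec k t else vec with hv₁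
      have h4 : Relation.ReflTransGen (RawStep L) vec vec₁ ∧ ∀ b, (vec₁ b).length = sz b := by
        rw [hv₁]
        split_ifs with hc
        · simp only [Bool.and_eq_true] at hc
          exact ⟨.single ⟨k, t, htl, hc.1, rfl⟩, length_fired hvec k t⟩
        · exact ⟨.refl, hvec⟩
      obtain ⟨vec', h5, h6, rfl⟩ := ih (fun t' ht' => hl (by simp [ht'])) h4.2 h3
      refine ⟨vec', h4.1.trans h5, h6, ?_⟩
      rw [letters_codeList_cons]
      simp

/-- The input of a round. -/
def input (L : RawSystem) : List Letter :=
  letters (codeList (L true)) ++ (letters (codeList (L false)) ++ [])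

theorem rewind_spec {L : RawSystem} : ExecLE (transfer J I (·.buf))
    (sim c o ch bd [] ((letters (codeList (L false))).reverse ++
      ((letters (codeList (L true))).reverse ++ [])) vec) (2 * (input L).length + 1)
    (sim c none ch bd (input L) [] vec) := by
  refine (transfer_spec (by simp) (g := some) (fun o => by simp) _ rfl).congr ?_ ?_
  · simp [input]; omega
  · simp [sim, input]

/-- The time for a round. -/
def roundTime (L : RawSystem) (Z : ℕ) : ℕ :=
  ((L true).length + (L false).length) * (20 * Z + 32) + 2 * (input L).length + 3

theorem round_skip {L : RawSystem} (hL : L.Valid sz) (hvec : ∀ b, (vec b).length = sz b) :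
    ExecLE round (sim c o ch bd (input L) [] vec) (roundTime L (size vec))
      (sim c none ch (bd || (ch && ((L true).any (enabled vec true) ||
        (L false).any (enabled vec false)))) (input L) [] vec) := by
  refine ((transLoop_skip (hL true) hvec).seq ((transLoop_skip (hL false) hvec).seq
    rewind_spec)).congr ?_ ?_
  · rw [roundTime, Nat.add_mul]; omega
  · rw [Bool.or_assoc, ← Bool.and_or_distrib_left]

theorem round_step {L : RawSystem} {vec' : Bool → List ℕ} (hL : L.Valid sz)
    (hvec : ∀ b, (vec b).length = sz b) (hs : RawStep L vec vec') (hZ : size vec ≤ Z)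
    (hZ' : size vec' ≤ Z) :
    ExecLE round (sim c o false bd (input L) [] vec) (roundTime L Z)
      (sim c none false bd (input L) [] vec') := by
  obtain ⟨k, t, ht, hen, rfl⟩ := hs
  have hmono : ∀ x l, x ≤ Z → (l : List RawTrans).length * (20 * x + 32) ≤
      l.length * (20 * Z + 32) := fun x l hx => Nat.mul_le_mul le_rfl (by omega)
  cases k with
  | true =>
    refine ((transLoop_fire (hL true) hvec ht hen hZ hZ').seq
      ((transLoop_skip (hL false) (length_fired hvec true t)).seq rewind_spec)).congr ?_ ?_
    · have := hmono _ (L false) hZ'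
      rw [roundTime, Nat.add_mul]; omega
    · simp
  | false =>
    have h1 := transLoop_skip (c := c) (o := o) (ch := false) (bd := bd) (j := [])
      (i := letters (codeList (L false)) ++ []) (hL true) hvec
    rw [Bool.false_and, Bool.or_false] at h1
    refine (h1.seq ((transLoop_fire (hL false) hvec ht hen hZ hZ').seq rewind_spec)).congr ?_ rfl
    have := hmono _ (L true) hZ
    rw [roundTime, Nat.add_mul]; omega

theorem round_sound {L : RawSystem} (hL : L.Valid sz) (hvec : ∀ b, (vec b).length = sz b)
    (h : Exec round (sim c o false bd (input L) [] vec) n s') :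
    ∃ vec', Relation.ReflTransGen (RawStep L) vec vec' ∧ (∀ b, (vec' b).length = sz b) ∧
      s' = sim c none false bd (input L) [] vec' := by
  cases h with
  | seq h1 h2 =>
    obtain ⟨v1, hr1, hl1, rfl⟩ := transLoop_sound hL (List.Subset.refl _) hvec h1
    cases h2 with
    | seq h2 h3 =>
      obtain ⟨v2, hr2, hl2, rfl⟩ := transLoop_sound hL (List.Subset.refl _) hl1 h2
      exact ⟨v2, hr1.trans hr2, hl2, rewind_spec.eq_of_exec (det_transfer _ _ _) h3⟩

theorem verify_sound {L : RawSystem} (hL : L.Valid sz) (hvec : ∀ b, (vec b).length = sz b)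
    (h : Exec verify (sim c o false false (input L) [] vec) n s') (hs' : s'.1.bad = false) :
    ¬ ∃ vec', RawStep L vec vec' := by
  obtain ⟨n, h⟩ := (ExecLE.op (s' := sim c o true false (input L) [] vec) false rfl).exec_seq_eq
    (by simp [Prog.Det, Prim.Det]) h
  cases h with
  | seq h1 h2 =>
    obtain rfl := transLoop_check (hL true) hvec h1
    cases h2 with
    | seq h2 h3 =>
      obtain rfl := transLoop_check (hL false) hvec h2
      obtain rfl := rewind_spec.eq_of_exec (det_transfer _ _ _) h3
      rintro ⟨vec', k, t, ht, hen, -⟩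
      simp only [sim, Bool.false_or, Bool.or_eq_false_iff, List.any_eq_false] at hs'
      cases k
      · exact hs'.2 t ht hen
      · exact hs'.1 t ht hen

theorem verify_complete {L : RawSystem} (hL : L.Valid sz) (hvec : ∀ b, (vec b).length = sz b)
    (h : ¬ ∃ vec', RawStep L vec vec') :
    ExecLE verify (sim c none false false (input L) [] vec) (1 + roundTime L (size vec))
      (sim c none true false (input L) [] vec) := by
  have h1 : ∀ k, (L k).any (enabled vec k) = false := by
    intro k
    rw [List.any_eq_false]
    exact fun t ht hen => h ⟨_, k, t, ht, hen, rfl⟩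
  refine ((ExecLE.op (s' := sim c none true false (input L) [] vec) false rfl).seq
    (round_skip hL hvec)).congr le_rfl ?_
  simp [h1]

theorem run_sound {L : RawSystem} (hL : L.Valid sz) (hvec : ∀ b, (vec b).length = sz b)
    (h : Exec run (sim c none false false (input L) [] vec) n s') :
    ∃ vec', Relation.ReflTransGen (RawStep L) vec vec' ∧ (∀ b, (vec' b).length = sz b) ∧
      s' = sim c none false false (input L) [] vec' := by
  have key := Exec.loop_inv
    (I := fun s => ∃ vec', Relation.ReflTransGen (RawStep L) vec vec' ∧
      (∀ b, (vec' b).length = sz b) ∧ s = sim c none false false (input L) [] vec')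
    (R := fun s => ∃ vec' f, Relation.ReflTransGen (RawStep L) vec vec' ∧
      (∀ b, (vec' b).length = sz b) ∧ s = ({ fire := f },
        (sim c none false false (input L) [] vec').2)) ?_ ?_ ⟨vec, .refl, hvec, rfl⟩ h
  · obtain ⟨⟨vec', f, h1, h2, rfl⟩, hf⟩ := key
    dsimp only at hf
    subst hf
    exact ⟨vec', h1, h2, rfl⟩
  · rintro _ n s' ⟨vec', h1, h2, rfl⟩ h3
    cases h3 with
    | op f => exact ⟨vec', f, h1, h2, rfl⟩
  · rintro _ n s' ⟨vec', f, h1, h2, rfl⟩ - h3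
    obtain ⟨n, h3⟩ := (ExecLE.op (s' := sim c none false false (input L) [] vec') false
      rfl).exec_seq_eq (by simp [Prog.Det, Prim.Det]) h3
    obtain ⟨v2, h4, h5, rfl⟩ := round_sound hL h2 h3
    exact ⟨v2, h1.trans h4, h5, rfl⟩

/-- Each step of the run uses one round, together with a coin toss and a reset; the final 1 is the
toss that leaves the loop. -/
theorem run_complete {L : RawSystem} (hL : L.Valid sz) {T : ℕ} {x : ℕ → Bool → List ℕ}
    (hx : ∀ t < T, RawStep L (x t) (x (t + 1))) (hlen : ∀ t ≤ T, ∀ b, (x t b).length = sz b)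
    (hZ : ∀ t ≤ T, size (x t) ≤ Z) :
    ExecLE run (sim c none false false (input L) [] (x 0)) (T * (roundTime L Z + 2) + 1)
      (sim c none false false (input L) [] (x T)) := by
  induction T generalizing x with
  | zero => exact (ExecLE.loop_exit (.op false rfl) rfl).mono (by omega)
  | succ T ih =>
    refine (ExecLE.loop_next (.op true rfl) rfl (.seq (s₁ := sim c none false false (input L) []
      (x 0)) (.op false rfl) (round_step hL (hlen 0 (by omega)) (hx 0 (by omega)) (hZ 0 (by omega))
        (hZ 1 (by omega)))) (ih (x := fun t => x (t + 1)) (fun t ht => hx (t + 1) (by omega))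
        (fun t ht => hlen (t + 1) (by omega)) fun t ht => hZ (t + 1) (by omega))).mono ?_
    rw [Nat.succ_mul]
    omega

end Sim

namespace Sim

/-- The sizes and initial states of a system. -/
structure Header where
  a : ℕ
  b : ℕ
  ia : ℕ
  ib : ℕ
  hia : ia < a
  hib : ib < b

/-- The code of the header. -/
def Header.code (H : Header) : List Bool :=
  DisjSystem.encNat H.a ++ DisjSystem.encNat H.b ++ DisjSystem.encNat H.ia ++ DisjSystem.encNat H.ib

/-- The sizes. -/
def Header.sz (H : Header) : Bool → ℕ
  | true => H.a
  | false => H.b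

/-- The initial vectors, for `n` processes `B`. -/
def Header.vec (H : Header) (n : ℕ) : Bool → List ℕ
  | true => (List.replicate H.a 0).set H.ia 1
  | false => (List.replicate H.b 0).set H.ib n

theorem Header.length_vec (H : Header) (n : ℕ) (b : Bool) : (H.vec n b).length = H.sz b := by
  cases b <;> simp [vec, sz]

/-- The contents of the stacks `V` while the processes `B` are put into their initial state. -/
def Header.v (H : Header) (n : ℕ) : Bool → List Letter
  | true => encV (H.vec 0 true)
  | false => List.replicate n one ++ List.replicate (H.b - H.ib) zero

/-- The contents of the stacks `W` while the processes `B` are put into their initial state. -/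
def Header.w (H : Header) : Bool → List Letter
  | true => []
  | false => List.replicate H.ib zero

variable {i j c r : List Letter} {v w : Bool → List Letter} {k : Bool} {m : Memory}
variable {o : Option Letter} {ch bd : Bool} {sz : Bool → ℕ} {vec : Bool → List ℕ} {t : RawTrans}
  {s' : SimState} {n Z : ℕ}

/-! #### The initial phase -/

theorem initBlocks_spec : ExecLE (initBlocks k)
    (m, stk (letters (DisjSystem.encNat n) ++ i) j v w c) (2 * n + 1) ({ m with buf := some zero },
      stk i ((letters (DisjSystem.encNat n)).reverse ++ j)
        (Function.update v k (List.replicate n zero ++ v k)) w c) := by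
  induction n generalizing m j v with
  | zero =>
    refine (ExecLE.loop_exit (.op false rfl) ?_).congr le_rfl ?_
    · simp [evalOps, Prim.eval, record, DisjSystem.encNat]
    · simp [evalOps, Prim.eval, record, DisjSystem.encNat]
  | succ n ih =>
    have h1 : letters (DisjSystem.encNat (n + 1)) = one :: letters (DisjSystem.encNat n) := by
      simp [DisjSystem.encNat, List.replicate_succ]
    rw [h1]
    refine (ExecLE.loop_next move_spec rfl (.op (s' := ({ m with buf := some one },
      stk (letters (DisjSystem.encNat n) ++ i) (one :: j) (Function.update v k (zero :: v k)) w c))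
      false ?_) ih).congr ?_ ?_
    · simp [evalOps, Prim.eval]
    · omega
    · simp [List.replicate_succ']

theorem encV_replicate_zero (n : ℕ) : encV (List.replicate n 0) = List.replicate n zero := by
  induction n with
  | zero => rfl
  | succ n ih =>
    rw [encV] at ih
    simp [List.replicate_succ, encV, blk] at ih ⊢
    exact ih

theorem encV_set_replicate {a s : ℕ} (hs : s < a) (n : ℕ) :
    encV ((List.replicate a 0).set s n) =
      List.replicate s zero ++ (List.replicate n one ++ List.replicate (a - s) zero) := by
  have h1 : a - s = (a - (s + 1)) + 1 := by omega
  rw [List.set_eq_take_append_cons_drop, if_pos (by simpa using hs), List.take_replicate,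
    List.drop_replicate, min_eq_left hs.le, encV, List.map_append, enc_append, List.map_cons,
    enc_cons, ← encV, ← encV, encV_replicate_zero, encV_replicate_zero, h1, List.replicate_succ]
  rfl

theorem length_encNat (n : ℕ) : (DisjSystem.encNat n).length = n + 1 := by
  simp [DisjSystem.encNat]

theorem Header.length_code (H : Header) : H.code.length = H.a + H.b + H.ia + H.ib + 4 := by
  simp only [code, List.length_append, length_encNat]; omega

/-- The initial state of the simulation. -/
def start (c : List Letter) (l : List Letter) : SimState :=
  ({}, stk l [] (fun _ => []) (fun _ => []) c)

/-- The last `seek` leaves the block of the initial state of `B` on top of `V false`, with the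
earlier blocks on `W false`. Hence `guess` can add processes just by pushing letters. -/
theorem initA_spec (H : Header) : ExecLE initA (start c (letters H.code ++ i)) (10 * H.code.length)
    ({ buf := some zero }, stk i (letters H.code).reverse (H.v 0) H.w c) := by
  have h0 : start c (letters H.code ++ i) = ({}, stk (letters (DisjSystem.encNat H.a) ++
      (letters (DisjSystem.encNat H.b) ++ (letters (DisjSystem.encNat H.ia) ++
        (letters (DisjSystem.encNat H.ib) ++ i)))) [] (fun _ => []) (fun _ => []) c) := by
    simp [start, Header.code]
  have hset : (List.map blk (List.replicate H.a 0)).set H.ia [one] =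
      (H.vec 0 true).map blk := by
    rw [Header.vec, List.map_set]; rfl
  have h3 := visit_spec (k := true) (m := { buf := some zero })
    (i := letters (DisjSystem.encNat H.ib) ++ i)
    (j := (letters (DisjSystem.encNat H.b)).reverse ++ ((letters (DisjSystem.encNat H.a)).reverse ++
      [])) (c := c)
    (v := fun b => if b then List.replicate H.a zero else List.replicate H.b zero)
    (w := fun _ => []) (zero_notMem_map_blk (List.replicate H.a 0)) (t := H.ia)
    (by simpa using H.hia) (b' := [one]) (ops := [.push (V true) fun _ => some one])
    (m' := { buf := some zero }) (by simp [← encV_replicate_zero, encV]) rfl (by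
      intro j v w r hv
      simp [blk] at hv
      simp [evalOps, Prim.eval, hv])
  rw [hset] at h3
  have h4 := seek_spec (k := false) (m := {}) (i := i)
    (j := (letters (DisjSystem.encNat H.ia)).reverse ++ ((letters (DisjSystem.encNat H.b)).reverse ++
      ((letters (DisjSystem.encNat H.a)).reverse ++ []))) (c := c)
    (pre := List.replicate H.ib []) (r := List.replicate (H.b - H.ib) zero) (w := fun _ => [])
    (v := Function.update (fun b => if b then List.replicate H.a zero else
      List.replicate H.b zero) true (enc ((H.vec 0 true).map blk)))
    (by simp [List.mem_replicate]) (by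
      have : enc (List.replicate H.ib []) = List.replicate H.ib zero := by
        rw [← encV_replicate_zero, encV, List.map_replicate]; rfl
      rw [this, ← List.replicate_add, Nat.add_sub_cancel' H.hib.le]
      simp)
  have henc : ∀ n, enc (List.replicate n []) = List.replicate n zero := by
    intro n; rw [← encV_replicate_zero, encV, List.map_replicate]; rfl
  rw [List.length_replicate, henc] at h4
  rw [h0]
  refine (ExecLE.seq initBlocks_spec (.seq (initBlocks_spec.congr le_rfl ?_)
    (.seq h3 h4))).congr ?_ ?_
  · simp only [Prod.mk.injEq, true_and]
    congr 1
    funext b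
    cases b <;> simp
  · have := H.hia
    have := H.hib
    have h5 : (enc (List.map blk (List.replicate H.a 0))).length = H.a := by
      rw [← encV, encV_replicate_zero, List.length_replicate]
    rw [H.length_code, h5, List.length_replicate]
    omega
  · simp only [Prod.mk.injEq, true_and]
    congr 1
    · simp [Header.code]
    · funext b
      cases b <;> simp [Header.v, encV]
    · funext b
      cases b <;> simp [Header.w]

/-- The state of the machine after `n` processes `B` were chosen. -/
def guessState (H : Header) (c i : List Letter) (f : Bool) (n : ℕ) : SimState :=
  ({ buf := some zero, fire := f }, stk i (letters H.code).reverse (H.v n) H.w c)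

theorem guess_op (H : Header) (f b : Bool) (n : ℕ) :
    evalOps b [.push (V false) fun _ => some one, .flip fun b m => { m with fire := b }]
      (guessState H c i f n) = guessState H c i b (n + 1) := by
  have : Function.update (H.v n) false (one :: H.v n false) = H.v (n + 1) := by
    funext b; cases b <;> simp [Header.v, List.replicate_succ]
  simp [guessState, evalOps, Prim.eval, this]

/-- A process is pushed before each toss, so `n` tosses that continue, and one that stops, give `n +
1` processes. In particular there is at least one. -/
theorem guess_complete (H : Header) (f : Bool) (n k : ℕ) :
    ExecLE guess (guessState H c i f k) (2 * n + 1) (guessState H c i false (k + n + 1)) := by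
  induction n generalizing f k with
  | zero => exact .loop_exit (.op false (guess_op H f false k)) rfl
  | succ n ih =>
    refine (ExecLE.loop_next (.op true (guess_op H f true k)) rfl (.op false rfl)
      (ih true (k + 1))).congr (by omega) ?_
    congr 1
    omega

theorem guess_sound (H : Header) (h : Exec guess (guessState H c i false 0) n s') :
    ∃ n ≥ 1, s' = guessState H c i false n := by
  obtain ⟨⟨n, f, hn, rfl⟩, hf⟩ := Exec.loop_inv
    (I := fun s => ∃ n f, s = guessState H c i f n)
    (R := fun s => ∃ n f, n ≥ 1 ∧ s = guessState H c i f n) (by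
      rintro _ _ _ ⟨n, f, rfl⟩ h
      cases h with
      | op b => exact ⟨n + 1, b, by omega, guess_op H f b n⟩) (by
      rintro _ _ _ ⟨n, f, -, rfl⟩ - h
      cases h with
      | op b => exact ⟨n, f, rfl⟩) ⟨0, false, rfl⟩ h
  dsimp only [guessState] at hf
  subst hf
  exact ⟨n, hn, rfl⟩

theorem initB_spec (H : Header) : ExecLE initB (guessState H c i false n) (5 * H.code.length)
    (sim c none false false i [] (H.vec n)) := by
  have hW : Function.update H.w false [] = fun _ => [] := by
    funext b; cases b <;> simp [Header.w]
  have hV : Function.update (H.v n) false ((H.w false).reverse ++ H.v n false) =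
      fun b => encV (H.vec n b) := by
    funext b
    cases b
    · simp [Header.v, Header.w, Header.vec, encV_set_replicate H.hib]
    · simp [Header.v, Header.vec]
  refine (ExecLE.seq restore_spec (.seq (transfer_spec (by simp) (g := fun _ => none)
    (by simp) _ rfl) (.op false rfl))).congr ?_ ?_
  · have := H.length_code
    simp [Header.w]
    omega
  · simp [evalOps, Prim.eval, reset, sim, hW, hV]

/-- The content of the clock stack and the number of steps are arbitrary here: neither the cutoff
nor a time bound is needed for soundness. -/
theorem main_sound {H : Header} {L : RawSystem} (hL : L.Valid H.sz)
    (h : Exec main (start c (letters H.code ++ input L)) n s') (hs' : s'.1.bad = false) :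
    ∃ n ≥ 1, ∃ vec, Relation.ReflTransGen (RawStep L) (H.vec n) vec ∧
      ¬ ∃ vec', RawStep L vec vec' := by
  obtain ⟨_, h⟩ := (initA_spec H).exec_seq_eq det_initA h
  cases h with
  | seq h1 h2 =>
    obtain ⟨n, hn, rfl⟩ := guess_sound H h1
    obtain ⟨_, h⟩ := (initB_spec H).exec_seq_eq det_initB h2
    cases h with
    | seq h1 h2 =>
      obtain ⟨vec, hr, hlen, rfl⟩ := run_sound hL (H.length_vec n) h1
      exact ⟨n, hn, vec, hr, verify_sound hL hlen h2 hs'⟩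

/-- Of the `T + 1` rounds in the bound, `T` simulate the run and one verifies the deadlock. -/
theorem main_complete {H : Header} {L : RawSystem} (hL : L.Valid H.sz) (hn : 1 ≤ n) {T : ℕ}
    {x : ℕ → Bool → List ℕ} (hx0 : x 0 = H.vec n)
    (hx : ∀ t < T, RawStep L (x t) (x (t + 1))) (hlen : ∀ t ≤ T, ∀ b, (x t b).length = H.sz b)
    (hZ : ∀ t ≤ T, size (x t) ≤ Z) (hd : ¬ ∃ vec', RawStep L (x T) vec') :
    ∃ s', ExecLE main (start c (letters H.code ++ input L))
      (15 * H.code.length + 2 * n + (T + 1) * (roundTime L Z + 2)) s' ∧ s'.1.bad = false := by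
  obtain ⟨n, rfl⟩ := Nat.exists_eq_add_of_le' hn
  have hg := guess_complete (c := c) (i := input L) H false n 0
  rw [Nat.zero_add] at hg
  have hr := run_complete (c := c) hL hx hlen hZ
  rw [hx0] at hr
  refine ⟨_, ((initA_spec H).seq (.seq hg (.seq (initB_spec H) (.seq hr
    (verify_complete hL (hlen T le_rfl) hd))))).mono ?_, rfl⟩
  have : roundTime L (size (x T)) ≤ roundTime L Z := by
    have := Nat.mul_le_mul (le_refl ((L true).length + (L false).length))
      (show 20 * size (x T) + 32 ≤ 20 * Z + 32 by have := hZ T le_rfl; omega)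
    simp only [roundTime]
    omega
  rw [Nat.succ_mul T]
  omega

end Sim

/-! ### The vectors and transitions of a disjunctive system -/

section OfFn

variable {n : ℕ} {f : Fin n → ℕ}

theorem List.getD_ofFn_fin {α : Type} {n : ℕ} (f : Fin n → α) (i : Fin n) (d : α) :
    (List.ofFn f).getD i d = f i := by
  simp [List.getD_eq_getElem?_getD]

theorem List.set_ofFn_fin {α : Type} {n : ℕ} (f : Fin n → α) (i : Fin n) (x : α) :
    (List.ofFn f).set i x = List.ofFn (Function.update f i x) := by
  refine List.ext_getElem (by simp) fun m h1 h2 => ?_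
  simp only [List.getElem_set, List.getElem_ofFn, Function.update_apply, Fin.ext_iff, eq_comm]

namespace Sim

theorem decAt_ofFn (i : Fin n) :
    decAt (List.ofFn f) i = List.ofFn (f - Pi.single i 1) := by
  rw [decAt, List.getD_ofFn_fin, List.set_ofFn_fin]
  congr 1
  funext j
  by_cases h : j = i
  · subst h; simp
  · simp [h]

theorem incAt_ofFn (i : Fin n) :
    incAt (List.ofFn f) i = List.ofFn (f + Pi.single i 1) := by
  rw [incAt, List.getD_ofFn_fin, List.set_ofFn_fin]
  congr 1
  funext j
  by_cases h : j = i
  · subst h; simp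
  · simp [h]

theorem satV_ofFn {p : Fin n → Bool} :
    satV (List.ofFn p) (List.ofFn f) = true ↔ ∃ i, p i = true ∧ 1 ≤ f i := by
  have : (List.ofFn p).zip (List.ofFn f) = List.ofFn fun i => (p i, f i) :=
    List.ext_getElem (by simp) fun m h1 h2 => by simp
  simp [satV, this, List.any_eq_true, List.mem_ofFn]

theorem enabled_iff {vec : Bool → List ℕ} {k : Bool} {t : RawTrans} : enabled vec k t = true ↔
    1 ≤ (vec k).getD t.src 0 ∧ (satV (t.guard true) (others vec k t.src true) = true ∨
      satV (t.guard false) (others vec k t.src false) = true) := by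
  simp only [enabled, Bool.and_eq_true, Bool.or_eq_true, decide_eq_true_eq]

theorem length_encV (l : List ℕ) : (encV l).length = l.sum + l.length := by
  induction l with
  | nil => rfl
  | cons a l ih =>
    rw [encV] at ih
    simp only [encV, List.map_cons, enc_cons, List.length_append, List.length_cons, blk_length, ih,
      List.sum_cons]
    omega

end Sim

end OfFn

namespace DisjSystem

open Sim

/-- The sizes and the initial states. -/
def header (D : DisjSystem) : Header :=
  ⟨D.sizeA, D.sizeB, D.initA, D.initB, D.initA.2, D.initB.2⟩

/-- A transition, with numbers and characteristic vectors. -/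
def rawTrans {a b m : ℕ} (t : Fin m × Finset (Fin a ⊕ Fin b) × Fin m) : RawTrans where
  src := t.1
  tgt := t.2.2
  guard
    | true => List.ofFn fun i : Fin a => decide (Sum.inl i ∈ t.2.1)
    | false => List.ofFn fun j : Fin b => decide (Sum.inr j ∈ t.2.1)

/-- The lists of transitions. -/
def raw (D : DisjSystem) : RawSystem
  | true => D.transA.map rawTrans
  | false => D.transB.map rawTrans

theorem codeList_rawTrans {a b m : ℕ} (l : List (Fin m × Finset (Fin a ⊕ Fin b) × Fin m)) :
    codeList (l.map rawTrans) = encTransList l := by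
  rw [codeList, encTransList, List.flatMap_map]
  rfl

theorem letters_encode (D : DisjSystem) :
    letters D.encode = letters D.header.code ++ input D.raw := by
  rw [input, raw, raw, codeList_rawTrans, codeList_rawTrans, List.append_nil, ← letters_append,
    ← letters_append, encode, List.append_assoc]
  rfl

theorem raw_valid (D : DisjSystem) : D.raw.Valid D.header.sz := by
  rintro (_ | _) t ht <;> obtain ⟨⟨i, g, j⟩, -, rfl⟩ := List.mem_map.1 ht <;>
    exact ⟨i.2, j.2, by rintro (_ | _) <;> exact List.length_ofFn⟩

/-- The vectors of numbers of processes in the local states. -/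
def vecOf {a b : ℕ} (s : Config (Fin a) (Fin b)) : Bool → List ℕ
  | true => List.ofFn (Pi.single s.qA 1 : Fin a → ℕ)
  | false => List.ofFn s.c

section

variable {a b : ℕ} {s : Config (Fin a) (Fin b)}

theorem size_vecOf : size (vecOf s) = a + 1 + (b + ∑ q, s.c q) := by
  rw [size, vecOf, vecOf, length_encV, length_encV, List.length_ofFn, List.length_ofFn,
    List.sum_ofFn, List.sum_ofFn, Finset.sum_pi_single']
  simp
  omega

theorem length_vecOf (D : DisjSystem) (s : Config (Fin D.sizeA) (Fin D.sizeB)) (k : Bool) :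
    (vecOf s k).length = D.header.sz k := by
  cases k <;> exact List.length_ofFn

theorem vecOf_initialConfig (D : DisjSystem) (n : ℕ) :
    vecOf (initialConfig D.A D.B n) = D.header.vec n := by
  have h : ∀ (a x : ℕ) (i : Fin a), List.ofFn (Pi.single i x) = (List.replicate a 0).set i x := by
    intro a x i
    rw [Pi.single, ← List.set_ofFn_fin]
    congr 1
    exact List.ofFn_const a 0
  funext k
  cases k <;> exact h _ _ _

/-- Without the moving process the vector of `A` is zero, so only states of `B` can satisfy the
guard. The uniform definition `enabled` thus reproduces `SatA`. -/
theorem enabled_true {t : Fin a × Finset (Fin a ⊕ Fin b) × Fin a} :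
    enabled (vecOf s) true (rawTrans t) = true ↔ s.qA = t.1 ∧ s.SatA t.2.1 := by
  obtain ⟨i, g, j⟩ := t
  by_cases h : s.qA = i
  · subst h
    have h1 : others (vecOf s) true s.qA true = List.ofFn (0 : Fin a → ℕ) := by
      rw [others, Function.update_self, vecOf, decAt_ofFn, tsub_self]
    simp only [enabled_iff, rawTrans]
    rw [h1, satV_ofFn, vecOf, List.getD_ofFn_fin, others, Function.update_of_ne (by simp), vecOf,
      satV_ofFn]
    simp [Config.SatA]
  · simp only [enabled_iff, rawTrans]
    rw [vecOf, List.getD_ofFn_fin]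
    simp [h, Ne.symm h]

/-- Removing the mover lowers only the counter of its own state `i`, so `i` itself satisfies the
guard iff it held at least two processes. This is the third clause of `SatB`. -/
theorem enabled_false {t : Fin b × Finset (Fin a ⊕ Fin b) × Fin b} :
    enabled (vecOf s) false (rawTrans t) = true ↔ 1 ≤ s.c t.1 ∧ s.SatB t.1 t.2.1 := by
  obtain ⟨i, g, j⟩ := t
  simp only [enabled_iff, rawTrans]
  have h1 : others (vecOf s) false i true = List.ofFn (Pi.single s.qA 1 : Fin a → ℕ) := rfl
  have h2 : others (vecOf s) false i false = List.ofFn (s.c - Pi.single i 1) := by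
    rw [others, Function.update_self, vecOf, decAt_ofFn]
  rw [h1, h2, vecOf, List.getD_ofFn_fin, satV_ofFn, satV_ofFn]
  refine and_congr_right fun hi => ?_
  simp only [Config.SatB, hi, true_and, decide_eq_true_eq]
  constructor
  · rintro (⟨k, hk, h1⟩ | ⟨k, hk, h1⟩)
    · by_cases h : k = s.qA
      · exact .inl (h ▸ hk)
      · simp [h] at h1
    · by_cases h : k = i
      · subst h
        refine .inr (.inr ⟨hk, ?_⟩)
        simp at h1
        omega
      · exact .inr (.inl ⟨k, hk, h, by simpa [h] using h1⟩)
  · rintro (h | ⟨k, hk, h, h1⟩ | ⟨hk, h⟩)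
    · exact .inl ⟨_, h, by simp⟩
    · exact .inr ⟨k, hk, by simpa [h] using h1⟩
    · refine .inr ⟨i, hk, ?_⟩
      simp
      omega

theorem fired_true {t : Fin a × Finset (Fin a ⊕ Fin b) × Fin a} (h : s.qA = t.1) :
    fired (vecOf s) true (rawTrans t) = vecOf ⟨t.2.2, s.c⟩ := by
  funext k
  cases k
  · rfl
  · rw [fired, Function.update_self]
    simp only [rawTrans, vecOf]
    rw [decAt_ofFn, h, tsub_self, incAt_ofFn, zero_add]

theorem fired_false {t : Fin b × Finset (Fin a ⊕ Fin b) × Fin b} :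
    fired (vecOf s) false (rawTrans t) =
      vecOf ⟨s.qA, s.c - Pi.single t.1 1 + Pi.single t.2.2 1⟩ := by
  funext k
  cases k
  · rw [fired, Function.update_self]
    simp only [rawTrans, vecOf]
    rw [decAt_ofFn, incAt_ofFn]
  · rfl

end

/-- The vector `vec` is arbitrary, so this also says that steps from the vectors of configurations
lead only to such vectors; runs can therefore be translated back. -/
theorem rawStep_iff (D : DisjSystem) {s : Config (Fin D.sizeA) (Fin D.sizeB)}
    {vec : Bool → List ℕ} : RawStep D.raw (vecOf s) vec ↔
      ∃ s', CounterStep D.A D.B s s' ∧ vec = vecOf s' := by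
  constructor
  · rintro ⟨_ | _, _, hm, hen, rfl⟩ <;> obtain ⟨t, ht, rfl⟩ := List.mem_map.1 hm
    · obtain ⟨h1, h2⟩ := enabled_false.1 hen
      exact ⟨⟨s.qA, s.c - Pi.single t.1 1 + Pi.single t.2.2 1⟩, .inr ⟨rfl, t.1, t.2.1, t.2.2, List.mem_toFinset.2 ht,
        h1, h2, rfl⟩, fired_false⟩
    · obtain ⟨h1, h2⟩ := enabled_true.1 hen
      exact ⟨⟨t.2.2, s.c⟩, .inl ⟨rfl, t.2.1, List.mem_toFinset.2 (h1 ▸ ht), h2⟩, fired_true h1⟩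
  · rintro ⟨⟨q, c⟩, ⟨rfl, g, ht, hg⟩ | ⟨rfl, i, g, j, ht, h1, h2, rfl⟩, rfl⟩
    · exact ⟨true, _, List.mem_map_of_mem (List.mem_toFinset.1 ht), enabled_true.2 ⟨rfl, hg⟩,
        (fired_true (t := (s.qA, g, q)) rfl).symm⟩
    · exact ⟨false, _, List.mem_map_of_mem (List.mem_toFinset.1 ht), enabled_false.2 ⟨h1, h2⟩,
        (fired_false (t := (i, g, j))).symm⟩

theorem exists_of_reflTransGen_rawStep (D : DisjSystem) {s : Config (Fin D.sizeA) (Fin D.sizeB)}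
    {vec : Bool → List ℕ} (h : Relation.ReflTransGen (RawStep D.raw) (vecOf s) vec) :
    ∃ s', Relation.ReflTransGen (CounterStep D.A D.B) s s' ∧ vec = vecOf s' := by
  induction h with
  | refl => exact ⟨s, .refl, rfl⟩
  | tail _ h ih =>
    obtain ⟨s₁, h1, rfl⟩ := ih
    obtain ⟨s₂, h2, rfl⟩ := D.rawStep_iff.1 h
    exact ⟨s₂, h1.tail h2, rfl⟩

theorem deadlocked_iff (D : DisjSystem) {s : Config (Fin D.sizeA) (Fin D.sizeB)} :
    Deadlocked D.A D.B s ↔ ¬ ∃ vec, RawStep D.raw (vecOf s) vec := by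
  simp only [rawStep_iff, Deadlocked]
  refine not_congr ⟨fun ⟨s', h⟩ => ⟨_, s', h, rfl⟩, fun ⟨_, s', h, _⟩ => ⟨s', h⟩⟩

/-- If the simulation accepts, then there is a reachable deadlock. -/
theorem hasDeadlock_of_exec (D : DisjSystem) {c : List Letter} {n : ℕ} {s' : SimState}
    (h : Exec main (start c (letters D.encode)) n s') (hs' : s'.1.bad = false) :
    D.HasDeadlock := by
  rw [letters_encode] at h
  obtain ⟨n, hn, vec, hr, hd⟩ := main_sound D.raw_valid h hs'
  rw [← vecOf_initialConfig] at hr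
  obtain ⟨s, h1, rfl⟩ := D.exists_of_reflTransGen_rawStep hr
  exact ⟨n, hn, s, h1, D.deadlocked_iff.2 hd⟩

/-- If there is a reachable deadlock, then the simulation accepts within the given time. -/
theorem HasDeadlock.exists_exec {D : DisjSystem} (h : D.HasDeadlock) : ∃ n ≤ 2 * D.sizeB ^ 2,
    ∃ T < D.sizeA * (n + 1) ^ D.sizeB, ∀ c, ∃ s',
    ExecLE main (start c (letters D.encode)) (15 * D.header.code.length + 2 * n +
      (T + 1) * (roundTime D.raw (D.sizeA + 1 + (D.sizeB + n)) + 2)) s' ∧ s'.1.bad = false := by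
  obtain ⟨n, hn1, hn, s, hr, hd⟩ := HasReachableDeadlock.exists_le h
  rw [Fintype.card_fin] at hn
  obtain ⟨T, x, hT, hx0, hxT, hx, hsum⟩ := exists_short_run hr
  rw [Fintype.card_fin, Fintype.card_fin] at hT
  refine ⟨n, hn, T, hT, fun c => ?_⟩
  rw [letters_encode]
  refine main_complete (x := fun t => vecOf (x t)) D.raw_valid hn1 ?_ ?_ ?_ ?_ ?_
  · rw [hx0, vecOf_initialConfig]
  · exact fun t ht => D.rawStep_iff.2 ⟨_, hx t ht, rfl⟩
  · exact fun t _ => D.length_vecOf _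
  · intro t ht
    rw [size_vecOf, hsum t ht]
  · rw [hxT]
    exact D.deadlocked_iff.1 hd

end DisjSystem

/-! ### The clock -/

namespace Sim

/-- Empty the stack `k`, and push its letters on both `k₁` and `k₂`. -/
def dup (k k₁ k₂ : StackName) : SimProg :=
  .loop (.op [.pop k record, .push k₁ (·.buf), .push k₂ (·.buf)]) (·.buf.isSome) (.op [])

/-- Multiply the number of letters on the clock stack by `d`. -/
def multiply (d : ℕ) : SimProg :=
  .loop (.op (.pop clk record :: List.replicate d (.push (W true) (·.buf)))) (·.buf.isSome)
    (.op []) ⨟ transfer (W true) clk (·.buf)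

/-- Multiply the number of letters on the clock stack by `d`, for every letter of `V false`. -/
def multiplyPow (d : ℕ) : SimProg :=
  .loop (move (V false) (W false)) (·.buf.isSome) (multiply d) ⨟ restore false

/-- Push `d ^ ℓ ^ 2` letters on the clock stack, where `ℓ` is the length of the input. -/
def windUp (d : ℕ) : SimProg :=
  dup I J (V true) ⨟ dup J I (V false) ⨟ .op [.push clk fun _ => some one] ⨟
  .loop (.op [.pop (V true) record]) (·.buf.isSome) (multiplyPow d) ⨟
  transfer (V false) I (fun _ => none)

theorem det_windUp (d : ℕ) : (windUp d).Det := by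
  simp [windUp, multiplyPow, multiply, dup, restore, Prog.Det, Prim.Det, det_transfer, det_move]

variable {i j c : List Letter} {v w : Bool → List Letter} {m : Memory} {d n : ℕ}

theorem dup_spec {k k₁ k₂ : StackName} (h₁ : k ≠ k₁) (h₂ : k ≠ k₂) (h₁₂ : k₁ ≠ k₂)
    (S : StackName → List Letter) {l : List Letter} (hl : S k = l) :
    ExecLE (dup k k₁ k₂) (m, S) (2 * l.length + 1) ({ m with buf := none },
      Function.update (Function.update (Function.update S k []) k₁ (l.reverse ++ S k₁)) k₂
        (l.reverse ++ S k₂)) := by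
  induction l generalizing m S with
  | nil =>
    refine (ExecLE.loop_exit (.op false rfl) ?_).congr le_rfl ?_
    · simp [evalOps, Prim.eval, hl, record]
    · simp [evalOps, Prim.eval, hl, record, h₁.symm, h₂.symm, h₁₂.symm]
  | cons a l ih =>
    refine (ExecLE.loop_next (.op false ?_) (by rfl) (.op false rfl)
      (ih (m := { m with buf := some a }) (Function.update (Function.update (Function.update S k l)
        k₁ (a :: S k₁)) k₂ (a :: S k₂)) (by simp [h₁, h₂]))).congr ?_ ?_
    · simp [evalOps, Prim.eval, hl, record, h₁.symm, h₂.symm, h₁₂.symm]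
    · simp only [List.length_cons]; omega
    · simp only [Prod.mk.injEq, true_and]
      funext z
      by_cases hz₂ : z = k₂
      · subst hz₂; simp
      · by_cases hz₁ : z = k₁
        · subst hz₁; simp [h₁₂]
        · by_cases hz : z = k
          · subst hz; simp [h₁, h₂]
          · simp [hz, hz₁, hz₂]

theorem evalOps_replicate_push (b : Bool) (d : ℕ) (a : Letter) (hm : m.buf = some a) :
    evalOps b (List.replicate d (.push (W true) (·.buf))) (m, stk i j v w c) =
      (m, stk i j v (Function.update w true (List.replicate d a ++ w true)) c) := by
  induction d generalizing w with
  | zero => simp [evalOps]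
  | succ d ih =>
    rw [List.replicate_succ, evalOps]
    simp only [Prim.eval, hm, Option.toList, stk_W, update_stk_W]
    rw [ih]
    simp [List.replicate_succ']

theorem multiply_spec (hw : w true = []) :
    ExecLE (multiply d) (m, stk i j v w (List.replicate n one)) (2 * n + 1 + (2 * (d * n) + 1))
      ({ m with buf := none }, stk i j v w (List.replicate (d * n) one)) := by
  have h : ExecLE (.loop (.op (.pop clk record :: List.replicate d (.push (W true) (·.buf))))
      (·.buf.isSome) (.op [])) (m, stk i j v w (List.replicate n one)) (2 * n + 1)
      ({ m with buf := none },
        stk i j v (Function.update w true (List.replicate (d * n) one ++ w true)) []) := by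
    clear hw
    induction n generalizing m w with
    | zero =>
      have hop : evalOps false (.pop clk record :: List.replicate d (.push (W true) (·.buf)))
          (m, stk i j v w []) = ({ m with buf := none }, stk i j v w []) := by
        have : ∀ s : SimState, s.1.buf = none →
            evalOps false (List.replicate d (.push (W true) (·.buf))) s = s := by
          intro s hs
          induction d with
          | zero => rfl
          | succ d ih => simpa [List.replicate_succ, evalOps, Prim.eval, hs] using ih
        rw [evalOps, this _ (by simp [Prim.eval, record])]
        simp [Prim.eval, record]
      exact (ExecLE.loop_exit (.op false hop) rfl).congr le_rfl (by simp)
    | succ n ih =>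
      have hop : evalOps false (.pop clk record :: List.replicate d (.push (W true) (·.buf)))
          (m, stk i j v w (List.replicate (n + 1) one)) = ({ m with buf := some one },
          stk i j v (Function.update w true (List.replicate d one ++ w true))
            (List.replicate n one)) := by
        rw [evalOps, ← evalOps_replicate_push (m := { m with buf := some one }) false d one rfl]
        simp [Prim.eval, record, List.replicate_succ]
      refine (ExecLE.loop_next (.op false hop) rfl (.op false rfl) ih).congr (by omega) ?_
      simp only [Function.update_self, Function.update_idem]
      rw [Nat.mul_succ, List.replicate_add, List.append_assoc]
  refine (h.seq (transfer_spec (by simp) (g := some) (fun o => by simp) _ rfl)).congr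
    (by simp [hw]) ?_
  have : Function.update w true [] = w := by rw [← hw, Function.update_eq_self]
  simp [hw, this]

/-- As `0 < d`, the clock never shrinks, so every single multiplication is charged at the final
size. -/
theorem multiplyPow_spec (hd : 0 < d) {r : List Letter} (hv : v false = r) (hw : w = fun _ => []) :
    ExecLE (multiplyPow d) (m, stk i j v w (List.replicate n one))
      (r.length * (4 * (d ^ r.length * n) + 5) + 2)
      ({ m with buf := none }, stk i j v w (List.replicate (d ^ r.length * n) one)) := by
  have h : ∀ (r : List Letter) n v w m, v false = r → w true = [] →
      ExecLE (.loop (move (V false) (W false)) (·.buf.isSome) (multiply d))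
        (m, stk i j v w (List.replicate n one)) (r.length * (4 * (d ^ r.length * n) + 3) + 1)
        ({ m with buf := none }, stk i j (Function.update v false [])
          (Function.update w false (r.reverse ++ w false))
          (List.replicate (d ^ r.length * n) one)) := by
    intro r
    induction r with
    | nil =>
      intro n v w m hv hw
      refine (ExecLE.loop_exit (.op false rfl) ?_).congr (by simp) ?_
      · simp [evalOps, Prim.eval, record, hv]
      · simp [evalOps, Prim.eval, record, hv]
    | cons a r ih =>
      intro n v w m hv hw
      have h1 : ExecLE (move (V false) (W false)) (m, stk i j v w (List.replicate n one)) 1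
          ({ m with buf := some a }, stk i j (Function.update v false r)
            (Function.update w false (a :: w false)) (List.replicate n one)) :=
        .op false (by simp [evalOps, Prim.eval, record, hv])
      refine (ExecLE.loop_next h1 rfl (multiply_spec (by simpa using hw))
        (ih (d * n) _ _ _ (by simp) (by simpa using hw))).congr ?_ ?_
      · have h2 : d ^ r.length * (d * n) = d ^ (a :: r).length * n := by
          rw [List.length_cons, pow_succ, mul_assoc]
        have h3 : d * n ≤ d ^ (a :: r).length * n :=
          Nat.mul_le_mul_right _ (Nat.le_self_pow (by simp) d)
        have h4 : n ≤ d * n := Nat.le_mul_of_pos_left n hd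
        rw [h2, List.length_cons, Nat.succ_mul r.length,
          ← List.length_cons (a := a)]
        omega
      · simp [pow_succ, mul_assoc]
  subst hw
  refine ((h r n v _ m hv rfl).seq restore_spec).congr ?_ ?_
  · simp only [Function.update_self, List.length_append, List.length_reverse, List.length_nil]
    rw [show ∀ x, r.length * (4 * x + 5) = r.length * (4 * x + 3) + 2 * r.length by
      intro x; ring]
    omega
  · simp [← hv]

/-- Two nested loops, over two copies of the input, multiply by `d` exactly `ℓ * ℓ` times, starting
from one letter. The two copying passes reverse the input twice, so it is finally in its original
order. -/
theorem windUp_spec (hd : 0 < d) (l : List Letter) :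
    ExecLE (windUp d) (start [] l)
      (l.length * (l.length * (4 * d ^ l.length ^ 2 + 5) + 9) + 6)
      (start (List.replicate (d ^ l.length ^ 2) one) l) := by
  have h : ∀ (t : List Letter) n v m, v true = t → v false = l →
      ExecLE (.loop (.op [.pop (V true) record]) (·.buf.isSome) (multiplyPow d))
        (m, stk l [] v (fun _ => []) (List.replicate n one))
        (t.length * (l.length * (4 * (d ^ (l.length * t.length) * n) + 5) + 3) + 1)
        ({ m with buf := none }, stk l [] (Function.update v true []) (fun _ => [])
          (List.replicate (d ^ (l.length * t.length) * n) one)) := by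
    intro t
    induction t with
    | nil =>
      intro n v m hv hl
      refine (ExecLE.loop_exit (.op false rfl) ?_).congr (by simp) ?_
      · simp [evalOps, Prim.eval, record, hv]
      · simp [evalOps, Prim.eval, record, hv]
    | cons a t ih =>
      intro n v m hv hl
      have h1 : ExecLE (.op [.pop (V true) record])
          (m, stk l [] v (fun _ => []) (List.replicate n one)) 1
          ({ m with buf := some a }, stk l [] (Function.update v true t) (fun _ => [])
            (List.replicate n one)) :=
        .op false (by simp [evalOps, Prim.eval, record, hv])
      refine (ExecLE.loop_next h1 rfl (multiplyPow_spec hd (by simpa using hl) rfl)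
        (ih _ _ _ (by simp) (by simpa using hl))).congr ?_ ?_
      · have h2 : d ^ (l.length * t.length) * (d ^ l.length * n) =
            d ^ (l.length * (a :: t).length) * n := by
          rw [List.length_cons, Nat.mul_succ, pow_add, mul_assoc]
        have h3 : d ^ l.length * n ≤ d ^ (l.length * (a :: t).length) * n :=
          Nat.mul_le_mul_right _ (Nat.pow_le_pow_right hd (Nat.le_mul_of_pos_right _ (by simp)))
        have h4 : l.length * (4 * (d ^ l.length * n) + 5) ≤
            l.length * (4 * (d ^ (l.length * (a :: t).length) * n) + 5) :=
          Nat.mul_le_mul_left _ (by omega)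
        rw [h2, List.length_cons, Nat.succ_mul t.length, ← List.length_cons (a := a)]
        omega
      · simp [Nat.mul_succ, pow_add, mul_assoc]
  have h1 : ExecLE (dup I J (V true)) (start [] l) (2 * l.length + 1) ({}, stk [] l.reverse
      (Function.update (fun _ => []) true l.reverse) (fun _ => []) []) :=
    (dup_spec (by simp) (by simp) (by simp) _ rfl).congr (by simp) (by simp)
  have h2 : ExecLE (dup J I (V false)) ({}, stk [] l.reverse
      (Function.update (fun _ => []) true l.reverse) (fun _ => []) []) (2 * l.length + 1) ({},
      stk l [] (Function.update (Function.update (fun _ => []) true l.reverse) false l)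
        (fun _ => []) []) :=
    (dup_spec (by simp) (by simp) (by simp) _ rfl).congr (by simp) (by simp)
  have h3 : ExecLE (.op [.push clk fun _ => some one]) (({} : Memory), stk l []
      (Function.update (Function.update (fun _ => []) true l.reverse) false l) (fun _ => []) []) 1
      (({} : Memory), stk l [] (Function.update (Function.update (fun _ => []) true l.reverse) false l)
        (fun _ => []) (List.replicate 1 one)) :=
    .op false (by simp [evalOps, Prim.eval])
  refine (h1.seq (.seq h2 (.seq h3 (.seq (h l.reverse 1 _ {} (by simp) (by simp))
    (transfer_spec (by simp) (g := fun _ => none) (by simp) _ rfl))))).congr ?_ ?_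
  · simp [sq, Nat.mul_add]
    omega
  · simp only [start, Prod.mk.injEq, true_and, List.length_reverse, mul_one, ← sq]
    simp
    congr 1
    funext b
    cases b <;> simp

end Sim

/-! ### Time bounds -/

namespace DisjSystem

open Sim

theorem length_le_length_codeList (l : List RawTrans) : l.length + 1 ≤ (codeList l).length := by
  induction l with
  | nil => rfl
  | cons t l ih =>
    simp only [codeList, List.flatMap_cons, List.length_append, List.length_cons] at ih ⊢
    omega

/-- The time of the simulation is at most `16 ^ ℓ ^ 2`. -/
theorem time_le {l a b n T h t x : ℕ} (hl : a + b + 4 ≤ l) (hh : h ≤ l) (ht : t ≤ l) (hx : x ≤ l)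
    (hn : n ≤ 2 * b ^ 2) (hT : T < a * (n + 1) ^ b) :
    15 * h + 2 * n + (T + 1) * (t * (20 * (a + 1 + (b + n)) + 32) + 2 * x + 3 + 2) ≤
      16 ^ l ^ 2 := by
  have h2 : l < 2 ^ l := Nat.lt_two_pow_self
  have hnl : n ≤ 2 * l ^ 2 := hn.trans (Nat.mul_le_mul_left _ (Nat.pow_le_pow_left (by omega) 2))
  have hsq : l ^ 2 ≤ 2 ^ (2 * l) := by
    rw [pow_mul']
    exact Nat.pow_le_pow_left h2.le 2
  have hcube : l ^ 3 ≤ 2 ^ (3 * l) := by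
    rw [pow_mul']
    exact Nat.pow_le_pow_left h2.le 3
  have hn1 : n + 1 ≤ 2 ^ (2 * l + 2) := by
    rw [pow_add]
    have := Nat.one_le_two_pow (n := 2 * l)
    omega
  have hT' : T + 1 ≤ 2 ^ (2 * l ^ 2 + 3 * l) := calc
    T + 1 ≤ a * (n + 1) ^ b := hT
    _ ≤ 2 ^ l * (2 ^ (2 * l + 2)) ^ l := Nat.mul_le_mul (by omega)
      ((Nat.pow_le_pow_left hn1 b).trans (Nat.pow_le_pow_right (by positivity) (by omega)))
    _ = 2 ^ (2 * l ^ 2 + 3 * l) := by rw [← pow_mul, ← pow_add]; congr 1; ring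
  have hr : t * (20 * (a + 1 + (b + n)) + 32) + 2 * x + 3 + 2 ≤ 2 ^ (3 * l + 6) := calc
    _ ≤ l * (20 * (l + 2 * l ^ 2) + 32) + 2 * l + 5 := by
      have : t * (20 * (a + 1 + (b + n)) + 32) ≤ l * (20 * (l + 2 * l ^ 2) + 32) :=
        Nat.mul_le_mul ht (by omega)
      omega
    _ ≤ 2 ^ 6 * l ^ 3 := by
      -- The left side has leading term `40 * l ^ 3`; from `l = 4` on, the remaining `24 * l ^ 3`
      -- absorbs the lower terms.
      obtain ⟨k, rfl⟩ := Nat.exists_eq_add_of_le' (show 4 ≤ l by omega)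
      ring_nf
      nlinarith [sq_nonneg k]
    _ ≤ 2 ^ (3 * l + 6) := by rw [pow_add]; omega
  have hfirst : 15 * h + 2 * n ≤ 2 ^ (2 * l + 4) := by
    have : 4 * l ≤ l ^ 2 := by rw [sq]; exact Nat.mul_le_mul_right _ (by omega)
    rw [pow_add]
    omega
  calc _ ≤ 2 ^ (2 * l + 4) + 2 ^ (2 * l ^ 2 + 3 * l) * 2 ^ (3 * l + 6) :=
        Nat.add_le_add hfirst (Nat.mul_le_mul hT' hr)
    _ ≤ 2 ^ (2 * l ^ 2 + 6 * l + 6) + 2 ^ (2 * l ^ 2 + 6 * l + 6) := by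
      rw [← pow_add]
      exact Nat.add_le_add (Nat.pow_le_pow_right (by omega) (by nlinarith))
        (Nat.pow_le_pow_right (by omega) (by omega))
    _ = 2 ^ (2 * l ^ 2 + 6 * l + 7) := by ring
    -- The inequality `2 * l ^ 2 + 6 * l + 7 ≤ 4 * l ^ 2` holds from `l = 4` on. The summand 4 in
    -- `hl`, which stands for the four terminating zeros of the header, ensures this.
    _ ≤ 2 ^ (4 * l ^ 2) := Nat.pow_le_pow_right (by omega) (by nlinarith)
    _ = 16 ^ l ^ 2 := by rw [pow_mul]; norm_num

/-- Preparing the clock and letting it run down takes exponential time. -/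
theorem windUp_time_le (l : ℕ) : l * (l * (4 * 16 ^ l ^ 2 + 5) + 9) + 6 + 16 ^ l ^ 2 + 1 ≤
    2 ^ (4 * l ^ 2 + 2 * l + 5) := by
  have h1 : (16 : ℕ) ^ l ^ 2 = 2 ^ (4 * l ^ 2) := by rw [pow_mul]; norm_num
  have h2 : (l + 1) ^ 2 ≤ 2 ^ (2 * l) := by
    rw [pow_mul']
    exact Nat.pow_le_pow_left Nat.lt_two_pow_self 2
  rw [h1, add_assoc (4 * l ^ 2), pow_add, pow_add 2 (2 * l)]
  have h3 : 1 ≤ 2 ^ (4 * l ^ 2) := Nat.one_le_two_pow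
  set M := 2 ^ (4 * l ^ 2)
  calc _ ≤ M * ((l + 1) ^ 2 * 2 ^ 5) := by nlinarith [Nat.zero_le (l * (M - 1)), sq_nonneg l]
    _ ≤ _ := Nat.mul_le_mul_left _ (Nat.mul_le_mul_right _ h2)

end DisjSystem

open Sim in
/-- Deadlock detection in disjunctive systems is in NEXPTIME. -/
theorem mainTheorem1 : InNEXPTIME DisjSystem.encode DisjSystem.HasDeadlock := by
  refine ⟨clockedNTM I clk (fun b => if b then one else zero) {} {m | m.bad = false} (windUp 16)
    main, 4 * Polynomial.X ^ 2 + 2 * Polynomial.X + 5, fun D => ?_⟩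
  have hstart : (({} : Memory), Function.update (fun _ => []) I
      (D.encode.map fun b => if b then one else zero)) = start [] (letters D.encode) := by
    rw [start, Prod.mk.injEq]
    refine ⟨rfl, ?_⟩
    funext k
    cases k <;> rfl
  obtain ⟨t, ht, h⟩ := windUp_spec (d := 16) (by omega) (letters D.encode)
  rw [letters_length] at ht h
  rw [← hstart] at h
  obtain ⟨h1, h2, h3⟩ := clockedNTM_spec (clk := clk) (acc := {m : Memory | m.bad = false})
    (main := main) (det_windUp 16) avoids_main h
  have hclk : ((start (List.replicate (16 ^ D.encode.length ^ 2) one)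
      (letters D.encode)).2 clk).length = 16 ^ D.encode.length ^ 2 := List.length_replicate
  rw [hclk] at h1 h3
  refine ⟨fun k c hk => (h1 k c hk).trans ?_, fun hacc => ?_, fun hdl => ?_⟩
  · simp only [Polynomial.eval_add, Polynomial.eval_mul, Polynomial.eval_pow, Polynomial.eval_X,
      Polynomial.eval_ofNat]
    exact le_trans (by omega) (DisjSystem.windUp_time_le _)
  · obtain ⟨n, s', h4, h5⟩ := h2 hacc
    exact D.hasDeadlock_of_exec h4 h5
  · obtain ⟨n, hn, T, hT, hex⟩ := hdl.exists_exec
    obtain ⟨s', ⟨m, hm, h4⟩, h5⟩ := hex (List.replicate (16 ^ D.encode.length ^ 2) one)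
    -- It remains to see that this execution ends before the clock runs out, which is `time_le` for
    -- the length of the input.
    refine h3 m (hm.trans ?_) s' h4 h5
    have hlen := congrArg List.length D.letters_encode
    rw [List.length_append, letters_length, letters_length] at hlen
    have hcode := D.header.length_code
    have hinp : (input D.raw).length =
        (codeList (D.raw true)).length + (codeList (D.raw false)).length := by
      simp [input]
    have hL1 := DisjSystem.length_le_length_codeList (D.raw true)
    have hL2 := DisjSystem.length_le_length_codeList (D.raw false)
    have ha : D.header.a = D.sizeA := rfl
    have hb : D.header.b = D.sizeB := rfl
    exact DisjSystem.time_le (by omega) (by omega) (by omega) (by omega) hn hT
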